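/- Let $n\ge 2$, $f\in C^1(\mathbb{R})$ and $u\in W^{3,1}_{loc}(\mathbb{R}^n)$. Suppose that $u$ is a stable solution on $\mathbb{R}^n$ of the mean curvature equation $$\operatorname{div}\left(\frac{\nabla u}{\sqrt{1+|\nabla u|^2}}\right)=-f(u),$$ that is, $f(u)$ and $f'(u)$ belong to $L^1_{loc}(\mathbb{R}^n)$, $$\int_{\mathbb{R}^n}\frac{\nabla u\cdot\nabla\varphi}{\sqrt{1+|\nabla u|^2}}\,dx=\int_{\mathbb{R}^n} f(u)\,\varphi\,dx\qquad\text{for all }\varphi\in C_c^\infty(\mathbb{R}^n),$$ and $$\int_{\mathbb{R}^n} f'(u)\,\xi^2\,dx\le\int_{\mathbb{R}^n}\left(\frac{|\nabla\xi|^2}{\sqrt{1+|\nabla u|^2}}-\frac{(\nabla u\cdot\nabla\xi)^2}{(1+|\nabla u|^2)^{3/2}}\right)dx\qquad\text{for all }\xi\in C_c^\infty(\mathbb{R}^n),$$ where $\nabla u$ is the weak gradient. Set $$q_n=-1\ \text{ if } 2\le n\le 10,\qquad q_n=-\frac n2+\sqrt{n-1}+1\ \text{ if } n\ge 11.$$ 1.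 If $u$ is not (almost everywhere equal to) a constant, then there exist $c>0$ and $R_0>2$ such that $$\frac{1}{|B_{2R}\setminus B_R|}\int_{B_{2R}\setminus B_R}|\nabla u|^2\,dx\ \ge\ c\,R^{2q_n}\qquad\text{for all } R\ge R_0,$$ where $B_r$ is the ball of radius $r$ centred at the origin and the integral may be $+\infty$. 2. In particular, if $|\nabla u(x)|=o(|x|^{q_n})$ as $|x|\to\infty$ (for almost every $x$), then $u$ is (almost everywhere equal to) a constant. -/

import Mathlib

open MeasureTheory Filter Metric
open scoped ContDiff Gradient InnerProductSpace

/-- The class `C_c^∞(ℝⁿ)` of smooth compactly supported real functions. -/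
def IsTestFunction {n : ℕ} (φ : EuclideanSpace ℝ (Fin n) → ℝ) : Prop :=
  ContDiff ℝ ∞ φ ∧ HasCompactSupport φ

/-- `g ∈ L^1_loc(ℝⁿ)` is the weak `i`-th partial derivative of `u ∈ L^1_loc(ℝⁿ)`. -/
def HasWeakPartialDeriv {n : ℕ} (i : Fin n) (u g : EuclideanSpace ℝ (Fin n) → ℝ) : Prop :=
  LocallyIntegrable u volume ∧ LocallyIntegrable g volume ∧
    ∀ φ : EuclideanSpace ℝ (Fin n) → ℝ, IsTestFunction φ →
      ∫ x, u x * fderiv ℝ φ x (EuclideanSpace.single i 1) = -∫ x, g x * φ x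

/-- The local Sobolev space `W^{k,1}_loc(ℝⁿ)`: all weak partial derivatives up to order `k`
exist as functions in `L^1_loc(ℝⁿ)`. -/
def MemSobolevLoc {n : ℕ} : ℕ → (EuclideanSpace ℝ (Fin n) → ℝ) → Prop
  | 0, u => LocallyIntegrable u volume
  | k + 1, u => LocallyIntegrable u volume ∧
      ∀ i : Fin n, ∃ g : EuclideanSpace ℝ (Fin n) → ℝ,
        HasWeakPartialDeriv i u g ∧ MemSobolevLoc k g

/-- `G` is (a representative of) the weak gradient of `u ∈ W^{1,1}_loc(ℝⁿ)`. It is determined by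
`u` up to a null set. -/
def HasWeakGradient {n : ℕ} (u : EuclideanSpace ℝ (Fin n) → ℝ)
    (G : EuclideanSpace ℝ (Fin n) → EuclideanSpace ℝ (Fin n)) : Prop :=
  ∀ i : Fin n, HasWeakPartialDeriv i u (fun x => G x i)

/-- `u ∈ W^{1,1}_loc(ℝⁿ)` is a weak solution of `div (∇u / √(1 + |∇u|²)) = -f(u)` in `ℝⁿ`,
and it is stable. -/
def IsStableSolution {n : ℕ} (f : ℝ → ℝ) (u : EuclideanSpace ℝ (Fin n) → ℝ) : Prop :=
  LocallyIntegrable u volume ∧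
  LocallyIntegrable (fun x => f (u x)) volume ∧
  LocallyIntegrable (fun x => deriv f (u x)) volume ∧
  ∃ G : EuclideanSpace ℝ (Fin n) → EuclideanSpace ℝ (Fin n),
    HasWeakGradient u G ∧
    (∀ φ : EuclideanSpace ℝ (Fin n) → ℝ, IsTestFunction φ →
      ∫ x, ⟪G x, ∇ φ x⟫_ℝ / √(1 + ‖G x‖ ^ 2) = ∫ x, f (u x) * φ x) ∧
    (∀ ξ : EuclideanSpace ℝ (Fin n) → ℝ, IsTestFunction ξ →
      ∫ x, deriv f (u x) * ξ x ^ 2 ≤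
        ∫ x, (‖∇ ξ x‖ ^ 2 / √(1 + ‖G x‖ ^ 2) -
          ⟪G x, ∇ ξ x⟫_ℝ ^ 2 / (1 + ‖G x‖ ^ 2) ^ (3 / 2 : ℝ)))

/-- The exponent `q_n` (used for `n ≥ 2`). -/
noncomputable def liouvilleExponent (n : ℕ) : ℝ :=
  if n ≤ 10 then -1 else -(n : ℝ) / 2 + √((n : ℝ) - 1) + 1

/-! Write H(p) = p/√(1+|p|²) for the flux (`mcMap`), A = DH(∇u) (`mcDeriv`), s = 1/√(1+|∇u|²)
(`mcFactor`) and v = x·∇u (`radial`). The proof uses v as the multiplier in the stability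
inequality.

Differentiating the equation along the dilation field shows that A∇v − (s + s³)∇u has divergence
−f'(u)v (`dilationFlux_eq`, `weak_dilationFlux`). Test this with vη², and the stability inequality
with vη. The terms in f'(u) coincide, and on subtraction the terms A∇v·∇v and A∇v·∇η cancel as well.
What is left is 0 ≤ ∫ v² A∇η·∇η + η²(s + s³)∇u·∇v + 2ηv(s + s³)∇u·∇η (`radial_stability`). Here ∇v =
∇u + (x·∇)∇u, and (s + s³)∇u·(x·∇)∇u is the dilation derivative of |∇u|²/√(1+|∇u|²). One more
integration by parts therefore leaves only first derivatives of u
(`integral_stabilityDensity_nonneg`).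

Take η = (1+|x|²)^(-b/2) on B_R, cut off inside B_{2R}, with b = `testDecay n` the smaller of
(n−2)/2 and 1+√(n−1). In B_R the integrand is at most −`coreDensity`, by the algebraic inequality
`testDecay_form_le`. In the annulus it is at most a constant times R^(-2b)|∇u|². Hence the integral
of `coreDensity` over a fixed ball, positive for some ball unless ∇u vanishes, is bounded by C
R^(-2b) ∫|∇u|² over the annulus. Division by the volume, of order Rⁿ, gives the rate R^(2b−n) =
R^(2q_n). The second claim follows because o(|x|^(q_n)) contradicts this lower bound.

The analytic difficulty is that u is only in W^{3,1}_loc: v need not be bounded and ∇v need not be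
square integrable. Two devices deal with this. The multipliers are truncated (`trunc`, `truncSq`)
and the truncation is removed by dominated convergence. The weighted L² bounds needed for that come
from `HasWeakDerivAlong.locallyIntegrable_inner_fderiv`, which trades one more L¹ derivative for a
quadratic estimate by means of a bounded monotone map. -/

open ContinuousLinearMap
open scoped Convolution Topology ENNReal

/-! ### Mollification and its convergence. -/

section Mollification

set_option linter.unusedSectionVars false

variable {E : Type*} [NormedAddCommGroup E] [InnerProductSpace ℝ E] [FiniteDimensional ℝ E]
  [MeasurableSpace E] [BorelSpace E] {F : Type*} [NormedAddCommGroup F] [NormedSpace ℝ F]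

/-- A bump function centred at the origin supported in the ball of radius `1 / (k + 1)`. -/
noncomputable def stdBump (E : Type*) [NormedAddCommGroup E] [InnerProductSpace ℝ E] (k : ℕ) :
    ContDiffBump (0 : E) where
  rIn := 1 / (2 * ((k : ℝ) + 1))
  rOut := 1 / ((k : ℝ) + 1)
  rIn_pos := by positivity
  rIn_lt_rOut := by
    apply one_div_lt_one_div_of_lt <;> nlinarith [(Nat.cast_nonneg k : (0 : ℝ) ≤ k)]

/-- The mollification of `g` at scale `1 / (k + 1)`. -/
noncomputable def mollify (k : ℕ) (g : E → F) : E → F :=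
  (stdBump E k).normed volume ⋆[lsmul ℝ ℝ, volume] g

lemma stdBump_rOut_le_one (k : ℕ) : (stdBump E k).rOut ≤ 1 := by
  change 1 / ((k : ℝ) + 1) ≤ 1
  rw [div_le_one (by positivity)]
  linarith [(Nat.cast_nonneg k : (0 : ℝ) ≤ k)]

lemma tendsto_stdBump_rOut : Tendsto (fun k => (stdBump E k).rOut) atTop (𝓝 0) :=
  tendsto_one_div_add_atTop_nhds_zero_nat

lemma ae_tendsto_mollify [CompleteSpace F] {g : E → F} (hg : LocallyIntegrable g volume) :
    ∀ᵐ x, Tendsto (fun k => mollify k g x) atTop (𝓝 (g x)) := by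
  refine ContDiffBump.ae_convolution_tendsto_right_of_locallyIntegrable (K := 2)
    tendsto_stdBump_rOut (Eventually.of_forall fun k => ?_) hg
  change 1 / ((k : ℝ) + 1) ≤ 2 * (1 / (2 * ((k : ℝ) + 1)))
  apply le_of_eq
  field_simp

lemma mollify_apply (k : ℕ) (g : E → F) (x : E) :
    mollify k g x = ∫ t, (stdBump E k).normed volume t • g (x - t) := rfl

lemma mollify_apply_swap (k : ℕ) (g : E → F) (x : E) :
    mollify k g x = ∫ t, (stdBump E k).normed volume (x - t) • g t := by
  unfold mollify
  rw [convolution_eq_swap]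
  rfl

lemma contDiff_mollify (k : ℕ) {g : E → F} (hg : LocallyIntegrable g volume) :
    ContDiff ℝ ∞ (mollify k g) :=
  (stdBump E k).hasCompactSupport_normed.contDiff_convolution_left (n := ⊤) _
    (stdBump E k).contDiff_normed hg

lemma mollify_congr_ae (k : ℕ) {g h : E → F} (hgh : g =ᵐ[volume] h) :
    mollify k g = mollify k h := by
  unfold mollify
  exact convolution_congr _ EventuallyEq.rfl hgh

lemma convolutionExists_mollify (k : ℕ) {g : E → F} (hg : LocallyIntegrable g volume) :
    ConvolutionExists ((stdBump E k).normed volume) g (lsmul ℝ ℝ) volume :=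
  (stdBump E k).hasCompactSupport_normed.convolutionExists_left _
    (stdBump E k).continuous_normed hg

lemma mollify_sub (k : ℕ) {g h : E → F} (hg : LocallyIntegrable g volume)
    (hh : LocallyIntegrable h volume) :
    mollify k (g - h) = mollify k g - mollify k h := by
  ext x
  have h1 := (convolutionExists_mollify k hg x).integrable
  have h2 := (convolutionExists_mollify k hh x).integrable
  simp only [mollify_apply, Pi.sub_apply, smul_sub]
  exact integral_sub h1 h2

/-- The probability measure with density the standard mollifier. -/
noncomputable def mollifierMeasure (E : Type*) [NormedAddCommGroup E] [InnerProductSpace ℝ E]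
    [FiniteDimensional ℝ E] [MeasurableSpace E] [BorelSpace E] (k : ℕ) : Measure E :=
  (volume : Measure E).withDensity fun t => ENNReal.ofReal ((stdBump E k).normed volume t)

instance isProbabilityMeasure_mollifierMeasure (k : ℕ) :
    IsProbabilityMeasure (mollifierMeasure E k) := by
  constructor
  rw [mollifierMeasure, withDensity_apply _ MeasurableSet.univ, setLIntegral_univ,
    ← ofReal_integral_eq_lintegral_ofReal (stdBump E k).integrable_normed
      (Eventually.of_forall fun x => (stdBump E k).nonneg_normed x),
    ContDiffBump.integral_normed, ENNReal.ofReal_one]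

lemma enorm_mollify_le (k : ℕ) (g : E → F) (x : E) :
    ‖mollify k g x‖ₑ ≤ ∫⁻ t, ‖g (x - t)‖ₑ ∂(mollifierMeasure E k) := by
  rw [mollify_apply, mollifierMeasure, lintegral_withDensity_eq_lintegral_mul_non_measurable]
  · refine (enorm_integral_le_lintegral_enorm _).trans (lintegral_mono fun t => ?_)
    rw [enorm_smul, Real.enorm_of_nonneg ((stdBump E k).nonneg_normed t)]
    rfl
  · exact (stdBump E k).continuous_normed.measurable.ennreal_ofReal
  · exact Eventually.of_forall fun t => ENNReal.ofReal_lt_top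

/-- Jensen's inequality for the probability measure `mollifierMeasure`, then Tonelli and translation
invariance. -/
lemma eLpNorm_mollify_le (k : ℕ) {g : E → F} (hg : AEStronglyMeasurable g volume) {p : ℝ≥0∞}
    (hp : 1 ≤ p) (hp' : p ≠ ⊤) :
    eLpNorm (mollify k g) p volume ≤ eLpNorm g p volume := by
  -- Tonelli needs joint measurability of (x, t) ↦ g (x − t), which is immediate for a strongly
  -- measurable representative.
  wlog hgm : StronglyMeasurable g generalizing g
  · rw [mollify_congr_ae k hg.ae_eq_mk, eLpNorm_congr_ae hg.ae_eq_mk]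
    exact this hg.stronglyMeasurable_mk.aestronglyMeasurable hg.stronglyMeasurable_mk
  have hp0 : p ≠ 0 := (zero_lt_one.trans_le hp).ne'
  have hpr : 0 < p.toReal := ENNReal.toReal_pos hp0 hp'
  have hm : StronglyMeasurable (fun z : E × E => g (z.1 - z.2)) :=
    hgm.comp_measurable (measurable_fst.sub measurable_snd)
  have key : ∀ x, ‖mollify k g x‖ₑ ^ p.toReal ≤
      ∫⁻ t, ‖g (x - t)‖ₑ ^ p.toReal ∂(mollifierMeasure E k) := by
    intro x
    have hmx : AEStronglyMeasurable (fun t => g (x - t)) (mollifierMeasure E k) :=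
      (hgm.comp_measurable (measurable_const.sub measurable_id)).aestronglyMeasurable
    have h1 := (enorm_mollify_le k g x)
    rw [← eLpNorm_one_eq_lintegral_enorm] at h1
    have h2 := h1.trans (eLpNorm_le_eLpNorm_of_exponent_le hp hmx)
    rw [eLpNorm_eq_lintegral_rpow_enorm_toReal hp0 hp'] at h2
    calc _ ≤ _ := ENNReal.rpow_le_rpow h2 hpr.le
      _ = _ := by rw [← ENNReal.rpow_mul, one_div, inv_mul_cancel₀ hpr.ne', ENNReal.rpow_one]
  rw [eLpNorm_eq_lintegral_rpow_enorm_toReal hp0 hp',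
    eLpNorm_eq_lintegral_rpow_enorm_toReal hp0 hp']
  refine ENNReal.rpow_le_rpow ?_ (by positivity)
  calc ∫⁻ x, ‖mollify k g x‖ₑ ^ p.toReal
      ≤ ∫⁻ x, ∫⁻ t, ‖g (x - t)‖ₑ ^ p.toReal ∂(mollifierMeasure E k) := lintegral_mono key
    _ = ∫⁻ t, (∫⁻ x, ‖g (x - t)‖ₑ ^ p.toReal) ∂(mollifierMeasure E k) := by
        rw [lintegral_lintegral_swap]
        exact (hm.enorm.pow_const _).aemeasurable
    _ = ∫⁻ t, (∫⁻ x, ‖g x‖ₑ ^ p.toReal) ∂(mollifierMeasure E k) := by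
        congr 1
        ext t
        exact lintegral_sub_right_eq_self (fun x => ‖g x‖ₑ ^ p.toReal) t
    _ = _ := by simp

lemma support_mollify_subset (k : ℕ) {g : E → F} :
    Function.support (mollify k g) ⊆ cthickening 1 (tsupport g) := by
  intro x hx
  by_contra hcon
  apply hx
  rw [mollify_apply]
  refine integral_eq_zero_of_ae (Eventually.of_forall fun t => ?_)
  by_cases ht : t ∈ ball (0 : E) (stdBump E k).rOut
  · have : g (x - t) = 0 := by
      by_contra hne
      apply hcon
      refine mem_cthickening_of_dist_le x (x - t) 1 _ (subset_tsupport _ hne) ?_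
      rw [dist_eq_norm, sub_sub_cancel]
      exact (mem_ball_zero_iff.1 ht).le.trans (stdBump_rOut_le_one k)
    simp [this]
  · have : (stdBump E k).normed volume t = 0 := by
      rw [← Function.notMem_support, ContDiffBump.support_normed_eq]
      exact ht
    simp [this]

lemma HasCompactSupport.mollify {g : E → F} (hg : HasCompactSupport g) (k : ℕ) :
    HasCompactSupport (mollify k g) :=
  hg.isCompact.cthickening.of_isClosed_subset (isClosed_tsupport _)
    (closure_minimal (support_mollify_subset k) isClosed_cthickening)

lemma norm_mollify_le_of_bound (k : ℕ) {g : E → F} {C : ℝ} (hC : ∀ x, ‖g x‖ ≤ C) (x : E) :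
    ‖_root_.mollify k g x‖ ≤ C := by
  rw [mollify_apply]
  calc _ ≤ ∫ t, (stdBump E k).normed volume t * C := by
        refine norm_integral_le_of_norm_le ((stdBump E k).integrable_normed.mul_const C)
          (Eventually.of_forall fun t => ?_)
        rw [norm_smul, Real.norm_of_nonneg ((stdBump E k).nonneg_normed t)]
        exact mul_le_mul_of_nonneg_left (hC _) ((stdBump E k).nonneg_normed t)
    _ = C := by rw [integral_mul_const, ContDiffBump.integral_normed, one_mul]

lemma tendsto_eLpNorm_mollify_sub_of_continuous [CompleteSpace F] {g : E → F} (hg : Continuous g)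
    (hgs : HasCompactSupport g) {p : ℝ≥0∞} (hp : 1 ≤ p) (hp' : p ≠ ⊤) :
    Tendsto (fun k => eLpNorm (mollify k g - g) p volume) atTop (𝓝 0) := by
  have hp0 : p ≠ 0 := (zero_lt_one.trans_le hp).ne'
  obtain ⟨C, hC⟩ := hg.bounded_above_of_compact_support hgs
  set K := cthickening 1 (tsupport g)
  have hK : IsCompact K := hgs.isCompact.cthickening
  have hsub : ∀ k x, x ∉ K → (mollify k g - g) x = 0 := by
    intro k x hx
    have h1 : mollify k g x = 0 := by
      by_contra h
      exact hx (support_mollify_subset k h)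
    have h2 : g x = 0 := by
      by_contra h
      exact hx (self_subset_cthickening _ (subset_tsupport _ h))
    simp [h1, h2]
  have hpr : 0 < p.toReal := ENNReal.toReal_pos hp0 hp'
  have hmain : Tendsto (fun k => ∫⁻ x, ‖(mollify k g - g) x‖ₑ ^ p.toReal) atTop (𝓝 0) := by
    have : (0 : ℝ≥0∞) = ∫⁻ _ : E, 0 := by simp
    rw [this]
    refine tendsto_lintegral_of_dominated_convergence'
      (K.indicator fun _ => ENNReal.ofReal (C + C) ^ p.toReal) ?_ ?_ ?_ ?_
    · intro k
      exact (((contDiff_mollify k hg.locallyIntegrable).continuous.sub hg).enorm.measurable.pow_const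
        _).aemeasurable
    · intro k
      refine Eventually.of_forall fun x => ?_
      by_cases hx : x ∈ K
      · rw [Set.indicator_of_mem hx]
        refine ENNReal.rpow_le_rpow ?_ hpr.le
        rw [← ofReal_norm]
        refine ENNReal.ofReal_le_ofReal ((norm_sub_le _ _).trans ?_)
        exact add_le_add (norm_mollify_le_of_bound k hC x) (hC x)
      · simp only [hsub k x hx]
        simp [hpr]
    · rw [lintegral_indicator_const hK.measurableSet]
      exact ENNReal.mul_ne_top (ENNReal.rpow_ne_top_of_nonneg hpr.le ENNReal.ofReal_ne_top)
        hK.measure_lt_top.ne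
    · refine Eventually.of_forall fun x => ?_
      have h1 : Tendsto (fun k => mollify k g x) atTop (𝓝 (g x)) :=
        ContDiffBump.convolution_tendsto_right_of_continuous tendsto_stdBump_rOut hg x
      have h2 : Tendsto (fun k => ‖(mollify k g - g) x‖ₑ) atTop (𝓝 0) := by
        have := (h1.sub_const (g x)).enorm
        simpa using this
      have := (ENNReal.continuous_rpow_const (y := p.toReal)).continuousAt.tendsto.comp h2
      simpa [hpr, Function.comp_def] using this
  have := (ENNReal.continuous_rpow_const (y := 1 / p.toReal)).continuousAt.tendsto.comp hmain
  simp only [eLpNorm_eq_lintegral_rpow_enorm_toReal hp0 hp']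
  simpa [hpr, Function.comp_def] using this

/-- Density of compactly supported continuous functions, together with the uniform contraction bound
`eLpNorm_mollify_le`. -/
lemma tendsto_eLpNorm_mollify_sub [CompleteSpace F] {g : E → F} {p : ℝ≥0∞} (hp : 1 ≤ p)
    (hp' : p ≠ ⊤) (hg : MemLp g p volume) :
    Tendsto (fun k => eLpNorm (mollify k g - g) p volume) atTop (𝓝 0) := by
  rw [ENNReal.tendsto_nhds_zero]
  intro ε hε
  have hε3 : ε / 3 ≠ 0 := (ENNReal.div_pos hε.ne' (by norm_num)).ne'
  obtain ⟨h, hhs, hgh, hhc, hhL⟩ := hg.exists_hasCompactSupport_eLpNorm_sub_le hp' hε3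
  have hh := tendsto_eLpNorm_mollify_sub_of_continuous hhc hhs hp hp'
  rw [ENNReal.tendsto_nhds_zero] at hh
  filter_upwards [hh (ε / 3) (pos_iff_ne_zero.2 hε3)] with k hk
  have hgl := hg.locallyIntegrable hp
  have hhl := hhL.locallyIntegrable hp
  have e : mollify k g - g = mollify k (g - h) + ((mollify k h - h) + (h - g)) := by
    rw [mollify_sub k hgl hhl]; abel
  have m1 : AEStronglyMeasurable (mollify k (g - h)) volume :=
    (contDiff_mollify k (hgl.sub hhl)).continuous.aestronglyMeasurable
  have m2 : AEStronglyMeasurable (mollify k h - h) volume :=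
    ((contDiff_mollify k hhl).continuous.sub hhc).aestronglyMeasurable
  have m3 : AEStronglyMeasurable (h - g) volume := hhL.1.sub hg.1
  rw [e]
  calc _ ≤ _ := eLpNorm_add_le m1 (m2.add m3) hp
    _ ≤ ε / 3 + (ε / 3 + ε / 3) := by
        refine add_le_add ((eLpNorm_mollify_le k (hg.1.sub hhL.1) hp hp').trans hgh) ?_
        refine (eLpNorm_add_le m2 m3 hp).trans (add_le_add hk ?_)
        rw [eLpNorm_sub_comm]
        exact hgh
    _ = ε := by rw [← add_assoc]; exact ENNReal.add_thirds ε

lemma mollify_eq_of_eqOn (k : ℕ) {g h : E → F} {x : E} (hgh : ∀ y ∈ ball x 1, g y = h y) :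
    mollify k g x = mollify k h x := by
  rw [mollify_apply, mollify_apply]
  refine integral_congr_ae (Eventually.of_forall fun t => ?_)
  by_cases ht : t ∈ ball (0 : E) (stdBump E k).rOut
  · have : g (x - t) = h (x - t) := by
      apply hgh
      rw [mem_ball, dist_eq_norm, sub_sub_cancel_left, norm_neg]
      exact (mem_ball_zero_iff.1 ht).trans_le (stdBump_rOut_le_one k)
    simp [this]
  · have : (stdBump E k).normed volume t = 0 := by
      rw [← Function.notMem_support, ContDiffBump.support_normed_eq]
      exact ht
    simp [this]

/-- Mollifications of a locally integrable function converge in `L¹` on balls. -/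
lemma tendsto_lintegral_mollify_sub [CompleteSpace F] {g : E → F}
    (hg : LocallyIntegrable g volume) (r : ℝ) :
    Tendsto (fun k => ∫⁻ x in ball (0 : E) r, ‖mollify k g x - g x‖ₑ) atTop (𝓝 0) := by
  -- Every mollifier is supported in the unit ball, so on the ball of radius r only the values of g
  -- up to radius r + 1 matter.
  set h : E → F := (closedBall (0 : E) (r + 1)).indicator g
  have hh : Integrable h volume :=
    (hg.integrableOn_isCompact (isCompact_closedBall _ _)).integrable_indicator
      isClosed_closedBall.measurableSet
  have h1 := tendsto_eLpNorm_mollify_sub le_rfl ENNReal.one_ne_top (memLp_one_iff_integrable.2 hh)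
  refine tendsto_of_tendsto_of_tendsto_of_le_of_le tendsto_const_nhds h1 (fun _ => zero_le)
    fun k => ?_
  rw [eLpNorm_one_eq_lintegral_enorm]
  calc ∫⁻ x in ball (0 : E) r, ‖mollify k g x - g x‖ₑ
      = ∫⁻ x in ball (0 : E) r, ‖(mollify k h - h) x‖ₑ := by
        refine setLIntegral_congr_fun measurableSet_ball fun x hx => ?_
        have hgh : ∀ y ∈ ball x 1, g y = h y := by
          intro y hy
          refine (Set.indicator_of_mem ?_ _).symm
          rw [mem_closedBall, dist_zero_right]
          rw [mem_ball, dist_eq_norm] at hy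
          rw [mem_ball, dist_zero_right] at hx
          calc ‖y‖ = ‖(y - x) + x‖ := by rw [sub_add_cancel]
            _ ≤ _ := norm_add_le _ _
            _ ≤ _ := by linarith
        simp only [Pi.sub_apply]
        rw [mollify_eq_of_eqOn k hgh, hgh x (mem_ball_self one_pos)]
    _ ≤ _ := setLIntegral_le_lintegral _ _

end Mollification

/-! ### Calculus of directional weak derivatives. -/

section WeakDerivative

set_option linter.unusedSectionVars false

variable {E : Type*} [NormedAddCommGroup E] [InnerProductSpace ℝ E] [FiniteDimensional ℝ E]
  [MeasurableSpace E] [BorelSpace E]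
  {F : Type*} [NormedAddCommGroup F] [NormedSpace ℝ F]
  {F' : Type*} [NormedAddCommGroup F'] [NormedSpace ℝ F']

/-- `W` is the weak derivative of `U` in the direction `e`; both are locally integrable. -/
def HasWeakDerivAlong (e : E) (U W : E → F) : Prop :=
  LocallyIntegrable U volume ∧ LocallyIntegrable W volume ∧
    ∀ φ : E → ℝ, ContDiff ℝ ∞ φ → HasCompactSupport φ →
      ∫ x, fderiv ℝ φ x e • U x = -∫ x, φ x • W x

lemma continuous_fderiv_apply_of_contDiff {φ : E → F} (hφ : ContDiff ℝ ∞ φ) (e : E) :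
    Continuous fun x => fderiv ℝ φ x e :=
  (hφ.continuous_fderiv (by simp)).clm_apply continuous_const

lemma contDiff_fderiv_apply {φ : E → F} (hφ : ContDiff ℝ ∞ φ) (e : E) :
    ContDiff ℝ ∞ fun x => fderiv ℝ φ x e :=
  (hφ.fderiv_right (m := ∞) (by simp)).clm_apply contDiff_const

lemma hasCompactSupport_fderiv_apply_of {φ : E → F} (hφ : HasCompactSupport φ) (e : E) :
    HasCompactSupport fun x => fderiv ℝ φ x e :=
  (hφ.fderiv (𝕜 := ℝ)).comp_left (g := fun L : E →L[ℝ] F => L e) (by simp)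

lemma MeasureTheory.LocallyIntegrable.integrable_test_smul {U : E → F}
    (hU : LocallyIntegrable U volume)
    {φ : E → ℝ} (hφ : Continuous φ) (hs : HasCompactSupport φ) :
    Integrable (fun x => φ x • U x) volume :=
  MeasureTheory.LocallyIntegrable.integrable_smul_left_of_hasCompactSupport hU hφ hs

lemma MeasureTheory.LocallyIntegrable.integrable_test_mul {U : E → ℝ}
    (hU : LocallyIntegrable U volume) {φ : E → ℝ} (hφ : Continuous φ) (hs : HasCompactSupport φ) :
    Integrable (fun x => φ x * U x) volume :=
  hU.integrable_test_smul hφ hs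

lemma locallyIntegrable_norm {U : E → F} (hU : LocallyIntegrable U volume) :
    LocallyIntegrable (fun x => ‖U x‖) volume := fun x => by
  obtain ⟨s, hs, hi⟩ := hU x
  exact ⟨s, hs, hi.norm⟩

/-- Dominated convergence against a test function. -/
lemma tendsto_integral_test_smul {U : ℕ → E → F} {V : E → F} {b : E → ℝ} {φ : E → ℝ}
    (hφ : Continuous φ) (hs : HasCompactSupport φ) (hb : LocallyIntegrable b volume)
    (hU : ∀ k, AEStronglyMeasurable (U k) volume) (hbd : ∀ k, ∀ᵐ x, ‖U k x‖ ≤ b x)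
    (hlim : ∀ᵐ x, Tendsto (fun k => U k x) atTop (𝓝 (V x))) :
    Tendsto (fun k => ∫ x, φ x • U k x) atTop (𝓝 (∫ x, φ x • V x)) := by
  refine tendsto_integral_of_dominated_convergence (fun x => ‖φ x‖ * b x) (fun k => ?_) ?_
    (fun k => ?_) ?_
  · exact hφ.aestronglyMeasurable.smul (hU k)
  · exact LocallyIntegrable.integrable_test_smul hb hφ.norm hs.norm
  · filter_upwards [hbd k] with x hx
    rw [norm_smul]
    exact mul_le_mul_of_nonneg_left hx (norm_nonneg _)
  · filter_upwards [hlim] with x hx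
    exact hx.const_smul _

/-- Convergence in `L¹` on balls gives convergence of integrals against test functions. -/
lemma tendsto_integral_test_smul_of_lintegral {U : ℕ → E → F} {V : E → F} {φ : E → ℝ}
    (hφ : Continuous φ) (hs : HasCompactSupport φ)
    (hU : ∀ k, LocallyIntegrable (U k) volume) (hV : LocallyIntegrable V volume)
    (hlim : ∀ r, Tendsto (fun k => ∫⁻ x in ball (0 : E) r, ‖U k x - V x‖ₑ) atTop (𝓝 0)) :
    Tendsto (fun k => ∫ x, φ x • U k x) atTop (𝓝 (∫ x, φ x • V x)) := by
  obtain ⟨C, hC⟩ := hφ.bounded_above_of_compact_support hs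
  obtain ⟨r, hr⟩ := hs.isCompact.isBounded.subset_ball (0 : E)
  refine tendsto_integral_of_L1 _ (hφ.aestronglyMeasurable.smul hV.aestronglyMeasurable)
    (Eventually.of_forall fun k => LocallyIntegrable.integrable_test_smul (hU k) hφ hs) ?_
  have h0 : Tendsto (fun k => ENNReal.ofReal C * ∫⁻ x in ball (0 : E) r, ‖U k x - V x‖ₑ) atTop
      (𝓝 0) := by
    have := ENNReal.Tendsto.const_mul (hlim r) (Or.inr (ENNReal.ofReal_ne_top (r := C)))
    simpa using this
  refine tendsto_of_tendsto_of_tendsto_of_le_of_le tendsto_const_nhds h0 (fun _ => zero_le)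
    fun k => ?_
  simp only
  rw [← lintegral_const_mul' _ _ ENNReal.ofReal_ne_top, ← lintegral_indicator measurableSet_ball]
  refine lintegral_mono fun x => ?_
  rw [Pi.smul_apply', ← smul_sub, enorm_smul]
  by_cases hx : x ∈ ball (0 : E) r
  · rw [Set.indicator_of_mem hx]
    gcongr
    rw [← ofReal_norm]
    exact ENNReal.ofReal_le_ofReal (hC x)
  · have : φ x = 0 := by
      by_contra h
      exact hx (hr (subset_tsupport _ h))
    simp [this]

namespace HasWeakDerivAlong

variable {e e' : E} {U U' W W' : E → F}

lemma congr (h : HasWeakDerivAlong e U W) (hU : U =ᵐ[volume] U') (hW : W =ᵐ[volume] W') :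
    HasWeakDerivAlong e U' W' := by
  refine ⟨h.1.congr hU, h.2.1.congr hW, fun φ hφ hs => ?_⟩
  have h1 : ∫ x, fderiv ℝ φ x e • U x = ∫ x, fderiv ℝ φ x e • U' x :=
    integral_congr_ae (by filter_upwards [hU] with x hx; rw [hx])
  have h2 : ∫ x, φ x • W x = ∫ x, φ x • W' x :=
    integral_congr_ae (by filter_upwards [hW] with x hx; rw [hx])
  rw [← h1, ← h2]
  exact h.2.2 φ hφ hs

lemma unique [CompleteSpace F] (h : HasWeakDerivAlong e U W) (h' : HasWeakDerivAlong e U W') :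
    W =ᵐ[volume] W' := by
  refine ae_eq_of_integral_contDiff_smul_eq h.2.1 h'.2.1 fun φ hφ hs => ?_
  exact neg_injective ((h.2.2 φ hφ hs).symm.trans (h'.2.2 φ hφ hs))

lemma add (h : HasWeakDerivAlong e U W) (h' : HasWeakDerivAlong e U' W') :
    HasWeakDerivAlong e (fun x => U x + U' x) (fun x => W x + W' x) := by
  refine ⟨h.1.add h'.1, h.2.1.add h'.2.1, fun φ hφ hs => ?_⟩
  have c := continuous_fderiv_apply_of_contDiff hφ e
  have s := hasCompactSupport_fderiv_apply_of hs e
  simp only [smul_add]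
  rw [integral_add (LocallyIntegrable.integrable_test_smul h.1 c s)
      (LocallyIntegrable.integrable_test_smul h'.1 c s),
    integral_add (LocallyIntegrable.integrable_test_smul h.2.1 hφ.continuous hs)
      (LocallyIntegrable.integrable_test_smul h'.2.1 hφ.continuous hs),
    h.2.2 φ hφ hs, h'.2.2 φ hφ hs, neg_add]

lemma clm [CompleteSpace F] [CompleteSpace F'] (h : HasWeakDerivAlong e U W) (L : F →L[ℝ] F') :
    HasWeakDerivAlong e (fun x => L (U x)) (fun x => L (W x)) := by
  have hL : ∀ {V : E → F}, LocallyIntegrable V volume →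
      LocallyIntegrable (fun x => L (V x)) volume :=
    fun hV x => by
      obtain ⟨s, hs, hi⟩ := hV x
      exact ⟨s, hs, L.integrable_comp hi⟩
  refine ⟨hL h.1, hL h.2.1, fun φ hφ hs => ?_⟩
  have c := continuous_fderiv_apply_of_contDiff hφ e
  have s := hasCompactSupport_fderiv_apply_of hs e
  have h1 := L.integral_comp_comm (LocallyIntegrable.integrable_test_smul h.1 c s)
  have h2 := L.integral_comp_comm (LocallyIntegrable.integrable_test_smul h.2.1 hφ.continuous hs)
  simp only [map_smul] at h1 h2
  rw [h1, h2, h.2.2 φ hφ hs, map_neg]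

lemma neg [CompleteSpace F] (h : HasWeakDerivAlong e U W) :
    HasWeakDerivAlong e (fun x => -U x) (fun x => -W x) := by
  simpa using h.clm (-ContinuousLinearMap.id ℝ F)

lemma sub [CompleteSpace F] (h : HasWeakDerivAlong e U W) (h' : HasWeakDerivAlong e U' W') :
    HasWeakDerivAlong e (fun x => U x - U' x) (fun x => W x - W' x) := by
  simpa [sub_eq_add_neg] using h.add h'.neg

lemma zero : HasWeakDerivAlong e (fun _ : E => (0 : F)) (fun _ => 0) :=
  ⟨locallyIntegrable_zero, locallyIntegrable_zero, fun φ _ _ => by simp⟩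

lemma sum {ι : Type*} (s : Finset ι) {U W : ι → E → F}
    (h : ∀ i ∈ s, HasWeakDerivAlong e (U i) (W i)) :
    HasWeakDerivAlong e (fun x => ∑ i ∈ s, U i x) (fun x => ∑ i ∈ s, W i x) := by
  classical
  induction s using Finset.induction_on with
  | empty => simpa using zero
  | insert a s ha ih =>
    simp only [Finset.sum_insert ha]
    exact (h a (Finset.mem_insert_self a s)).add
      (ih fun i hi => h i (Finset.mem_insert_of_mem hi))

lemma prodMk [CompleteSpace F] [CompleteSpace F'] {V Z : E → F'} (h : HasWeakDerivAlong e U W)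
    (h' : HasWeakDerivAlong e V Z) :
    HasWeakDerivAlong e (fun x => (U x, V x)) (fun x => (W x, Z x)) := by
  simpa using (h.clm (ContinuousLinearMap.inl ℝ F F')).add
    (h'.clm (ContinuousLinearMap.inr ℝ F F'))

lemma smooth_smul (h : HasWeakDerivAlong e U W) {η : E → ℝ} (hη : ContDiff ℝ ∞ η) :
    HasWeakDerivAlong e (fun x => η x • U x) (fun x => fderiv ℝ η x e • U x + η x • W x) := by
  have cη := continuous_fderiv_apply_of_contDiff hη e
  have i1 : LocallyIntegrable (fun x => η x • U x) volume := h.1.continuous_smul hη.continuous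
  have i2 : LocallyIntegrable (fun x => fderiv ℝ η x e • U x) volume := h.1.continuous_smul cη
  have i3 : LocallyIntegrable (fun x => η x • W x) volume := h.2.1.continuous_smul hη.continuous
  refine ⟨i1, i2.add i3, fun φ hφ hs => ?_⟩
  have c := continuous_fderiv_apply_of_contDiff hφ e
  have s := hasCompactSupport_fderiv_apply_of hs e
  have key := h.2.2 (fun x => η x * φ x) (hη.mul hφ) hs.mul_left
  have hd : ∀ x, fderiv ℝ (fun x => η x * φ x) x e • U x =
      fderiv ℝ φ x e • η x • U x + φ x • fderiv ℝ η x e • U x := by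
    intro x
    rw [fderiv_fun_mul (hη.differentiable (by simp) x) (hφ.differentiable (by simp) x)]
    simp only [add_apply, smul_apply, smul_eq_mul, add_smul,
      smul_smul]
    congr 2; ring
  simp only [hd] at key
  rw [integral_add (LocallyIntegrable.integrable_test_smul i1 c s)
    (LocallyIntegrable.integrable_test_smul i2 hφ.continuous hs)] at key
  simp only [smul_add]
  rw [integral_add (LocallyIntegrable.integrable_test_smul i2 hφ.continuous hs)
    (LocallyIntegrable.integrable_test_smul i3 hφ.continuous hs)]
  have e3 : ∫ x, (η x * φ x) • W x = ∫ x, φ x • η x • W x := by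
    congr 1 with x
    rw [smul_smul, mul_comm]
  rw [e3] at key
  rw [eq_sub_of_add_eq key]
  abel

/-- Mixed weak derivatives commute. -/
lemma comm [CompleteSpace F] {W₁ W₂ W₁₂ W₂₁ : E → F} (h₁ : HasWeakDerivAlong e U W₁)
    (h₂ : HasWeakDerivAlong e' U W₂) (h₁₂ : HasWeakDerivAlong e' W₁ W₁₂)
    (h₂₁ : HasWeakDerivAlong e W₂ W₂₁) : W₁₂ =ᵐ[volume] W₂₁ := by
  refine ae_eq_of_integral_contDiff_smul_eq h₁₂.2.1 h₂₁.2.1 fun φ hφ hs => ?_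
  have a1 := h₁₂.2.2 φ hφ hs
  have a2 := h₁.2.2 _ (contDiff_fderiv_apply hφ e') (hasCompactSupport_fderiv_apply_of hs e')
  have b1 := h₂₁.2.2 φ hφ hs
  have b2 := h₂.2.2 _ (contDiff_fderiv_apply hφ e) (hasCompactSupport_fderiv_apply_of hs e)
  -- Both mixed derivatives are transferred to the test function, whose second derivative is
  -- symmetric.
  have hsymm : ∀ x, fderiv ℝ (fun x => fderiv ℝ φ x e') x e =
      fderiv ℝ (fun x => fderiv ℝ φ x e) x e' := by
    intro x
    have hd : DifferentiableAt ℝ (fderiv ℝ φ) x :=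
      (hφ.fderiv_right (m := 1) (by norm_cast)).differentiable (by simp) x
    rw [fderiv_clm_apply hd (differentiableAt_const _),
      fderiv_clm_apply hd (differentiableAt_const _)]
    simp only [fderiv_fun_const, Pi.zero_apply, ContinuousLinearMap.comp_zero, zero_add,
      ContinuousLinearMap.flip_apply]
    exact (hφ.contDiffAt.isSymmSndFDerivAt (by simp; norm_cast)) e e'
  simp only [hsymm] at a2
  rw [a2] at b2
  rw [← neg_inj, ← a1, ← b1]
  exact neg_injective b2

/-- Weak derivatives pass to limits that are dominated and hold almost everywhere. -/
lemma of_tendsto {Us Ws : ℕ → E → F} {b c : E → ℝ} (h : ∀ k, HasWeakDerivAlong e (Us k) (Ws k))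
    (hb : LocallyIntegrable b volume) (hc : LocallyIntegrable c volume)
    (hUb : ∀ k, ∀ᵐ x, ‖Us k x‖ ≤ b x) (hWc : ∀ k, ∀ᵐ x, ‖Ws k x‖ ≤ c x)
    (hU : ∀ᵐ x, Tendsto (fun k => Us k x) atTop (𝓝 (U x)))
    (hW : ∀ᵐ x, Tendsto (fun k => Ws k x) atTop (𝓝 (W x))) :
    HasWeakDerivAlong e U W := by
  have aux : ∀ {Vs : ℕ → E → F} {V : E → F} {b : E → ℝ}, (∀ k, LocallyIntegrable (Vs k) volume) →
      LocallyIntegrable b volume → (∀ k, ∀ᵐ x, ‖Vs k x‖ ≤ b x) →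
      (∀ᵐ x, Tendsto (fun k => Vs k x) atTop (𝓝 (V x))) → LocallyIntegrable V volume := by
    intro Vs V b hVs hb hbd hlim
    refine hb.mono (aestronglyMeasurable_of_tendsto_ae atTop
      (fun k => (hVs k).aestronglyMeasurable) hlim) ?_
    filter_upwards [hlim, ae_all_iff.2 hbd] with x hx hbx
    refine (le_of_tendsto hx.norm (Eventually.of_forall hbx)).trans (le_abs_self _)
  refine ⟨aux (fun k => (h k).1) hb hUb hU, aux (fun k => (h k).2.1) hc hWc hW,
    fun φ hφ hs => ?_⟩
  have l1 := tendsto_integral_test_smul (continuous_fderiv_apply_of_contDiff hφ e)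
    (hasCompactSupport_fderiv_apply_of hs e) hb (fun k => (h k).1.aestronglyMeasurable) hUb hU
  have l2 := tendsto_integral_test_smul hφ.continuous hs hc
    (fun k => (h k).2.1.aestronglyMeasurable) hWc hW
  refine tendsto_nhds_unique l1 (l2.neg.congr fun k => ?_)
  exact ((h k).2.2 φ hφ hs).symm

/-- Differentiation commutes with mollification. -/
lemma fderiv_mollify [CompleteSpace F] (h : HasWeakDerivAlong e U W) (k : ℕ) (x : E) :
    fderiv ℝ (mollify k U) x e = mollify k W x := by
  set ρ := (stdBump E k).normed volume with hρdef
  have hρ : ContDiff ℝ ∞ ρ := (stdBump E k).contDiff_normed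
  have hρs : HasCompactSupport ρ := (stdBump E k).hasCompactSupport_normed
  have h1 := hρs.hasFDerivAt_convolution_left (lsmul ℝ ℝ) (hρ.of_le (by simp)) h.1 x
  have h1' : fderiv ℝ (mollify k U) x = _ := h1.fderiv
  rw [h1', convolution_eq_swap]
  have hint : Integrable (fun t => (precompL E (lsmul ℝ ℝ : ℝ →L[ℝ] F →L[ℝ] F))
      (fderiv ℝ ρ (x - t)) (U t)) volume := by
    have := (hρs.fderiv (𝕜 := ℝ)).convolutionExists_left
      (precompL E (lsmul ℝ ℝ : ℝ →L[ℝ] F →L[ℝ] F)) (hρ.continuous_fderiv (by simp)) h.1 x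
    exact this.integrable_swap
  rw [ContinuousLinearMap.integral_apply hint]
  have hψ : ContDiff ℝ ∞ fun t => ρ (x - t) := hρ.comp (contDiff_const.sub contDiff_id)
  have hψs : HasCompactSupport fun t => ρ (x - t) :=
    hρs.comp_homeomorph (Homeomorph.subLeft x)
  have h2 := h.2.2 _ hψ hψs
  have hd : ∀ t, fderiv ℝ (fun t => ρ (x - t)) t e = -fderiv ℝ ρ (x - t) e := by
    intro t
    have : HasFDerivAt (fun t => ρ (x - t)) 
        ((fderiv ℝ ρ (x - t)).comp (-ContinuousLinearMap.id ℝ E)) t :=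
      ((hρ.differentiable (by simp)) (x - t)).hasFDerivAt.comp t
        ((hasFDerivAt_id t).const_sub x)
    rw [this.fderiv]
    simp
  simp only [hd, neg_smul, integral_neg, neg_inj] at h2
  rw [mollify_apply_swap, ← h2]
  rfl

lemma of_contDiff_comp {V : E → F} (hV : ContDiff ℝ 1 V) (e : E) :
    HasWeakDerivAlong e V fun x => fderiv ℝ V x e := by
  have c1 : Continuous fun x => fderiv ℝ V x e :=
    (hV.continuous_fderiv (by simp)).clm_apply continuous_const
  refine ⟨hV.continuous.locallyIntegrable, c1.locallyIntegrable, fun φ hφ hs => ?_⟩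
  have c := continuous_fderiv_apply_of_contDiff hφ e
  have s := hasCompactSupport_fderiv_apply_of hs e
  rw [eq_neg_iff_add_eq_zero, add_comm, ← eq_neg_iff_add_eq_zero]
  exact integral_smul_fderiv_eq_neg_fderiv_smul_of_integrable
    (LocallyIntegrable.integrable_test_smul hV.continuous.locallyIntegrable c s)
    (LocallyIntegrable.integrable_test_smul c1.locallyIntegrable hφ.continuous hs)
    (LocallyIntegrable.integrable_test_smul hV.continuous.locallyIntegrable hφ.continuous hs)
    (fun x _ => hφ.differentiable (by simp) x) (fun x _ => hV.differentiable (by simp) x)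

/-- Chain rule for weak derivatives. -/
lemma comp_of_bounded_fderiv [CompleteSpace F] [CompleteSpace F'] (h : HasWeakDerivAlong e U W)
    {Φ : F → F'} (hΦ : ContDiff ℝ 1 Φ) {C : ℝ} (hC : ∀ y, ‖fderiv ℝ Φ y‖ ≤ C) :
    HasWeakDerivAlong e (fun x => Φ (U x)) (fun x => fderiv ℝ Φ (U x) (W x)) := by
  have hC0 : 0 ≤ C := (norm_nonneg _).trans (hC 0)
  have hlip : ∀ y z, ‖Φ y - Φ z‖ ≤ C * ‖y - z‖ := fun y z =>
    convex_univ.norm_image_sub_le_of_norm_fderiv_le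
      (fun y _ => hΦ.differentiable (by simp) y) (fun y _ => hC y) trivial trivial
  have cD : Continuous (fderiv ℝ Φ) := hΦ.continuous_fderiv (by simp)
  have mU := h.1.aestronglyMeasurable
  have mW := h.2.1.aestronglyMeasurable
  have lU : LocallyIntegrable (fun x => Φ (U x)) volume := by
    have hb : LocallyIntegrable (fun x => C * ‖U x‖ + ‖Φ 0‖) volume :=
      ((locallyIntegrable_norm h.1).smul C).add (locallyIntegrable_const _)
    refine hb.mono (hΦ.continuous.comp_aestronglyMeasurable mU)
      (Eventually.of_forall fun x => ?_)
    rw [Real.norm_of_nonneg (by positivity)]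
    calc ‖Φ (U x)‖ = ‖(Φ (U x) - Φ 0) + Φ 0‖ := by rw [sub_add_cancel]
      _ ≤ ‖Φ (U x) - Φ 0‖ + ‖Φ 0‖ := norm_add_le _ _
      _ ≤ _ := by
        have := hlip (U x) 0
        rw [sub_zero] at this
        linarith
  have mD : ∀ {V Z : E → F}, AEStronglyMeasurable V volume → AEStronglyMeasurable Z volume →
      AEStronglyMeasurable (fun x => fderiv ℝ Φ (V x) (Z x)) volume := fun hV hZ =>
    isBoundedBilinearMap_apply.continuous.comp_aestronglyMeasurable
      ((cD.comp_aestronglyMeasurable hV).prodMk hZ)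
  have lD : ∀ {V Z : E → F}, AEStronglyMeasurable V volume → LocallyIntegrable Z volume →
      LocallyIntegrable (fun x => fderiv ℝ Φ (V x) (Z x)) volume := fun hV hZ =>
    ((locallyIntegrable_norm hZ).smul C).mono (mD hV hZ.aestronglyMeasurable)
      (Eventually.of_forall fun x => by
      simp only [Pi.smul_apply, smul_eq_mul]
      rw [Real.norm_of_nonneg (by positivity)]
      exact (le_opNorm _ _).trans (mul_le_mul_of_nonneg_right (hC _) (norm_nonneg _)))
  refine ⟨lU, lD mU h.2.1, fun φ hφ hs => ?_⟩
  -- The classical chain rule holds for the mollifications. It remains to pass to the limit in L¹ on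
  -- balls on both sides.
  have cm : ∀ k, ContDiff ℝ ∞ (mollify k U) := fun k => contDiff_mollify k h.1
  have cc : ∀ k, ContDiff ℝ 1 (fun x => Φ (mollify k U x)) := fun k =>
    hΦ.comp ((cm k).of_le (by simp))
  have hk : ∀ k, HasWeakDerivAlong e (fun x => Φ (mollify k U x))
      (fun x => fderiv ℝ Φ (mollify k U x) (mollify k W x)) := by
    intro k
    refine (of_contDiff_comp (cc k) e).congr EventuallyEq.rfl (Eventually.of_forall fun x => ?_)
    have := fderiv_comp x (hΦ.differentiable (by simp) (mollify k U x))
      ((cm k).differentiable (by simp) x)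
    simp only [Function.comp_def] at this
    simp only [this, ContinuousLinearMap.comp_apply, h.fderiv_mollify]
  have l1 := tendsto_integral_test_smul_of_lintegral (continuous_fderiv_apply_of_contDiff hφ e)
    (hasCompactSupport_fderiv_apply_of hs e) (fun k => (hk k).1) lU (fun r => by
      have h0 := ENNReal.Tendsto.const_mul (tendsto_lintegral_mollify_sub h.1 r)
        (Or.inr (ENNReal.ofReal_ne_top (r := C)))
      rw [mul_zero] at h0
      refine tendsto_of_tendsto_of_tendsto_of_le_of_le tendsto_const_nhds h0 (fun _ => zero_le)
        fun k => ?_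
      simp only
      rw [← lintegral_const_mul' _ _ ENNReal.ofReal_ne_top]
      refine lintegral_mono fun x => ?_
      rw [← ofReal_norm, ← ofReal_norm, ← ENNReal.ofReal_mul hC0]
      exact ENNReal.ofReal_le_ofReal (hlip _ _))
  -- The error is split as Φ'(U_k)(W_k − W) + (Φ'(U_k) − Φ'(U))W. The first part is bounded by C‖W_k
  -- − W‖, and the second tends to zero by dominated convergence with majorant 2C‖W‖.
  have l2 := tendsto_integral_test_smul_of_lintegral hφ.continuous hs (fun k => (hk k).2.1)
    (lD mU h.2.1) (fun r => by
      have h0 := ENNReal.Tendsto.const_mul (tendsto_lintegral_mollify_sub h.2.1 r)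
        (Or.inr (ENNReal.ofReal_ne_top (r := C)))
      rw [mul_zero] at h0
      have h1 : Tendsto (fun k => ∫⁻ x in ball (0 : E) r,
          ‖fderiv ℝ Φ (mollify k U x) (W x) - fderiv ℝ Φ (U x) (W x)‖ₑ) atTop (𝓝 0) := by
        have : (0 : ℝ≥0∞) = ∫⁻ _ in ball (0 : E) r, 0 := by simp
        rw [this]
        refine tendsto_lintegral_of_dominated_convergence'
          (fun x => ENNReal.ofReal (C + C) * ‖W x‖ₑ) (fun k => ?_) (fun k => ?_) ?_ ?_
        · exact ((mD (cm k).continuous.aestronglyMeasurable mW).sub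
            (mD mU mW)).enorm.restrict
        · refine Eventually.of_forall fun x => ?_
          simp only
          rw [← ofReal_norm, ← ofReal_norm, ← ENNReal.ofReal_mul (by positivity)]
          refine ENNReal.ofReal_le_ofReal ((norm_sub_le _ _).trans ?_)
          rw [add_mul]
          exact add_le_add
            ((le_opNorm _ _).trans (mul_le_mul_of_nonneg_right (hC _) (norm_nonneg _)))
            ((le_opNorm _ _).trans (mul_le_mul_of_nonneg_right (hC _) (norm_nonneg _)))
        · rw [lintegral_const_mul' _ _ ENNReal.ofReal_ne_top]
          refine ENNReal.mul_ne_top ENNReal.ofReal_ne_top ?_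
          exact (((h.2.1.integrableOn_isCompact (isCompact_closedBall 0 r)).mono_set
            ball_subset_closedBall).2).ne
        · filter_upwards [ae_restrict_of_ae (ae_tendsto_mollify h.1)] with x hx
          have hc : Continuous fun y => fderiv ℝ Φ y (W x) := cD.clm_apply continuous_const
          have := (((hc.tendsto (U x)).comp hx).sub_const (fderiv ℝ Φ (U x) (W x))).enorm
          simpa using this
      have h2 := h0.add h1
      rw [add_zero] at h2
      refine tendsto_of_tendsto_of_tendsto_of_le_of_le tendsto_const_nhds h2 (fun _ => zero_le)
        fun k => ?_
      simp only
      rw [← lintegral_const_mul' _ _ ENNReal.ofReal_ne_top, ← lintegral_add_right']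
      · refine lintegral_mono fun x => ?_
        have e1 : fderiv ℝ Φ (mollify k U x) (mollify k W x) - fderiv ℝ Φ (U x) (W x) =
          fderiv ℝ Φ (mollify k U x) (mollify k W x - W x) +
            (fderiv ℝ Φ (mollify k U x) (W x) - fderiv ℝ Φ (U x) (W x)) := by
          rw [map_sub]; abel
        rw [e1]
        refine (enorm_add_le _ _).trans (add_le_add ?_ le_rfl)
        rw [← ofReal_norm, ← ofReal_norm, ← ENNReal.ofReal_mul hC0]
        exact ENNReal.ofReal_le_ofReal
          ((le_opNorm _ _).trans (mul_le_mul_of_nonneg_right (hC _) (norm_nonneg _)))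
      · exact ((mD (cm k).continuous.aestronglyMeasurable mW).sub (mD mU mW)).enorm.restrict)
  refine tendsto_nhds_unique l1 (l2.neg.congr fun k => ?_)
  exact ((hk k).2.2 φ hφ hs).symm

end HasWeakDerivAlong

/-- A function all of whose weak derivatives vanish is almost everywhere constant. -/
lemma ae_const_of_hasWeakDerivAlong_zero [CompleteSpace F] {U : E → F}
    (h : ∀ e, HasWeakDerivAlong e U fun _ => 0) : ∃ b : F, U =ᵐ[volume] fun _ => b := by
  have hU := (h 0).1
  -- The mollifications are smooth with zero derivative, hence constant, and they converge to U
  -- almost everywhere.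
  have hconst : ∀ k x, mollify k U x = mollify k U 0 := by
    intro k x
    refine is_const_of_fderiv_eq_zero (𝕜 := ℝ) ((contDiff_mollify k hU).differentiable (by simp))
      (fun y => ?_) x 0
    ext e
    rw [(h e).fderiv_mollify, mollify_apply]
    simp
  obtain ⟨x₀, hx₀⟩ := (ae_tendsto_mollify hU).exists
  refine ⟨U x₀, ?_⟩
  filter_upwards [ae_tendsto_mollify hU] with x hx
  refine tendsto_nhds_unique hx (hx₀.congr fun k => ?_)
  rw [hconst k x, hconst k x₀]

end WeakDerivative

/-! ### Algebra of the mean curvature flux and of its derivatives. -/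

section MeanCurvatureMap

set_option linter.unusedSectionVars false

variable {V : Type*} [NormedAddCommGroup V] [InnerProductSpace ℝ V]

/-- The factor `1 / √(1 + |p|²)`. -/
noncomputable def mcFactor (p : V) : ℝ := (√(1 + ‖p‖ ^ 2))⁻¹

/-- The mean curvature flux `p / √(1 + |p|²)`. -/
noncomputable def mcMap (p : V) : V := mcFactor p • p

/-- The derivative of the mean curvature flux. -/
noncomputable def mcDeriv (p : V) : V →L[ℝ] V :=
  mcFactor p • ContinuousLinearMap.id ℝ V - mcFactor p ^ 3 • (innerSL ℝ p).smulRight p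

lemma mcFactor_pos (p : V) : 0 < mcFactor p := by unfold mcFactor; positivity

lemma mcFactor_sq (p : V) : mcFactor p ^ 2 * (1 + ‖p‖ ^ 2) = 1 := by
  unfold mcFactor
  rw [inv_pow, Real.sq_sqrt (by positivity)]
  exact inv_mul_cancel₀ (by positivity)

lemma mcFactor_le_one (p : V) : mcFactor p ≤ 1 := by
  nlinarith [mcFactor_sq p, mcFactor_pos p, mul_nonneg (sq_nonneg (mcFactor p)) (sq_nonneg ‖p‖)]

lemma mcFactor_mul_norm_le_one (p : V) : mcFactor p * ‖p‖ ≤ 1 := by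
  have h0 : 0 ≤ mcFactor p * ‖p‖ := mul_nonneg (mcFactor_pos p).le (norm_nonneg p)
  nlinarith [mcFactor_sq p, sq_nonneg (mcFactor p)]

lemma mcDeriv_apply (p q : V) :
    mcDeriv p q = mcFactor p • q - (mcFactor p ^ 3 * ⟪p, q⟫_ℝ) • p := by
  simp [mcDeriv, smul_smul]

lemma contDiff_mcFactor : ContDiff ℝ ∞ (mcFactor : V → ℝ) := by
  unfold mcFactor
  refine ContDiff.inv (ContDiff.sqrt (contDiff_const.add (contDiff_norm_sq ℝ)) fun p => ?_)
    fun p => ?_ <;> positivity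

lemma contDiff_mcMap : ContDiff ℝ ∞ (mcMap : V → V) := contDiff_mcFactor.smul contDiff_id

lemma contDiff_mcDeriv : ContDiff ℝ ∞ (mcDeriv : V → V →L[ℝ] V) := by
  unfold mcDeriv
  refine (contDiff_mcFactor.smul contDiff_const).sub ((contDiff_mcFactor.pow 3).smul ?_)
  exact ((innerSL ℝ).contDiff).smulRight contDiff_id

lemma hasFDerivAt_mcFactor (p : V) :
    HasFDerivAt (mcFactor : V → ℝ) (-(mcFactor p ^ 3) • innerSL ℝ p) p := by
  have h1 : HasFDerivAt (fun p : V => 1 + ‖p‖ ^ 2) (2 • innerSL ℝ p) p :=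
    (hasStrictFDerivAt_norm_sq p).hasFDerivAt.const_add 1
  have hpos : (0 : ℝ) < 1 + ‖p‖ ^ 2 := by positivity
  have h2 := (hasDerivAt_inv (by positivity : √(1 + ‖p‖ ^ 2) ≠ 0)).comp_hasFDerivAt p
    (h1.sqrt hpos.ne')
  refine h2.congr_fderiv ?_
  ext q
  simp only [mcFactor, smul_apply, innerSL_apply_apply, smul_eq_mul, nsmul_eq_mul]
  rw [Real.sq_sqrt hpos.le]
  have hs : √(1 + ‖p‖ ^ 2) ^ 2 = 1 + ‖p‖ ^ 2 := Real.sq_sqrt hpos.le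
  have hs0 : 0 < √(1 + ‖p‖ ^ 2) := by positivity
  generalize √(1 + ‖p‖ ^ 2) = s at *
  rw [← hs]
  field_simp
  push_cast
  ring

lemma hasFDerivAt_mcMap (p : V) : HasFDerivAt (mcMap : V → V) (mcDeriv p) p := by
  have h := (hasFDerivAt_mcFactor p).smul (hasFDerivAt_id p)
  refine h.congr_fderiv ?_
  ext q
  simp [mcDeriv_apply, sub_eq_add_neg]

lemma fderiv_mcMap (p : V) : fderiv ℝ (mcMap : V → V) p = mcDeriv p := (hasFDerivAt_mcMap p).fderiv

lemma norm_mcMap_le_one (p : V) : ‖mcMap p‖ ≤ 1 := by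
  rw [mcMap, norm_smul, Real.norm_of_nonneg (mcFactor_pos p).le]
  exact mcFactor_mul_norm_le_one p

lemma norm_mcDeriv_apply_le (p q : V) : ‖mcDeriv p q‖ ≤ 2 * ‖q‖ := by
  rw [mcDeriv_apply]
  refine (norm_sub_le _ _).trans ?_
  rw [norm_smul, norm_smul, Real.norm_of_nonneg (mcFactor_pos p).le, Real.norm_eq_abs, abs_mul,
    abs_of_nonneg (pow_nonneg (mcFactor_pos p).le 3)]
  have h1 := mcFactor_pos p
  have h2 := mcFactor_le_one p
  have h3 := mcFactor_mul_norm_le_one p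
  have h4 := abs_real_inner_le_norm p q
  have h5 : mcFactor p ^ 3 * |⟪p, q⟫_ℝ| * ‖p‖ ≤ mcFactor p ^ 3 * (‖p‖ * ‖q‖) * ‖p‖ := by gcongr
  have h6 : mcFactor p ^ 3 * (‖p‖ * ‖q‖) * ‖p‖ =
    mcFactor p * ((mcFactor p * ‖p‖) * (mcFactor p * ‖p‖)) * ‖q‖ := by ring
  have h0 : 0 ≤ mcFactor p * ‖p‖ := by positivity
  have h7 : mcFactor p * ((mcFactor p * ‖p‖) * (mcFactor p * ‖p‖)) ≤ 1 * (1 * 1) := by gcongr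
  have h8 : mcFactor p * ‖q‖ ≤ 1 * ‖q‖ := by gcongr
  have h9 := mul_le_mul_of_nonneg_right h7 (norm_nonneg q)
  linarith

lemma norm_mcDeriv_le (p : V) : ‖mcDeriv p‖ ≤ 2 :=
  opNorm_le_bound _ (by norm_num) (norm_mcDeriv_apply_le p)

lemma mcDeriv_self (p : V) : mcDeriv p p = mcFactor p ^ 3 • p := by
  rw [mcDeriv_apply, ← sub_smul, real_inner_self_eq_norm_sq]
  congr 1
  linear_combination (- mcFactor p) * mcFactor_sq p

lemma inner_mcDeriv_apply (p q r : V) :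
    ⟪mcDeriv p q, r⟫_ℝ = mcFactor p * ⟪q, r⟫_ℝ - mcFactor p ^ 3 * (⟪p, q⟫_ℝ * ⟪p, r⟫_ℝ) := by
  rw [mcDeriv_apply, inner_sub_left, real_inner_smul_left, real_inner_smul_left]
  ring

lemma inner_mcDeriv_comm (p q r : V) : ⟪mcDeriv p q, r⟫_ℝ = ⟪q, mcDeriv p r⟫_ℝ := by
  rw [real_inner_comm (mcDeriv p r) q, inner_mcDeriv_apply, inner_mcDeriv_apply,
    real_inner_comm r q]
  ring

lemma inner_mcDeriv_self (p q : V) :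
    ⟪mcDeriv p q, q⟫_ℝ = mcFactor p * ‖q‖ ^ 2 - mcFactor p ^ 3 * ⟪p, q⟫_ℝ ^ 2 := by
  rw [inner_mcDeriv_apply, real_inner_self_eq_norm_sq]
  ring

/-- By Cauchy–Schwarz the form is at least s³|q|² with s = `mcFactor p`, since s² (1 + |p|²) = 1.
The flux is therefore monotone. -/
lemma inner_mcDeriv_self_nonneg (p q : V) : 0 ≤ ⟪mcDeriv p q, q⟫_ℝ := by
  rw [inner_mcDeriv_self]
  have h1 := mcFactor_pos p
  have h2 : ⟪p, q⟫_ℝ ^ 2 ≤ ‖p‖ ^ 2 * ‖q‖ ^ 2 := by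
    rw [← mul_pow]
    exact sq_le_sq' (by linarith [neg_abs_le ⟪p, q⟫_ℝ, abs_real_inner_le_norm p q])
      (real_inner_le_norm p q)
  have h3 := mcFactor_sq p
  have h4 : mcFactor p ^ 3 * ⟪p, q⟫_ℝ ^ 2 ≤ mcFactor p ^ 3 * (‖p‖ ^ 2 * ‖q‖ ^ 2) := by gcongr
  have h5 : mcFactor p ^ 3 * (‖p‖ ^ 2 * ‖q‖ ^ 2) =
      mcFactor p * (1 - mcFactor p ^ 2) * ‖q‖ ^ 2 := by
    linear_combination (mcFactor p * ‖q‖ ^ 2) * h3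
  have h6 : 0 ≤ mcFactor p * mcFactor p ^ 2 * ‖q‖ ^ 2 := by positivity
  nlinarith

lemma inner_mcDeriv_self_le (p q : V) : ⟪mcDeriv p q, q⟫_ℝ ≤ mcFactor p * ‖q‖ ^ 2 := by
  rw [inner_mcDeriv_self]
  have : 0 ≤ mcFactor p ^ 3 * ⟪p, q⟫_ℝ ^ 2 :=
    mul_nonneg (pow_nonneg (mcFactor_pos p).le 3) (sq_nonneg _)
  linarith

lemma inner_mcDeriv_self_le_sq (p q : V) : ⟪mcDeriv p q, q⟫_ℝ ≤ ‖q‖ ^ 2 :=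
  (inner_mcDeriv_self_le p q).trans
    (mul_le_of_le_one_left (sq_nonneg _) (mcFactor_le_one p))

lemma two_mul_abs_inner_mcDeriv_le (p q r : V) :
    2 * |⟪mcDeriv p q, r⟫_ℝ| ≤ ⟪mcDeriv p q, q⟫_ℝ + ⟪mcDeriv p r, r⟫_ℝ := by
  have h1 := inner_mcDeriv_self_nonneg p (q + r)
  have h2 := inner_mcDeriv_self_nonneg p (q - r)
  have h3 : ⟪mcDeriv p r, q⟫_ℝ = ⟪mcDeriv p q, r⟫_ℝ := by
    rw [inner_mcDeriv_comm, real_inner_comm]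
  simp only [map_add, map_sub, inner_add_left, inner_add_right, inner_sub_left, inner_sub_right,
    h3] at h1 h2
  have : |⟪mcDeriv p q, r⟫_ℝ| ≤ (⟪mcDeriv p q, q⟫_ℝ + ⟪mcDeriv p r, r⟫_ℝ) / 2 := by
    rw [abs_le]
    constructor <;> linarith
  linarith

lemma inner_mcDeriv_add_le (p q r : V) :
    ⟪mcDeriv p (q + r), q + r⟫_ℝ ≤ 2 * (⟪mcDeriv p q, q⟫_ℝ + ⟪mcDeriv p r, r⟫_ℝ) := by
  have h2 := inner_mcDeriv_self_nonneg p (q - r)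
  have h3 : ⟪mcDeriv p r, q⟫_ℝ = ⟪mcDeriv p q, r⟫_ℝ := by
    rw [inner_mcDeriv_comm, real_inner_comm]
  simp only [map_add, map_sub, inner_add_left, inner_add_right, inner_sub_left, inner_sub_right,
    h3] at h2 ⊢
  linarith

/-- The point is the gain `mcFactor p ^ 2`: the product of two Hessian entries of u is locally
integrable only with this weight. Each factor |p| in the second derivative is absorbed by one factor
`mcFactor p`. The constant is 1 + 3 + 1 + 1, one contribution for each of the four terms. -/
lemma norm_fderiv_mcDeriv_apply_le (p e q : V) :
    ‖fderiv ℝ (mcDeriv : V → V →L[ℝ] V) p e q‖ ≤ 6 * mcFactor p ^ 2 * (‖e‖ * ‖q‖) := by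
  have hd : DifferentiableAt ℝ (mcDeriv : V → V →L[ℝ] V) p :=
    contDiff_mcDeriv.differentiable (by simp) p
  have h1 : fderiv ℝ (mcDeriv : V → V →L[ℝ] V) p e q =
      fderiv ℝ (fun p : V => mcDeriv p q) p e := by
    rw [fderiv_clm_apply hd (differentiableAt_const _)]
    simp
  have h2 := ((hasFDerivAt_mcFactor p).smul_const q).sub
      ((((hasFDerivAt_mcFactor p).pow 3).mul
        ((innerSL ℝ q).hasFDerivAt (x := p))).smul (hasFDerivAt_id p))
  have h3 : (fun p : V => mcDeriv p q) = (fun y => mcFactor y • q) -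
      ((fun x => mcFactor x ^ 3) * (innerSL ℝ q : V → ℝ)) • (_root_.id : V → V) := by
    funext y
    simp [mcDeriv_apply, real_inner_comm]
  have hs := mcFactor_pos p
  have hs1 := mcFactor_le_one p
  have hsp := mcFactor_mul_norm_le_one p
  have hsp0 : 0 ≤ mcFactor p * ‖p‖ := by positivity
  have h4 : fderiv ℝ (mcDeriv : V → V →L[ℝ] V) p e q =
      (-(mcFactor p ^ 3 * ⟪p, e⟫_ℝ)) • q + (3 * mcFactor p ^ 5 * ⟪p, e⟫_ℝ * ⟪p, q⟫_ℝ) • p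
        + (-(mcFactor p ^ 3 * ⟪q, e⟫_ℝ)) • p + (-(mcFactor p ^ 3 * ⟪p, q⟫_ℝ)) • e := by
    rw [h1, h3, h2.fderiv]
    simp only [sub_apply, smulRight_apply, smul_apply, add_apply, innerSL_apply_apply, Pi.mul_apply,
      smul_eq_mul, nsmul_eq_mul, _root_.id, ContinuousLinearMap.id_apply, real_inner_comm p q]
    module
  rw [h4]
  have hA : mcFactor p ^ 3 * ‖p‖ ≤ mcFactor p ^ 2 := by
    calc mcFactor p ^ 3 * ‖p‖ = mcFactor p ^ 2 * (mcFactor p * ‖p‖) := by ring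
      _ ≤ mcFactor p ^ 2 * 1 := by gcongr
      _ = _ := mul_one _
  have hB : mcFactor p ^ 5 * ‖p‖ * ‖p‖ * ‖p‖ ≤ mcFactor p ^ 2 := by
    calc mcFactor p ^ 5 * ‖p‖ * ‖p‖ * ‖p‖
        = mcFactor p ^ 2 * ((mcFactor p * ‖p‖) * (mcFactor p * ‖p‖) * (mcFactor p * ‖p‖)) := by ring
      _ ≤ mcFactor p ^ 2 * (1 * 1 * 1) := by gcongr
      _ = _ := by ring
  have t1 : ‖(-(mcFactor p ^ 3 * ⟪p, e⟫_ℝ)) • q‖ ≤ mcFactor p ^ 2 * (‖e‖ * ‖q‖) := by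
    rw [norm_smul, norm_neg, norm_mul, Real.norm_of_nonneg (by positivity), Real.norm_eq_abs]
    calc _ ≤ mcFactor p ^ 3 * (‖p‖ * ‖e‖) * ‖q‖ := by gcongr; exact abs_real_inner_le_norm p e
      _ = (mcFactor p ^ 3 * ‖p‖) * (‖e‖ * ‖q‖) := by ring
      _ ≤ _ := by gcongr
  have t2 : ‖(3 * mcFactor p ^ 5 * ⟪p, e⟫_ℝ * ⟪p, q⟫_ℝ) • p‖ ≤
      3 * (mcFactor p ^ 2 * (‖e‖ * ‖q‖)) := by
    rw [norm_smul, norm_mul, norm_mul, Real.norm_of_nonneg (by positivity), Real.norm_eq_abs,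
      Real.norm_eq_abs]
    calc _ ≤ 3 * mcFactor p ^ 5 * (‖p‖ * ‖e‖) * (‖p‖ * ‖q‖) * ‖p‖ := by
          gcongr
          exacts [abs_real_inner_le_norm p e, abs_real_inner_le_norm p q]
      _ = 3 * ((mcFactor p ^ 5 * ‖p‖ * ‖p‖ * ‖p‖) * (‖e‖ * ‖q‖)) := by ring
      _ ≤ _ := by gcongr
  have t3 : ‖(-(mcFactor p ^ 3 * ⟪q, e⟫_ℝ)) • p‖ ≤ mcFactor p ^ 2 * (‖e‖ * ‖q‖) := by
    rw [norm_smul, norm_neg, norm_mul, Real.norm_of_nonneg (by positivity), Real.norm_eq_abs]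
    calc _ ≤ mcFactor p ^ 3 * (‖q‖ * ‖e‖) * ‖p‖ := by gcongr; exact abs_real_inner_le_norm q e
      _ = (mcFactor p ^ 3 * ‖p‖) * (‖e‖ * ‖q‖) := by ring
      _ ≤ _ := by gcongr
  have t4 : ‖(-(mcFactor p ^ 3 * ⟪p, q⟫_ℝ)) • e‖ ≤ mcFactor p ^ 2 * (‖e‖ * ‖q‖) := by
    rw [norm_smul, norm_neg, norm_mul, Real.norm_of_nonneg (by positivity), Real.norm_eq_abs]
    calc _ ≤ mcFactor p ^ 3 * (‖p‖ * ‖q‖) * ‖e‖ := by gcongr; exact abs_real_inner_le_norm p q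
      _ = (mcFactor p ^ 3 * ‖p‖) * (‖e‖ * ‖q‖) := by ring
      _ ≤ _ := by gcongr
  refine (norm_add_le _ _).trans ((add_le_add (norm_add₃_le) le_rfl).trans ?_)
  linarith

/-- The truncation `q / √(1 + δ²|q|²)`. -/
noncomputable def trunc (δ : ℝ) (q : V) : V := mcFactor (δ • q) • q

lemma contDiff_trunc (δ : ℝ) : ContDiff ℝ ∞ (trunc δ : V → V) :=
  (contDiff_mcFactor.comp (contDiff_const_smul δ)).smul contDiff_id

/-- The truncation is the rescaled flux δ⁻¹ `mcMap` (δ q), so its derivative is again `mcDeriv` and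
the bounds for the flux apply uniformly in δ. -/
lemma hasFDerivAt_trunc {δ : ℝ} (hδ : δ ≠ 0) (q : V) :
    HasFDerivAt (trunc δ : V → V) (mcDeriv (δ • q)) q := by
  have h1 : HasFDerivAt (fun q : V => δ • q) (δ • ContinuousLinearMap.id ℝ V) q :=
    (hasFDerivAt_id q).const_smul δ
  have h2 := ((hasFDerivAt_mcMap (δ • q)).comp q h1).const_smul δ⁻¹
  have h3 : (trunc δ : V → V) = δ⁻¹ • (mcMap ∘ fun q => δ • q) := by
    funext q
    simp only [trunc, mcMap, Pi.smul_apply, Function.comp_apply, smul_comm _ δ q, smul_smul]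
    rw [inv_mul_cancel_left₀ hδ]
  rw [h3]
  refine h2.congr_fderiv ?_
  ext z
  simp [smul_smul, hδ]

lemma norm_trunc_le (δ : ℝ) (q : V) : ‖trunc δ q‖ ≤ ‖q‖ := by
  rw [trunc, norm_smul, Real.norm_of_nonneg (mcFactor_pos _).le]
  exact mul_le_of_le_one_left (norm_nonneg q) (mcFactor_le_one _)

lemma norm_trunc_le_inv {δ : ℝ} (hδ : 0 < δ) (q : V) : ‖trunc δ q‖ ≤ δ⁻¹ := by
  rw [trunc, norm_smul, Real.norm_of_nonneg (mcFactor_pos _).le, ← one_div,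
    le_div_iff₀ hδ]
  have := mcFactor_mul_norm_le_one (δ • q)
  rw [norm_smul, Real.norm_of_nonneg hδ.le] at this
  linarith

lemma tendsto_mcFactor_smul {δ : ℕ → ℝ} (hδ : Tendsto δ atTop (𝓝 0)) (q : V) :
    Tendsto (fun k => mcFactor (δ k • q)) atTop (𝓝 1) := by
  have h := (contDiff_mcFactor (V := V)).continuous.tendsto 0
  have h1 : mcFactor (0 : V) = 1 := by simp [mcFactor]
  rw [h1] at h
  have h2 := hδ.smul_const q
  rw [zero_smul] at h2
  exact h.comp h2

lemma tendsto_trunc {δ : ℕ → ℝ} (hδ : Tendsto δ atTop (𝓝 0)) (q : V) :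
    Tendsto (fun k => trunc (δ k) q) atTop (𝓝 q) := by
  simpa [trunc] using (tendsto_mcFactor_smul hδ q).smul_const q

lemma tendsto_mcDeriv_smul {δ : ℕ → ℝ} (hδ : Tendsto δ atTop (𝓝 0)) (q z : V) :
    Tendsto (fun k => mcDeriv (δ k • q) z) atTop (𝓝 z) := by
  have h2 := hδ.smul_const q
  rw [zero_smul] at h2
  have h : Continuous fun p : V => mcDeriv p z :=
    contDiff_mcDeriv.continuous.clm_apply continuous_const
  have h3 := (h.tendsto 0).comp h2
  have h1 : mcFactor (0 : V) = 1 := by simp [mcFactor]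
  simpa [mcDeriv_apply, h1, Function.comp_def] using h3

end MeanCurvatureMap

/-! ### Product rule and quadratic estimate by truncation. -/

section Product

set_option linter.unusedSectionVars false

variable {E : Type*} [NormedAddCommGroup E] [InnerProductSpace ℝ E] [FiniteDimensional ℝ E]
  [MeasurableSpace E] [BorelSpace E]
  {F₁ F₂ F₃ : Type*} [NormedAddCommGroup F₁] [NormedSpace ℝ F₁] [CompleteSpace F₁]
  [NormedAddCommGroup F₂] [InnerProductSpace ℝ F₂] [CompleteSpace F₂]
  [NormedAddCommGroup F₃] [NormedSpace ℝ F₃] [CompleteSpace F₃]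

/-- Product rule: `Φ(U)` acts linearly on `Q`, where `Φ` is bounded with bounded derivative, and
the term that contains the derivative of `Φ(U)` is dominated by a locally integrable function. -/
lemma HasWeakDerivAlong.clm_apply_of_bounded {e : E} {U W : E → F₁} {Q Z : E → F₂}
    (hU : HasWeakDerivAlong e U W) (hQ : HasWeakDerivAlong e Q Z) {Φ : F₁ → F₂ →L[ℝ] F₃}
    (hΦ : ContDiff ℝ 1 Φ) {C D : ℝ} (hC : ∀ y, ‖Φ y‖ ≤ C) (hD : ∀ y, ‖fderiv ℝ Φ y‖ ≤ D)
    {b : E → ℝ} (hb : LocallyIntegrable b volume)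
    (hle : ∀ᵐ x, ‖fderiv ℝ Φ (U x) (W x)‖ * ‖Q x‖ ≤ b x) :
    HasWeakDerivAlong e (fun x => Φ (U x) (Q x))
      (fun x => fderiv ℝ Φ (U x) (W x) (Q x) + Φ (U x) (Z x)) := by
  have hC0 : 0 ≤ C := (norm_nonneg _).trans (hC 0)
  have hD0 : 0 ≤ D := (norm_nonneg (fderiv ℝ Φ 0)).trans (hD 0)
  set δ : ℕ → ℝ := fun k => 1 / ((k : ℝ) + 1)
  have hδ : ∀ k, 0 < δ k := fun k => Nat.one_div_pos_of_nat
  have hδ0 : Tendsto δ atTop (𝓝 0) := tendsto_one_div_add_atTop_nhds_zero_nat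
  have hfd : ∀ k (z : F₁ × F₂), HasFDerivAt (fun z : F₁ × F₂ => Φ z.1 (trunc (δ k) z.2))
      ((Φ z.1).comp ((mcDeriv (δ k • z.2)).comp (ContinuousLinearMap.snd ℝ F₁ F₂)) +
        ((fderiv ℝ Φ z.1).comp (ContinuousLinearMap.fst ℝ F₁ F₂)).flip (trunc (δ k) z.2)) z := by
    intro k z
    have h1 : HasFDerivAt (fun z : F₁ × F₂ => Φ z.1)
        ((fderiv ℝ Φ z.1).comp (ContinuousLinearMap.fst ℝ F₁ F₂)) z :=
      (hΦ.differentiable (by simp) z.1).hasFDerivAt.comp z hasFDerivAt_fst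
    have h2 : HasFDerivAt (fun z : F₁ × F₂ => trunc (δ k) z.2)
        ((mcDeriv (δ k • z.2)).comp (ContinuousLinearMap.snd ℝ F₁ F₂)) z :=
      (hasFDerivAt_trunc (hδ k).ne' z.2).comp z hasFDerivAt_snd
    exact h1.clm_apply h2
  -- With Q truncated the product is a C¹ function of the pair (U, Q) with bounded derivative, and
  -- the chain rule applies. The bound depends on δ, but the majorants used in the limit do not.
  have hk : ∀ k, HasWeakDerivAlong e (fun x => Φ (U x) (trunc (δ k) (Q x)))
      (fun x => fderiv ℝ Φ (U x) (W x) (trunc (δ k) (Q x)) +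
        Φ (U x) (mcDeriv (δ k • Q x) (Z x))) := by
    intro k
    have hcd : ContDiff ℝ 1 (fun z : F₁ × F₂ => Φ z.1 (trunc (δ k) z.2)) :=
      (hΦ.comp contDiff_fst).clm_apply
        (((contDiff_trunc (δ k)).of_le (by simp)).comp contDiff_snd)
    have := (hU.prodMk hQ).comp_of_bounded_fderiv hcd (C := C * 2 + D * (δ k)⁻¹) (fun z => by
      rw [(hfd k z).fderiv]
      refine opNorm_le_bound _ (by have := hδ k; positivity) fun y => ?_
      simp only [add_apply, ContinuousLinearMap.comp_apply, flip_apply, coe_fst', coe_snd']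
      refine (norm_add_le _ _).trans ?_
      rw [add_mul]
      have hy1 : ‖y.1‖ ≤ ‖y‖ := norm_fst_le y
      have hy2 : ‖y.2‖ ≤ ‖y‖ := norm_snd_le y
      refine add_le_add ?_ ?_
      · calc _ ≤ ‖Φ z.1‖ * ‖mcDeriv (δ k • z.2) y.2‖ := le_opNorm _ _
          _ ≤ C * (2 * ‖y‖) := by
            gcongr
            · exact hC _
            · exact (norm_mcDeriv_apply_le _ _).trans (by gcongr)
          _ = _ := by ring
      · calc _ ≤ ‖fderiv ℝ Φ z.1 y.1‖ * ‖trunc (δ k) z.2‖ := le_opNorm _ _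
          _ ≤ (D * ‖y‖) * (δ k)⁻¹ := by
            gcongr
            · refine (le_opNorm _ _).trans ?_
              gcongr
              exact hD _
            · exact norm_trunc_le_inv (hδ k) _
          _ = _ := by ring)
    refine this.congr EventuallyEq.rfl (Eventually.of_forall fun x => ?_)
    simp only [(hfd k _).fderiv, add_apply, ContinuousLinearMap.comp_apply, flip_apply, coe_fst',
      coe_snd']
    rw [add_comm]
  refine HasWeakDerivAlong.of_tendsto (b := fun x => C * ‖Q x‖)
    (c := fun x => b x + C * 2 * ‖Z x‖) hk
    ((locallyIntegrable_norm hQ.1).smul C)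
    (hb.add ((locallyIntegrable_norm hQ.2.1).smul (C * 2))) (fun k => ?_) (fun k => ?_) ?_ ?_
  · refine Eventually.of_forall fun x => (le_opNorm _ _).trans ?_
    gcongr
    exacts [hC _, norm_trunc_le _ _]
  · filter_upwards [hle] with x hx
    refine (norm_add_le _ _).trans (add_le_add ?_ ?_)
    · refine ((le_opNorm _ _).trans ?_).trans hx
      gcongr
      exact norm_trunc_le _ _
    · calc _ ≤ ‖Φ (U x)‖ * ‖mcDeriv (δ k • Q x) (Z x)‖ := le_opNorm _ _
        _ ≤ C * (2 * ‖Z x‖) := by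
          gcongr
          exacts [hC _, norm_mcDeriv_apply_le _ _]
        _ = _ := by ring
  · exact Eventually.of_forall fun x =>
      ((Φ (U x)).continuous.tendsto _).comp (tendsto_trunc hδ0 (Q x))
  · refine Eventually.of_forall fun x => ?_
    exact (((fderiv ℝ Φ (U x) (W x)).continuous.tendsto _).comp (tendsto_trunc hδ0 (Q x))).add
      (((Φ (U x)).continuous.tendsto _).comp (tendsto_mcDeriv_smul hδ0 (Q x) (Z x)))

lemma locallyIntegrable_iff_forall_ball {U : E → F₃} :
    LocallyIntegrable U volume ↔ ∀ r, 0 < r → IntegrableOn U (ball 0 r) volume := by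
  refine ⟨fun h r _ => (h.integrableOn_isCompact (isCompact_closedBall 0 r)).mono_set
    ball_subset_closedBall, fun h x => ⟨ball 0 (‖x‖ + 1), ?_, h _ (by positivity)⟩⟩
  exact isOpen_ball.mem_nhds (by simp)

/-- If `H` is bounded and monotone with bounded derivative, then `⟨DH(U) W, W⟩` is locally
integrable whenever `W` is a weak derivative of `U` and has itself a weak derivative in the same
direction. -/
lemma HasWeakDerivAlong.locallyIntegrable_inner_fderiv {e : E} {Q W Z : E → F₂}
    (hQ : HasWeakDerivAlong e Q W) (hW : HasWeakDerivAlong e W Z) {H : F₂ → F₂}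
    (hH : ContDiff ℝ 1 H) {C D : ℝ} (hC : ∀ y, ‖H y‖ ≤ C) (hD : ∀ y, ‖fderiv ℝ H y‖ ≤ D)
    (hpos : ∀ y z, 0 ≤ ⟪fderiv ℝ H y z, z⟫_ℝ) :
    LocallyIntegrable (fun x => ⟪fderiv ℝ H (Q x) (W x), W x⟫_ℝ) volume := by
  have hC0 : 0 ≤ C := (norm_nonneg _).trans (hC 0)
  have hD0 : 0 ≤ D := (norm_nonneg _).trans (hD 0)
  set δ : ℕ → ℝ := fun k => 1 / ((k : ℝ) + 1)
  have hδ : ∀ k, 0 < δ k := fun k => Nat.one_div_pos_of_nat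
  have hδ0 : Tendsto δ atTop (𝓝 0) := tendsto_one_div_add_atTop_nhds_zero_nat
  have hfd : ∀ k (z : F₂ × F₂), HasFDerivAt (fun z : F₂ × F₂ => ⟪H z.1, trunc (δ k) z.2⟫_ℝ)
      ((fderivInnerCLM ℝ (H z.1, trunc (δ k) z.2)).comp
        (((fderiv ℝ H z.1).comp (ContinuousLinearMap.fst ℝ F₂ F₂)).prod
        ((mcDeriv (δ k • z.2)).comp (ContinuousLinearMap.snd ℝ F₂ F₂)))) z := by
    intro k z
    have h1 : HasFDerivAt (fun z : F₂ × F₂ => H z.1)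
        ((fderiv ℝ H z.1).comp (ContinuousLinearMap.fst ℝ F₂ F₂)) z :=
      (hH.differentiable (by simp) z.1).hasFDerivAt.comp z hasFDerivAt_fst
    have h2 : HasFDerivAt (fun z : F₂ × F₂ => trunc (δ k) z.2)
        ((mcDeriv (δ k • z.2)).comp (ContinuousLinearMap.snd ℝ F₂ F₂)) z :=
      (hasFDerivAt_trunc (hδ k).ne' z.2).comp z hasFDerivAt_snd
    exact h1.inner ℝ h2
  -- Differentiating ⟨H(Q), W⟩ yields ⟨DH(Q)W, W⟩ + ⟨H(Q), Z⟩. With H bounded, every quantity except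
  -- the quadratic one is controlled by the L¹ norms of W and Z. Truncating W only inserts a weight
  -- in (0, 1] in front of the quadratic term.
  have hk : ∀ k, HasWeakDerivAlong e (fun x => ⟪H (Q x), trunc (δ k) (W x)⟫_ℝ)
      (fun x => ⟪H (Q x), mcDeriv (δ k • W x) (Z x)⟫_ℝ +
        mcFactor (δ k • W x) * ⟪fderiv ℝ H (Q x) (W x), W x⟫_ℝ) := by
    intro k
    have hcd : ContDiff ℝ 1 (fun z : F₂ × F₂ => ⟪H z.1, trunc (δ k) z.2⟫_ℝ) :=
      (hH.comp contDiff_fst).inner ℝ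
        (((contDiff_trunc (δ k)).of_le (by simp)).comp contDiff_snd)
    have := (hQ.prodMk hW).comp_of_bounded_fderiv hcd (C := C * 2 + D * (δ k)⁻¹) (fun z => by
      rw [(hfd k z).fderiv]
      refine opNorm_le_bound _ (by have := hδ k; positivity) fun y => ?_
      simp only [ContinuousLinearMap.comp_apply, coe_fst', coe_snd', prod_apply,
        fderivInnerCLM_apply]
      refine (norm_add_le _ _).trans ?_
      rw [add_mul]
      have hy1 : ‖y.1‖ ≤ ‖y‖ := norm_fst_le y
      have hy2 : ‖y.2‖ ≤ ‖y‖ := norm_snd_le y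
      refine add_le_add ?_ ?_
      · calc _ ≤ ‖H z.1‖ * ‖mcDeriv (δ k • z.2) y.2‖ := norm_inner_le_norm _ _
          _ ≤ C * (2 * ‖y‖) := by
            gcongr
            · exact hC _
            · exact (norm_mcDeriv_apply_le _ _).trans (by gcongr)
          _ = _ := by ring
      · calc _ ≤ ‖fderiv ℝ H z.1 y.1‖ * ‖trunc (δ k) z.2‖ := norm_inner_le_norm _ _
          _ ≤ (D * ‖y‖) * (δ k)⁻¹ := by
            gcongr
            · refine (le_opNorm _ _).trans ?_
              gcongr
              exact hD _
            · exact norm_trunc_le_inv (hδ k) _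
          _ = _ := by ring)
    refine this.congr EventuallyEq.rfl (Eventually.of_forall fun x => ?_)
    simp only [(hfd k _).fderiv, ContinuousLinearMap.comp_apply, coe_fst', coe_snd', prod_apply,
        fderivInnerCLM_apply]
    simp only [trunc, real_inner_smul_right]
  have cD : Continuous (fderiv ℝ H) := hH.continuous_fderiv (by simp)
  have mJ : AEStronglyMeasurable (fun x => ⟪fderiv ℝ H (Q x) (W x), W x⟫_ℝ) volume :=
    (isBoundedBilinearMap_apply.continuous.comp_aestronglyMeasurable
      ((cD.comp_aestronglyMeasurable hQ.1.aestronglyMeasurable).prodMk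
        hW.1.aestronglyMeasurable)).inner hW.1.aestronglyMeasurable
  have mX : ∀ k, AEStronglyMeasurable (fun x => ⟪H (Q x), mcDeriv (δ k • W x) (Z x)⟫_ℝ) volume := by
    intro k
    refine (hH.continuous.comp_aestronglyMeasurable hQ.1.aestronglyMeasurable).inner ?_
    exact isBoundedBilinearMap_apply.continuous.comp_aestronglyMeasurable
      ((contDiff_mcDeriv.continuous.comp_aestronglyMeasurable
        (hW.1.aestronglyMeasurable.const_smul (δ k))).prodMk hW.2.1.aestronglyMeasurable)
  have bX : ∀ k x, ‖⟪H (Q x), mcDeriv (δ k • W x) (Z x)⟫_ℝ‖ ≤ C * 2 * ‖Z x‖ := by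
    intro k x
    calc _ ≤ ‖H (Q x)‖ * ‖mcDeriv (δ k • W x) (Z x)‖ := norm_inner_le_norm _ _
      _ ≤ C * (2 * ‖Z x‖) := by
        gcongr
        exacts [hC _, norm_mcDeriv_apply_le _ _]
      _ = _ := by ring
  have lZ : LocallyIntegrable (fun x => C * 2 * ‖Z x‖) volume :=
    (locallyIntegrable_norm hW.2.1).smul (C * 2)
  have lW : LocallyIntegrable (fun x => C * ‖W x‖) volume :=
    (locallyIntegrable_norm hW.1).smul C
  have lX : ∀ k, LocallyIntegrable (fun x => ⟪H (Q x), mcDeriv (δ k • W x) (Z x)⟫_ℝ) volume :=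
    fun k => lZ.mono (mX k) (Eventually.of_forall fun x => (bX k x).trans (le_abs_self _))
  have lJ : ∀ k, LocallyIntegrable
      (fun x => mcFactor (δ k • W x) * ⟪fderiv ℝ H (Q x) (W x), W x⟫_ℝ) volume := by
    intro k
    have := (hk k).2.1.sub (lX k)
    refine this.congr (Eventually.of_forall fun x => ?_)
    simp
  rw [locallyIntegrable_iff_forall_ball]
  intro r hr
  let φ : ContDiffBump (0 : E) := ⟨r, r + 1, hr, by linarith⟩
  have hφ : ContDiff ℝ ∞ φ := φ.contDiff
  have hφs : HasCompactSupport φ := φ.hasCompactSupport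
  have cφ := continuous_fderiv_apply_of_contDiff hφ e
  have sφ := hasCompactSupport_fderiv_apply_of hφs e
  -- This bound is independent of the truncation. As the weights tend to 1 and the quadratic term is
  -- nonnegative, Fatou's lemma carries it to the limit.
  set M := (∫ x, ‖fderiv ℝ φ x e‖ * (C * ‖W x‖)) + ∫ x, φ x * (C * 2 * ‖Z x‖) with hM
  have hbound : ∀ k, ∫ x, φ x * (mcFactor (δ k • W x) * ⟪fderiv ℝ H (Q x) (W x), W x⟫_ℝ) ≤ M := by
    intro k
    have h1 := (hk k).2.2 φ hφ hφs
    simp only [smul_eq_mul, mul_add] at h1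
    rw [integral_add ((lX k).integrable_test_mul hφ.continuous hφs)
      ((lJ k).integrable_test_mul hφ.continuous hφs)] at h1
    have h2 : ‖∫ x, fderiv ℝ φ x e * ⟪H (Q x), trunc (δ k) (W x)⟫_ℝ‖ ≤
        ∫ x, ‖fderiv ℝ φ x e‖ * (C * ‖W x‖) := by
      refine norm_integral_le_of_norm_le (lW.integrable_test_mul cφ.norm sφ.norm)
        (Eventually.of_forall fun x => ?_)
      rw [norm_mul]
      gcongr
      refine (norm_inner_le_norm _ _).trans ?_
      gcongr
      exacts [hC _, norm_trunc_le _ _]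
    have h3 : ‖∫ x, φ x * ⟪H (Q x), mcDeriv (δ k • W x) (Z x)⟫_ℝ‖ ≤
        ∫ x, φ x * (C * 2 * ‖Z x‖) := by
      refine norm_integral_le_of_norm_le (lZ.integrable_test_mul hφ.continuous hφs)
        (Eventually.of_forall fun x => ?_)
      rw [norm_mul, Real.norm_of_nonneg φ.nonneg]
      gcongr
      · exact φ.nonneg
      · exact bX k x
    rw [Real.norm_eq_abs] at h2 h3
    linarith [neg_abs_le (∫ x, fderiv ℝ φ x e * ⟪H (Q x), trunc (δ k) (W x)⟫_ℝ),
      neg_abs_le (∫ x, φ x * ⟪H (Q x), mcDeriv (δ k • W x) (Z x)⟫_ℝ)]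
  refine ⟨mJ.restrict, ?_⟩
  rw [hasFiniteIntegral_iff_ofReal (Eventually.of_forall fun x => hpos _ _)]
  have hF : ∀ k, ∫⁻ x in ball (0 : E) r,
      ENNReal.ofReal (mcFactor (δ k • W x) * ⟪fderiv ℝ H (Q x) (W x), W x⟫_ℝ) ≤
        ENNReal.ofReal M := by
    intro k
    calc _ ≤ ∫⁻ x, ENNReal.ofReal
          (φ x * (mcFactor (δ k • W x) * ⟪fderiv ℝ H (Q x) (W x), W x⟫_ℝ)) := by
          rw [← lintegral_indicator measurableSet_ball]
          refine lintegral_mono fun x => ?_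
          by_cases hx : x ∈ ball (0 : E) r
          · rw [Set.indicator_of_mem hx, φ.one_of_mem_closedBall (ball_subset_closedBall hx),
              one_mul]
          · simp [hx]
      _ = ENNReal.ofReal (∫ x, φ x *
          (mcFactor (δ k • W x) * ⟪fderiv ℝ H (Q x) (W x), W x⟫_ℝ)) := by
          rw [ofReal_integral_eq_lintegral_ofReal
            ((lJ k).integrable_test_mul hφ.continuous hφs)]
          exact Eventually.of_forall fun x =>
            mul_nonneg φ.nonneg (mul_nonneg (mcFactor_pos _).le (hpos _ _))
      _ ≤ _ := ENNReal.ofReal_le_ofReal (hbound k)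
  have hlim : ∀ x, Tendsto (fun k => ENNReal.ofReal
      (mcFactor (δ k • W x) * ⟪fderiv ℝ H (Q x) (W x), W x⟫_ℝ)) atTop
      (𝓝 (ENNReal.ofReal ⟪fderiv ℝ H (Q x) (W x), W x⟫_ℝ)) := by
    intro x
    have := (tendsto_mcFactor_smul hδ0 (W x)).mul_const ⟪fderiv ℝ H (Q x) (W x), W x⟫_ℝ
    rw [one_mul] at this
    exact (ENNReal.continuous_ofReal.tendsto _).comp this
  calc ∫⁻ x in ball (0 : E) r, ENNReal.ofReal ⟪fderiv ℝ H (Q x) (W x), W x⟫_ℝ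
      = ∫⁻ x in ball (0 : E) r, liminf (fun k => ENNReal.ofReal
          (mcFactor (δ k • W x) * ⟪fderiv ℝ H (Q x) (W x), W x⟫_ℝ)) atTop :=
        lintegral_congr fun x => (hlim x).liminf_eq.symm
    _ ≤ liminf (fun k => ∫⁻ x in ball (0 : E) r, ENNReal.ofReal
          (mcFactor (δ k • W x) * ⟪fderiv ℝ H (Q x) (W x), W x⟫_ℝ)) atTop :=
        lintegral_liminf_le' fun k =>
          (lJ k).aestronglyMeasurable.aemeasurable.restrict.ennreal_ofReal
    _ ≤ liminf (fun _ : ℕ => ENNReal.ofReal M) atTop :=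
        liminf_le_liminf (Eventually.of_forall hF)
    _ = ENNReal.ofReal M := liminf_const _
    _ < ⊤ := ENNReal.ofReal_lt_top

end Product

/-! ### Scalar versions of the product rule and the quadratic estimate. -/

section ScalarTools

set_option linter.unusedSectionVars false

variable {E : Type*} [NormedAddCommGroup E] [InnerProductSpace ℝ E] [FiniteDimensional ℝ E]
  [MeasurableSpace E] [BorelSpace E]
  {F : Type*} [NormedAddCommGroup F] [InnerProductSpace ℝ F] [CompleteSpace F]

/-- Product rule for a bounded function of a scalar function times a vector function. -/
lemma HasWeakDerivAlong.comp_smul_of_bounded {e : E} {v v' : E → ℝ} {Q Z : E → F}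
    (hv : HasWeakDerivAlong e v v') (hQ : HasWeakDerivAlong e Q Z) {θ : ℝ → ℝ}
    (hθ : ContDiff ℝ 1 θ) {C D : ℝ} (hC : ∀ y, |θ y| ≤ C) (hD : ∀ y, |deriv θ y| ≤ D)
    {b : E → ℝ} (hb : LocallyIntegrable b volume)
    (hle : ∀ᵐ x, |deriv θ (v x)| * |v' x| * ‖Q x‖ ≤ b x) :
    HasWeakDerivAlong e (fun x => θ (v x) • Q x)
      (fun x => (deriv θ (v x) * v' x) • Q x + θ (v x) • Z x) := by
  have hfd : ∀ y, HasFDerivAt (fun y => θ y • ContinuousLinearMap.id ℝ F)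
      ((fderiv ℝ θ y).smulRight (ContinuousLinearMap.id ℝ F)) y := by
    intro y
    have h := (hθ.differentiable (by simp) y).hasFDerivAt
    exact h.smul_const (ContinuousLinearMap.id ℝ F)
  have hid : ‖ContinuousLinearMap.id ℝ F‖ ≤ 1 := norm_id_le
  have happ : ∀ y z, ‖fderiv ℝ (fun y => θ y • ContinuousLinearMap.id ℝ F) y z‖ ≤
      |deriv θ y| * |z| := by
    intro y z
    rw [(hfd y).fderiv, smulRight_apply, norm_smul, fderiv_eq_smul_deriv, smul_eq_mul, norm_mul,
      Real.norm_eq_abs, Real.norm_eq_abs]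
    calc |z| * |deriv θ y| * _ ≤ |z| * |deriv θ y| * 1 := by gcongr
      _ = _ := by ring
  have := hv.clm_apply_of_bounded hQ (Φ := fun y => θ y • ContinuousLinearMap.id ℝ F)
    (hθ.smul contDiff_const) (C := C) (D := D) (fun y => ?_) (fun y => ?_) hb ?_
  · refine this.congr (Eventually.of_forall fun x => rfl) (Eventually.of_forall fun x => ?_)
    simp only [(hfd _).fderiv, smulRight_apply, smul_apply, ContinuousLinearMap.id_apply,
      fderiv_eq_smul_deriv, smul_eq_mul]
    rw [mul_comm]
  · rw [norm_smul, Real.norm_eq_abs]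
    calc |θ y| * _ ≤ |θ y| * 1 := by gcongr
      _ ≤ C := by rw [mul_one]; exact hC y
  · refine opNorm_le_bound _ ((abs_nonneg _).trans (hD 0)) fun z => (happ y z).trans ?_
    rw [Real.norm_eq_abs]
    gcongr
    exact hD y
  · filter_upwards [hle] with x hx
    refine le_trans ?_ hx
    gcongr
    exact happ _ _

/-- If `v` has two weak derivatives in the direction `e`, then `(∂ₑ v)² / (1 + v²)` is locally
integrable. -/
lemma HasWeakDerivAlong.locallyIntegrable_sq_div {e : E} {v v' v'' : E → ℝ}
    (hv : HasWeakDerivAlong e v v') (hv' : HasWeakDerivAlong e v' v'') :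
    LocallyIntegrable (fun x => v' x ^ 2 / (1 + v x ^ 2)) volume := by
  have hd : ∀ y z, fderiv ℝ Real.arctan y z = z / (1 + y ^ 2) := by
    intro y z
    rw [fderiv_eq_smul_deriv, Real.deriv_arctan, smul_eq_mul]
    ring
  -- The arctangent is the bounded monotone function whose derivative is the weight 1/(1 + v²).
  have := hv.locallyIntegrable_inner_fderiv hv' (H := Real.arctan) Real.contDiff_arctan
    (C := Real.pi / 2) (D := 1) (fun y => ?_) (fun y => ?_) (fun y z => ?_)
  · refine this.congr (Eventually.of_forall fun x => ?_)
    simp only [hd]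
    rw [RCLike.inner_apply]
    simp
    ring
  · rw [Real.norm_eq_abs, abs_le]
    exact ⟨(Real.neg_pi_div_two_lt_arctan y).le, (Real.arctan_lt_pi_div_two y).le⟩
  · refine opNorm_le_bound _ zero_le_one fun z => ?_
    rw [hd, norm_div, one_mul, Real.norm_of_nonneg (by positivity : 0 ≤ 1 + y ^ 2)]
    exact div_le_self (norm_nonneg z) (by nlinarith [sq_nonneg y])
  · rw [hd, RCLike.inner_apply]
    simp only [conj_trivial]
    have : z * (z / (1 + y ^ 2)) = z ^ 2 / (1 + y ^ 2) := by ring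
    rw [this]
    positivity

end ScalarTools

/-! ### Coordinates, and the data attached to a stable solution. -/

/-- The standard basis vectors of `ℝⁿ`. -/
noncomputable abbrev stdVec {n : ℕ} (i : Fin n) : EuclideanSpace ℝ (Fin n) :=
  EuclideanSpace.single i 1

lemma hasWeakDerivAlong_of_coord {n : ℕ} {e : EuclideanSpace ℝ (Fin n)}
    {U W : EuclideanSpace ℝ (Fin n) → EuclideanSpace ℝ (Fin n)}
    (h : ∀ i, HasWeakDerivAlong e (fun x => U x i) (fun x => W x i)) :
    HasWeakDerivAlong e U W := by
  have h1 : ∀ z : EuclideanSpace ℝ (Fin n), ∑ i, z i • stdVec i = z := by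
    intro z
    ext j
    simp [Pi.single_apply]
  have h2 := HasWeakDerivAlong.sum Finset.univ fun i _ =>
    (h i).clm ((ContinuousLinearMap.id ℝ ℝ).smulRight (stdVec i))
  simpa [h1] using h2

lemma HasWeakDerivAlong.coord {n : ℕ} {e : EuclideanSpace ℝ (Fin n)}
    {U W : EuclideanSpace ℝ (Fin n) → EuclideanSpace ℝ (Fin n)}
    (h : HasWeakDerivAlong e U W) (i : Fin n) :
    HasWeakDerivAlong e (fun x => U x i) (fun x => W x i) :=
  h.clm (EuclideanSpace.proj i)

lemma hasWeakPartialDeriv_iff {n : ℕ} {i : Fin n} {u g : EuclideanSpace ℝ (Fin n) → ℝ} :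
    HasWeakPartialDeriv i u g ↔ HasWeakDerivAlong (stdVec i) u g := by
  unfold HasWeakPartialDeriv HasWeakDerivAlong IsTestFunction
  simp only [smul_eq_mul, and_imp, mul_comm]

lemma fderiv_coord {n : ℕ} (i : Fin n) (x e : EuclideanSpace ℝ (Fin n)) :
    fderiv ℝ (fun x : EuclideanSpace ℝ (Fin n) => x i) x e = e i := by
  have : (fun x : EuclideanSpace ℝ (Fin n) => x i) = EuclideanSpace.proj (𝕜 := ℝ) i := rfl
  rw [this, ContinuousLinearMap.fderiv]
  rfl

lemma contDiff_coord {n : ℕ} (i : Fin n) :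
    ContDiff ℝ ∞ (fun x : EuclideanSpace ℝ (Fin n) => x i) :=
  (EuclideanSpace.proj (𝕜 := ℝ) i : EuclideanSpace ℝ (Fin n) →L[ℝ] ℝ).contDiff

/-- Weak derivative of `∑ᵢ xᵢ Uᵢ(x)`. -/
lemma HasWeakDerivAlong.sum_coord_smul {n : ℕ} {F : Type*} [NormedAddCommGroup F]
    [NormedSpace ℝ F] [CompleteSpace F] {k : Fin n}
    {U W : Fin n → EuclideanSpace ℝ (Fin n) → F}
    (h : ∀ i, HasWeakDerivAlong (stdVec k) (U i) (W i)) :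
    HasWeakDerivAlong (stdVec k) (fun x => ∑ i, x i • U i x)
      (fun x => U k x + ∑ i, x i • W i x) := by
  have := HasWeakDerivAlong.sum Finset.univ fun i _ => (h i).smooth_smul (contDiff_coord i)
  refine this.congr EventuallyEq.rfl (Eventually.of_forall fun x => ?_)
  simp only [fderiv_coord, Finset.sum_add_distrib]
  congr 1
  rw [Finset.sum_eq_single k]
  · simp
  · intro i _ hi
    simp [hi]
  · simp

lemma real_inner_gradient {n : ℕ} (φ : EuclideanSpace ℝ (Fin n) → ℝ)
    (x v : EuclideanSpace ℝ (Fin n)) : ⟪v, ∇ φ x⟫_ℝ = fderiv ℝ φ x v := by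
  rw [inner_gradient_right]
  rfl

lemma gradient_coord {n : ℕ} (φ : EuclideanSpace ℝ (Fin n) → ℝ) (x : EuclideanSpace ℝ (Fin n))
    (i : Fin n) : (∇ φ x) i = fderiv ℝ φ x (stdVec i) := by
  rw [← real_inner_gradient φ, EuclideanSpace.inner_single_left]
  simp

lemma euclidean_inner_eq_sum {n : ℕ} (x y : EuclideanSpace ℝ (Fin n)) :
    ⟪x, y⟫_ℝ = ∑ i, x i * y i := by
  simp [PiLp.inner_apply, mul_comm]

/-- A stable solution with its weak gradient `G`, the weak derivatives `W i = ∂ᵢ G` and the second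
weak derivatives `W₂ i k = ∂ₖ ∂ᵢ G`. -/
structure StableData {n : ℕ} (f : ℝ → ℝ) (u : EuclideanSpace ℝ (Fin n) → ℝ)
    (G : EuclideanSpace ℝ (Fin n) → EuclideanSpace ℝ (Fin n))
    (W : Fin n → EuclideanSpace ℝ (Fin n) → EuclideanSpace ℝ (Fin n))
    (W₂ : Fin n → Fin n → EuclideanSpace ℝ (Fin n) → EuclideanSpace ℝ (Fin n)) : Prop where
  weak_u : ∀ i, HasWeakDerivAlong (stdVec i) u (fun x => G x i)
  weak_G : ∀ i, HasWeakDerivAlong (stdVec i) G (W i)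
  weak_W : ∀ i k, HasWeakDerivAlong (stdVec k) (W i) (W₂ i k)
  contDiff_f : ContDiff ℝ 1 f
  locallyIntegrable_f : LocallyIntegrable (fun x => f (u x)) volume
  locallyIntegrable_deriv : LocallyIntegrable (fun x => deriv f (u x)) volume
  equation : ∀ φ : EuclideanSpace ℝ (Fin n) → ℝ, ContDiff ℝ ∞ φ → HasCompactSupport φ →
    ∫ x, ⟪mcMap (G x), ∇ φ x⟫_ℝ = ∫ x, f (u x) * φ x
  stability : ∀ ξ : EuclideanSpace ℝ (Fin n) → ℝ, ContDiff ℝ ∞ ξ → HasCompactSupport ξ →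
    ∫ x, deriv f (u x) * ξ x ^ 2 ≤ ∫ x, ⟪mcDeriv (G x) (∇ ξ x), ∇ ξ x⟫_ℝ

lemma MemSobolevLoc.congr_ae {n : ℕ} {k : ℕ} {u v : EuclideanSpace ℝ (Fin n) → ℝ}
    (hu : MemSobolevLoc k u) (huv : u =ᵐ[volume] v) : MemSobolevLoc k v := by
  cases k with
  | zero => exact LocallyIntegrable.congr hu huv
  | succ k =>
    refine ⟨hu.1.congr huv, fun i => ?_⟩
    obtain ⟨g, hg, hgs⟩ := hu.2 i
    exact ⟨g, hasWeakPartialDeriv_iff.2 ((hasWeakPartialDeriv_iff.1 hg).congr huv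
      EventuallyEq.rfl), hgs⟩

lemma exists_stableData {n : ℕ} {f : ℝ → ℝ} (hf : ContDiff ℝ 1 f)
    {u : EuclideanSpace ℝ (Fin n) → ℝ} (hu : MemSobolevLoc 3 u) (hstable : IsStableSolution f u)
    {G : EuclideanSpace ℝ (Fin n) → EuclideanSpace ℝ (Fin n)} (hG : HasWeakGradient u G) :
    ∃ W W₂, StableData f u G W W₂ := by
  have hG2 : ∀ j, MemSobolevLoc 2 (fun x => G x j) := by
    intro j
    obtain ⟨g, hg, hgs⟩ := hu.2 j
    exact hgs.congr_ae ((hasWeakPartialDeriv_iff.1 hg).unique (hasWeakPartialDeriv_iff.1 (hG j)))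
  have h1 : ∀ i j, ∃ g, HasWeakPartialDeriv i (fun x => G x j) g ∧ MemSobolevLoc 1 g :=
    fun i j => (hG2 j).2 i
  choose g hg hgs using h1
  have h2 : ∀ i k j, ∃ g', HasWeakPartialDeriv k (g i j) g' ∧ MemSobolevLoc 0 g' :=
    fun i k j => (hgs i j).2 k
  choose g₂ hg₂ _ using h2
  obtain ⟨_, hfu, hfu', G', hG', heq, hst⟩ := hstable
  -- The gradient supplied with the stability hypothesis and the given one agree almost everywhere,
  -- so both integral conditions can be rewritten in terms of `G`.
  have hGG : G' =ᵐ[volume] G := by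
    have : ∀ᵐ x, ∀ i, G' x i = G x i := ae_all_iff.2 fun i =>
      (hasWeakPartialDeriv_iff.1 (hG' i)).unique (hasWeakPartialDeriv_iff.1 (hG i))
    filter_upwards [this] with x hx
    ext i
    exact hx i
  refine ⟨fun i x => WithLp.toLp 2 fun j => g i j x, fun i k x => WithLp.toLp 2 fun j => g₂ i k j x,
    ⟨fun i => hasWeakPartialDeriv_iff.1 (hG i), fun i => ?_, fun i k => ?_, hf, hfu, hfu',
    fun φ hφ hs => ?_, fun ξ hξ hs => ?_⟩⟩
  · exact hasWeakDerivAlong_of_coord fun j => hasWeakPartialDeriv_iff.1 (hg i j)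
  · exact hasWeakDerivAlong_of_coord fun j => hasWeakPartialDeriv_iff.1 (hg₂ i k j)
  · rw [← heq φ ⟨hφ, hs⟩]
    refine integral_congr_ae ?_
    filter_upwards [hGG] with x hx
    rw [hx, mcMap, real_inner_smul_left, mcFactor]
    ring
  · refine (hst ξ ⟨hξ, hs⟩).trans (le_of_eq (integral_congr_ae ?_))
    filter_upwards [hGG] with x hx
    rw [hx, inner_mcDeriv_self]
    have hpos : (0 : ℝ) < 1 + ‖G x‖ ^ 2 := by positivity
    have h3 : (1 + ‖G x‖ ^ 2) ^ (3 / 2 : ℝ) = √(1 + ‖G x‖ ^ 2) ^ 3 := by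
      rw [Real.sqrt_eq_rpow, ← Real.rpow_natCast _ 3, ← Real.rpow_mul hpos.le]
      norm_num
    rw [h3, mcFactor]
    ring

/-! ### Pointwise equations and second derivatives of the flux. -/

namespace StableData

variable {n : ℕ} {f : ℝ → ℝ} {u : EuclideanSpace ℝ (Fin n) → ℝ}
  {G : EuclideanSpace ℝ (Fin n) → EuclideanSpace ℝ (Fin n)}
  {W : Fin n → EuclideanSpace ℝ (Fin n) → EuclideanSpace ℝ (Fin n)}
  {W₂ : Fin n → Fin n → EuclideanSpace ℝ (Fin n) → EuclideanSpace ℝ (Fin n)}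

lemma locallyIntegrable_G [NeZero n] (h : StableData f u G W W₂) : LocallyIntegrable G volume :=
  (h.weak_G 0).1

lemma hessian_symm (h : StableData f u G W W₂) : ∀ᵐ x, ∀ i j, W i x j = W j x i := by
  refine ae_all_iff.2 fun i => ae_all_iff.2 fun j => ?_
  exact (h.weak_u j).comm (h.weak_u i) ((h.weak_G i).coord j) ((h.weak_G j).coord i)

lemma weak_mcMap (h : StableData f u G W W₂) (i : Fin n) :
    HasWeakDerivAlong (stdVec i) (fun x => mcMap (G x)) (fun x => mcDeriv (G x) (W i x)) := by
  have := (h.weak_G i).comp_of_bounded_fderiv (Φ := mcMap) (contDiff_mcMap.of_le (by simp))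
    (C := 2) (fun y => by rw [fderiv_mcMap]; exact norm_mcDeriv_le y)
  simpa only [fderiv_mcMap] using this

/-- The flux is weakly differentiable, so the weak equation holds pointwise. This form gives f(u) a
weak gradient even though f' may be unbounded and the chain rule is not directly available. -/
lemma equation_ae (h : StableData f u G W W₂) :
    (fun x => f (u x)) =ᵐ[volume] fun x => -∑ i, (mcDeriv (G x) (W i x)) i := by
  have hi : ∀ i, HasWeakDerivAlong (stdVec i) (fun x => mcMap (G x) i)
      (fun x => mcDeriv (G x) (W i x) i) := fun i => (h.weak_mcMap i).coord i
  have hl : LocallyIntegrable (fun x => ∑ i, (mcDeriv (G x) (W i x)) i) volume := by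
    have : (fun x => ∑ i, (mcDeriv (G x) (W i x)) i) =
      ∑ i, fun x => (mcDeriv (G x) (W i x)) i := by
      ext x
      rw [Finset.sum_apply]
    rw [this]
    exact locallyIntegrable_finsetSum' _ fun i _ => (hi i).2.1
  refine ae_eq_of_integral_contDiff_smul_eq h.locallyIntegrable_f hl.neg fun φ hφ hs => ?_
  have h1 := h.equation φ hφ hs
  simp only [euclidean_inner_eq_sum, gradient_coord] at h1
  have h2 : ∀ i, Integrable (fun x => mcMap (G x) i * fderiv ℝ φ x (stdVec i)) volume := by
    intro i
    have := (hi i).1.integrable_test_mul (continuous_fderiv_apply_of_contDiff hφ (stdVec i))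
      (hasCompactSupport_fderiv_apply_of hs _)
    simpa only [mul_comm] using this
  have h3 : ∀ i, Integrable (fun x => φ x * mcDeriv (G x) (W i x) i) volume := fun i =>
    (hi i).2.1.integrable_test_mul hφ.continuous hs
  rw [integral_finsetSum _ fun i _ => h2 i] at h1
  have h4 : ∀ i, ∫ x, mcMap (G x) i * fderiv ℝ φ x (stdVec i) =
      -∫ x, φ x * mcDeriv (G x) (W i x) i := by
    intro i
    have := (hi i).2.2 φ hφ hs
    simp only [smul_eq_mul] at this
    rw [← this]
    simp only [mul_comm]
  simp only [h4] at h1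
  simp only [smul_eq_mul, mul_comm (φ _) (f _), ← h1, mul_neg, Finset.mul_sum]
  rw [integral_neg, integral_finsetSum _ fun i _ => h3 i, Finset.sum_neg_distrib]

/-- The arctangent estimate is applied to each component of the gradient; the weight 1/(1 + |G|²) is
smaller than each 1/(1 + G_j²). -/
lemma locallyIntegrable_sq_hessian (h : StableData f u G W W₂) (i : Fin n) :
    LocallyIntegrable (fun x => mcFactor (G x) ^ 2 * ‖W i x‖ ^ 2) volume := by
  have h1 : ∀ j, LocallyIntegrable (fun x => W i x j ^ 2 / (1 + G x j ^ 2)) volume := fun j =>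
    ((h.weak_G i).coord j).locallyIntegrable_sq_div ((h.weak_W i i).coord j)
  have h2 : LocallyIntegrable (∑ j, fun x => W i x j ^ 2 / (1 + G x j ^ 2)) volume :=
    locallyIntegrable_finsetSum' _ fun j _ => h1 j
  refine h2.mono ?_ (Eventually.of_forall fun x => ?_)
  · exact ((contDiff_mcFactor.continuous.comp_aestronglyMeasurable
      (h.weak_G i).1.aestronglyMeasurable).pow 2).mul
        ((h.weak_G i).2.1.aestronglyMeasurable.norm.pow 2)
  · have hs := mcFactor_sq (G x)
    rw [Real.norm_of_nonneg (by positivity), Finset.sum_apply, EuclideanSpace.real_norm_sq_eq,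
      Finset.mul_sum]
    refine le_trans (Finset.sum_le_sum fun j _ => ?_) (le_abs_self _)
    rw [div_eq_inv_mul]
    gcongr
    rw [← one_div, le_div_iff₀ (by positivity)]
    have hj : G x j ^ 2 ≤ ‖G x‖ ^ 2 := by
      rw [EuclideanSpace.real_norm_sq_eq]
      exact Finset.single_le_sum (f := fun j => G x j ^ 2) (fun _ _ => sq_nonneg _)
        (Finset.mem_univ j)
    refine le_trans ?_ hs.le
    gcongr

/-- The second weak derivatives of the flux `mcMap (G x)`. -/
noncomputable def fluxHessian (G : EuclideanSpace ℝ (Fin n) → EuclideanSpace ℝ (Fin n))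
    (W : Fin n → EuclideanSpace ℝ (Fin n) → EuclideanSpace ℝ (Fin n))
    (W₂ : Fin n → Fin n → EuclideanSpace ℝ (Fin n) → EuclideanSpace ℝ (Fin n))
    (i k : Fin n) (x : EuclideanSpace ℝ (Fin n)) : EuclideanSpace ℝ (Fin n) :=
  fderiv ℝ mcDeriv (G x) (W k x) (W i x) + mcDeriv (G x) (W₂ i k x)

/-- The term with two first derivatives of G is dominated through the decay of the second derivative
of the flux and `locallyIntegrable_sq_hessian`. -/
lemma weak_mcDeriv (h : StableData f u G W W₂) (i k : Fin n) :
    HasWeakDerivAlong (stdVec k) (fun x => mcDeriv (G x) (W i x)) (fluxHessian G W W₂ i k) := by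
  have hb : LocallyIntegrable (fun x => 3 * (mcFactor (G x) ^ 2 * ‖W k x‖ ^ 2) +
      3 * (mcFactor (G x) ^ 2 * ‖W i x‖ ^ 2)) volume :=
    ((h.locallyIntegrable_sq_hessian k).smul (3 : ℝ)).add
      ((h.locallyIntegrable_sq_hessian i).smul (3 : ℝ))
  have hop : ∀ p e : EuclideanSpace ℝ (Fin n),
      ‖fderiv ℝ (mcDeriv : EuclideanSpace ℝ (Fin n) → _) p e‖ ≤ 6 * mcFactor p ^ 2 * ‖e‖ := by
    intro p e
    refine opNorm_le_bound _ (by positivity) fun q => ?_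
    rw [mul_assoc (6 * mcFactor p ^ 2)]
    exact norm_fderiv_mcDeriv_apply_le p e q
  refine (h.weak_G k).clm_apply_of_bounded (h.weak_W i k) (contDiff_mcDeriv.of_le (by simp))
    (C := 2) (D := 6) norm_mcDeriv_le (fun p => ?_) hb (Eventually.of_forall fun x => ?_)
  · refine opNorm_le_bound _ (by norm_num) fun e => (hop p e).trans ?_
    have h1 : mcFactor p ^ 2 ≤ 1 := pow_le_one₀ (mcFactor_pos p).le (mcFactor_le_one p)
    gcongr
    linarith
  · calc _ ≤ 6 * mcFactor (G x) ^ 2 * ‖W k x‖ * ‖W i x‖ := by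
          gcongr
          exact hop _ _
      _ ≤ _ := by
          nlinarith [mul_nonneg (sq_nonneg (mcFactor (G x))) (sq_nonneg (‖W k x‖ - ‖W i x‖))]

/-- Both sides are mixed second weak derivatives of the flux, so no explicit formula is compared. -/
lemma fluxHessian_symm (h : StableData f u G W W₂) :
    ∀ᵐ x, ∀ i k, fluxHessian G W W₂ i k x = fluxHessian G W W₂ k i x := by
  refine ae_all_iff.2 fun i => ae_all_iff.2 fun k => ?_
  exact (h.weak_mcMap i).comm (h.weak_mcMap k) (h.weak_mcDeriv i k) (h.weak_mcDeriv k i)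

/-- The differentiated equation. -/
lemma deriv_equation_ae (h : StableData f u G W W₂) (k : Fin n) :
    ∀ᵐ x, deriv f (u x) * G x k = -∑ i, (fluxHessian G W W₂ i k x) i := by
  have hg : HasWeakDerivAlong (stdVec k) (fun x => f (u x))
      (fun x => -∑ i, (fluxHessian G W W₂ i k x) i) := by
    have h1 := (HasWeakDerivAlong.sum Finset.univ fun i _ => (h.weak_mcDeriv i k).coord i).neg
    exact h1.congr h.equation_ae.symm EventuallyEq.rfl
  -- On each set where u is bounded, f is replaced by θf with a cutoff θ. The derivative of θ(u)f(u)
  -- is computed twice: by the chain rule for θf, and by the product rule with the weak derivative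
  -- of f(u). The terms with θ' agree, and comparison where θ = 1 gives the claim.
  have hm : ∀ m : ℕ, ∀ᵐ x, |u x| ≤ m + 1 →
      deriv f (u x) * G x k = -∑ i, (fluxHessian G W W₂ i k x) i := by
    intro m
    let θ : ContDiffBump (0 : ℝ) := ⟨(m : ℝ) + 1, m + 2, by positivity, by linarith⟩
    have hθ : ContDiff ℝ 1 θ := θ.contDiff
    have hθs : HasCompactSupport θ := θ.hasCompactSupport
    have hF : ContDiff ℝ 1 fun y => θ y * f y := hθ.mul h.contDiff_f
    have hFs : HasCompactSupport fun y => θ y * f y := hθs.mul_right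
    obtain ⟨C₁, hC₁⟩ := (hF.continuous_fderiv (by simp)).bounded_above_of_compact_support
      (hFs.fderiv (𝕜 := ℝ))
    obtain ⟨C₂, hC₂⟩ := (hθ.continuous_deriv (by simp)).bounded_above_of_compact_support hθs.deriv
    obtain ⟨C₃, hC₃⟩ := ((hθ.continuous_deriv (by simp)).mul
      h.contDiff_f.continuous).bounded_above_of_compact_support hθs.deriv.mul_right
    have a1 := (h.weak_u k).comp_of_bounded_fderiv hF hC₁
    have hb : LocallyIntegrable (fun x => C₃ * ‖G x k‖) volume :=
      (locallyIntegrable_norm (h.weak_u k).2.1).smul C₃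
    have a2 := (h.weak_u k).comp_smul_of_bounded hg hθ (C := 1) (D := C₂)
      (fun y => by rw [abs_of_nonneg θ.nonneg]; exact θ.le_one) hC₂ hb
      (Eventually.of_forall fun x => by
        have := hC₃ (u x)
        rw [Pi.mul_apply, norm_mul] at this
        calc _ = (‖deriv θ (u x)‖ * ‖f (u x)‖) * ‖G x k‖ := by
              simp only [Real.norm_eq_abs]; ring
          _ ≤ _ := by gcongr)
    simp only [smul_eq_mul] at a2
    filter_upwards [a1.unique a2] with x hx hux
    have e1 : fderiv ℝ (fun y => θ y * f y) (u x) (G x k) =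
        (deriv θ (u x) * f (u x) + θ (u x) * deriv f (u x)) * G x k := by
      rw [fderiv_eq_smul_deriv, deriv_fun_mul (hθ.differentiable (by simp) _)
        (h.contDiff_f.differentiable (by simp) _), smul_eq_mul]
      ring
    have e2 : θ (u x) = 1 := θ.one_of_mem_closedBall (by simpa using hux)
    rw [e1, e2] at hx
    linarith
  filter_upwards [ae_all_iff.2 hm] with x hx
  obtain ⟨m, hm⟩ := exists_nat_ge |u x|
  exact hx m (by linarith)

/-! ### The radial derivative and the linearized flux. -/

/-- The radial derivative `x · ∇u`. -/
noncomputable def radial (G : EuclideanSpace ℝ (Fin n) → EuclideanSpace ℝ (Fin n))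
    (x : EuclideanSpace ℝ (Fin n)) : ℝ := ⟪x, G x⟫_ℝ

/-- The derivative of the gradient along the dilation field. -/
noncomputable def dilationDeriv (W : Fin n → EuclideanSpace ℝ (Fin n) → EuclideanSpace ℝ (Fin n))
    (x : EuclideanSpace ℝ (Fin n)) : EuclideanSpace ℝ (Fin n) := ∑ i, x i • W i x

/-- The weak gradient of the radial derivative `x · ∇u`. -/
noncomputable def radialGrad (G : EuclideanSpace ℝ (Fin n) → EuclideanSpace ℝ (Fin n))
    (W : Fin n → EuclideanSpace ℝ (Fin n) → EuclideanSpace ℝ (Fin n))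
    (x : EuclideanSpace ℝ (Fin n)) : EuclideanSpace ℝ (Fin n) := G x + dilationDeriv W x

/-- The field whose divergence is `-f'(u) (x · ∇u)`. -/
noncomputable def dilationFlux (G : EuclideanSpace ℝ (Fin n) → EuclideanSpace ℝ (Fin n))
    (W : Fin n → EuclideanSpace ℝ (Fin n) → EuclideanSpace ℝ (Fin n))
    (x : EuclideanSpace ℝ (Fin n)) : EuclideanSpace ℝ (Fin n) :=
  (∑ i, x i • mcDeriv (G x) (W i x)) - mcMap (G x)

/-- Since ∇v = G + (x·∇)G, replacing (x·∇)G by ∇v costs A G = s³G, and subtracting the flux costs a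
further sG. Here s = `mcFactor (G x)`. -/
lemma dilationFlux_eq (x : EuclideanSpace ℝ (Fin n)) :
    dilationFlux G W x = mcDeriv (G x) (radialGrad G W x) -
      (mcFactor (G x) + mcFactor (G x) ^ 3) • G x := by
  simp only [dilationFlux, radialGrad, dilationDeriv, map_add, map_sum, map_smul, mcDeriv_self,
    mcMap, add_smul]
  abel

/-- The flux is subtracted in `dilationFlux` exactly to cancel the term in which the derivative
falls on the coefficient x_k. -/
lemma weak_dilationFlux (h : StableData f u G W W₂) (k : Fin n) :
    HasWeakDerivAlong (stdVec k) (dilationFlux G W)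
      (fun x => ∑ i, x i • fluxHessian G W W₂ i k x) := by
  have h1 := (HasWeakDerivAlong.sum_coord_smul fun i => h.weak_mcDeriv i k).sub (h.weak_mcMap k)
  refine h1.congr EventuallyEq.rfl (Eventually.of_forall fun x => ?_)
  simp

lemma weak_radial (h : StableData f u G W W₂) (k : Fin n) :
    HasWeakDerivAlong (stdVec k) (radial G) (fun x => radialGrad G W x k) := by
  have h1 := HasWeakDerivAlong.sum_coord_smul fun i => (h.weak_G k).coord i
  refine h1.congr (Eventually.of_forall fun x => ?_) ?_
  · simp [radial, euclidean_inner_eq_sum]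
  · filter_upwards [h.hessian_symm] with x hx
    simp only [radialGrad, dilationDeriv, smul_eq_mul, PiLp.add_apply, WithLp.ofLp_sum,
      Finset.sum_apply, PiLp.smul_apply]
    congr 1
    exact Finset.sum_congr rfl fun i _ => by rw [hx k i]

lemma weak_radialGrad (h : StableData f u G W W₂) (k : Fin n) :
    ∃ Z, HasWeakDerivAlong (stdVec k) (radialGrad G W) Z :=
  ⟨_, (h.weak_G k).add (HasWeakDerivAlong.sum_coord_smul fun i => h.weak_W i k)⟩

lemma locallyIntegrable_radialGrad [NeZero n] (h : StableData f u G W W₂) :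
    LocallyIntegrable (radialGrad G W) volume :=
  (h.weak_radialGrad 0).choose_spec.1

lemma locallyIntegrable_radial [NeZero n] (h : StableData f u G W W₂) :
    LocallyIntegrable (radial G) volume := (h.weak_radial 0).1

/-- The arctangent estimate applied to v itself, which has two weak derivatives because u has three.
It justifies the truncated multipliers at a fixed δ. -/
lemma locallyIntegrable_radialGrad_sq_div (h : StableData f u G W W₂) :
    LocallyIntegrable (fun x => ‖radialGrad G W x‖ ^ 2 / (1 + radial G x ^ 2)) volume := by
  have h1 : ∀ k, LocallyIntegrable (fun x => radialGrad G W x k ^ 2 / (1 + radial G x ^ 2))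
      volume := by
    intro k
    obtain ⟨Z, hZ⟩ := h.weak_radialGrad k
    exact (h.weak_radial k).locallyIntegrable_sq_div (hZ.coord k)
  have h2 : LocallyIntegrable (∑ k, fun x => radialGrad G W x k ^ 2 / (1 + radial G x ^ 2))
      volume := locallyIntegrable_finsetSum' _ fun j _ => h1 j
  refine h2.congr (Eventually.of_forall fun x => ?_)
  simp only [Finset.sum_apply, EuclideanSpace.real_norm_sq_eq, Finset.sum_div]

lemma inner_mcDeriv_sum_le {ι : Type*} (s : Finset ι) (p : EuclideanSpace ℝ (Fin n))
    (q : ι → EuclideanSpace ℝ (Fin n)) :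
    ⟪mcDeriv p (∑ i ∈ s, q i), ∑ i ∈ s, q i⟫_ℝ ≤
      2 ^ s.card * ∑ i ∈ s, ⟪mcDeriv p (q i), q i⟫_ℝ := by
  classical
  induction s using Finset.induction_on with
  | empty => simp
  | insert a s ha ih =>
    rw [Finset.sum_insert ha, Finset.sum_insert ha, Finset.card_insert_of_notMem ha, pow_succ]
    have h1 := inner_mcDeriv_add_le p (q a) (∑ i ∈ s, q i)
    have h2 := inner_mcDeriv_self_nonneg p (q a)
    have h3 : (1 : ℝ) ≤ 2 ^ s.card := one_le_pow₀ (by norm_num)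
    nlinarith [mul_nonneg (sub_nonneg.2 h3) h2]

/-- This bound carries no weight in v, so it dominates uniformly as the truncation is removed. The
flux itself serves as the bounded monotone map and controls A W_i·W_i for each i. These are combined
through ∇v = G + ∑ x_i W_i, with A G·G ≤ |G|. -/
lemma locallyIntegrable_inner_radialGrad [NeZero n] (h : StableData f u G W W₂) :
    LocallyIntegrable (fun x => ⟪mcDeriv (G x) (radialGrad G W x), radialGrad G W x⟫_ℝ)
      volume := by
  have h1 : ∀ i, LocallyIntegrable (fun x => ⟪mcDeriv (G x) (W i x), W i x⟫_ℝ) volume := by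
    intro i
    have := (h.weak_G i).locallyIntegrable_inner_fderiv (h.weak_W i i) (H := mcMap)
      (contDiff_mcMap.of_le (by simp)) (C := 1) (D := 2) norm_mcMap_le_one
      (fun y => by rw [fderiv_mcMap]; exact norm_mcDeriv_le y)
      (fun y z => by rw [fderiv_mcMap]; exact inner_mcDeriv_self_nonneg y z)
    simpa only [fderiv_mcMap] using this
  have h2 : ∀ i, LocallyIntegrable (fun x => x i ^ 2 * ⟪mcDeriv (G x) (W i x), W i x⟫_ℝ)
      volume := fun i => (h1 i).continuous_smul ((contDiff_coord i).continuous.pow 2)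
  have h3 : LocallyIntegrable
      (∑ i, fun x => x i ^ 2 * ⟪mcDeriv (G x) (W i x), W i x⟫_ℝ) volume :=
    locallyIntegrable_finsetSum' _ fun j _ => h2 j
  have hb := ((locallyIntegrable_norm h.locallyIntegrable_G).smul (2 : ℝ)).add
    (h3.smul ((2 : ℝ) * 2 ^ n))
  have mN := h.locallyIntegrable_radialGrad.aestronglyMeasurable
  refine hb.mono ?_ (Eventually.of_forall fun x => ?_)
  · exact (isBoundedBilinearMap_apply.continuous.comp_aestronglyMeasurable
      ((contDiff_mcDeriv.continuous.comp_aestronglyMeasurable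
        h.locallyIntegrable_G.aestronglyMeasurable).prodMk mN)).inner mN
  · rw [Real.norm_of_nonneg (inner_mcDeriv_self_nonneg _ _)]
    refine le_trans ?_ (le_abs_self _)
    have e1 := inner_mcDeriv_add_le (G x) (G x) (dilationDeriv W x)
    have e2 := inner_mcDeriv_sum_le Finset.univ (G x) (fun i => x i • W i x)
    have e3 : ⟪mcDeriv (G x) (G x), G x⟫_ℝ ≤ ‖G x‖ := by
      rw [mcDeriv_self, real_inner_smul_left, real_inner_self_eq_norm_sq]
      have a1 := mcFactor_pos (G x)
      have a2 := mcFactor_mul_norm_le_one (G x)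
      have a3 : mcFactor (G x) ^ 2 ≤ 1 := pow_le_one₀ a1.le (mcFactor_le_one _)
      calc mcFactor (G x) ^ 3 * ‖G x‖ ^ 2
          = mcFactor (G x) ^ 2 * (mcFactor (G x) * ‖G x‖) * ‖G x‖ := by ring
        _ ≤ 1 * 1 * ‖G x‖ := by gcongr
        _ = _ := by ring
    simp only [map_smul, real_inner_smul_left, real_inner_smul_right, Finset.card_univ,
      Fintype.card_fin] at e2
    simp only [Pi.add_apply, Pi.smul_apply, Finset.sum_apply, smul_eq_mul]
    have e4 : ∑ i, x i * (x i * ⟪mcDeriv (G x) (W i x), W i x⟫_ℝ) =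
        ∑ i, x i ^ 2 * ⟪mcDeriv (G x) (W i x), W i x⟫_ℝ :=
      Finset.sum_congr rfl fun i _ => by ring
    rw [e4] at e2
    unfold radialGrad
    unfold dilationDeriv at e1 ⊢
    linarith

end StableData

/-! ### The paired truncations of the radial derivative. -/

section RealTruncation

/-- The function `w / (1 + δ²w²)`, equal to `(trunc δ w)² / w`. -/
noncomputable def truncSq (δ w : ℝ) : ℝ := mcFactor (δ • w) ^ 2 * w

lemma mcFactor_real_sq (δ w : ℝ) : mcFactor (δ • w) ^ 2 * (1 + δ ^ 2 * w ^ 2) = 1 := by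
  have := mcFactor_sq (δ • w)
  rwa [norm_smul, mul_pow, Real.norm_eq_abs, Real.norm_eq_abs, sq_abs, sq_abs] at this

lemma trunc_real (δ w : ℝ) : trunc δ w = mcFactor (δ • w) * w := rfl

lemma fderiv_trunc_real {δ : ℝ} (hδ : δ ≠ 0) (w z : ℝ) :
    fderiv ℝ (trunc δ : ℝ → ℝ) w z = mcFactor (δ • w) ^ 3 * z := by
  rw [(hasFDerivAt_trunc hδ w).fderiv, mcDeriv_apply]
  have h := mcFactor_real_sq δ w
  simp only [smul_eq_mul, RCLike.inner_apply, conj_trivial] at h ⊢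
  linear_combination (- mcFactor (δ * w) * z) * h

lemma contDiff_truncSq (δ : ℝ) : ContDiff ℝ ∞ (truncSq δ) :=
  ((contDiff_mcFactor.comp (contDiff_const_smul δ)).pow 2).mul contDiff_id

lemma deriv_truncSq (δ w : ℝ) :
    deriv (truncSq δ) w = 2 * mcFactor (δ • w) ^ 4 - mcFactor (δ • w) ^ 2 := by
  have h1 : HasFDerivAt (fun w : ℝ => δ • w) (δ • ContinuousLinearMap.id ℝ ℝ) w :=
    (hasFDerivAt_id w).const_smul δ
  have h2 := ((hasFDerivAt_mcFactor (δ • w)).comp w h1).hasDerivAt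
  have h3 : HasDerivAt (truncSq δ) _ w := (h2.pow 2).mul (hasDerivAt_id w)
  rw [h3.deriv]
  have h := mcFactor_real_sq δ w
  simp only [ContinuousLinearMap.comp_apply, smul_apply, ContinuousLinearMap.id_apply,
    innerSL_apply_apply, RCLike.inner_apply, conj_trivial, smul_eq_mul, Function.comp_apply,
    Pi.pow_apply] at h ⊢
  norm_num
  linear_combination (-2 * mcFactor (δ * w) ^ 2) * h

lemma abs_deriv_truncSq_le (δ w : ℝ) : |deriv (truncSq δ) w| ≤ mcFactor (δ • w) ^ 2 := by
  rw [deriv_truncSq, abs_le]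
  have h1 : mcFactor (δ • w) ^ 2 ≤ 1 := pow_le_one₀ (mcFactor_pos _).le (mcFactor_le_one _)
  have h2 := sq_nonneg (mcFactor (δ • w))
  constructor <;> nlinarith

lemma mcFactor_real_sq_le {δ : ℝ} (hδ : 0 < δ) (hδ1 : δ ≤ 1) (w : ℝ) :
    mcFactor (δ • w) ^ 2 ≤ (δ ^ 2)⁻¹ * (1 + w ^ 2)⁻¹ := by
  have h := mcFactor_real_sq δ w
  have h2 := sq_nonneg (mcFactor (δ • w))
  rw [← mul_inv, ← one_div, le_div_iff₀ (by positivity), ← h]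
  have h3 : δ ^ 2 ≤ 1 := pow_le_one₀ hδ.le hδ1
  gcongr
  nlinarith [sq_nonneg w]

lemma abs_truncSq_le_inv {δ : ℝ} (hδ : 0 < δ) (w : ℝ) : |truncSq δ w| ≤ δ⁻¹ := by
  have h1 := norm_trunc_le_inv hδ w
  rw [trunc_real, norm_mul, Real.norm_of_nonneg (mcFactor_pos _).le, Real.norm_eq_abs] at h1
  rw [truncSq, abs_mul, abs_of_nonneg (sq_nonneg _), sq, mul_assoc]
  exact (mul_le_of_le_one_left (mul_nonneg (mcFactor_pos _).le (abs_nonneg w))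
    (mcFactor_le_one _)).trans h1

/-- This is why two truncations are used: testing the linearized equation with `truncSq` and
stability with `trunc` yields the same term in f'(u). -/
lemma mul_truncSq (δ w : ℝ) : w * truncSq δ w = trunc δ w ^ 2 := by
  rw [truncSq, trunc_real]
  ring

end RealTruncation

/-! ### The linearized equation for the radial derivative. -/

namespace StableData

variable {n : ℕ} {f : ℝ → ℝ} {u : EuclideanSpace ℝ (Fin n) → ℝ}
  {G : EuclideanSpace ℝ (Fin n) → EuclideanSpace ℝ (Fin n)}
  {W : Fin n → EuclideanSpace ℝ (Fin n) → EuclideanSpace ℝ (Fin n)}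
  {W₂ : Fin n → Fin n → EuclideanSpace ℝ (Fin n) → EuclideanSpace ℝ (Fin n)}

lemma norm_flux_factor_smul_le (p : EuclideanSpace ℝ (Fin n)) :
    ‖(mcFactor p + mcFactor p ^ 3) • p‖ ≤ 2 := by
  have h1 := mcFactor_pos p
  have h2 := mcFactor_mul_norm_le_one p
  have h3 : mcFactor p ^ 2 ≤ 1 := pow_le_one₀ h1.le (mcFactor_le_one p)
  rw [norm_smul, Real.norm_of_nonneg (by positivity)]
  calc (mcFactor p + mcFactor p ^ 3) * ‖p‖
      = (1 + mcFactor p ^ 2) * (mcFactor p * ‖p‖) := by ring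
    _ ≤ (1 + 1) * 1 := by gcongr
    _ = 2 := by norm_num

lemma norm_dilationFlux_le (x : EuclideanSpace ℝ (Fin n)) :
    ‖dilationFlux G W x‖ ≤ 2 * ‖radialGrad G W x‖ + 2 := by
  rw [dilationFlux_eq]
  exact (norm_sub_le _ _).trans
    (add_le_add (norm_mcDeriv_apply_le _ _) (norm_flux_factor_smul_le _))

/-- The equation satisfied by `x · ∇u`, tested with `truncSq δ (x · ∇u) η²`. -/
lemma integral_linearized [NeZero n] (h : StableData f u G W W₂) {δ : ℝ} (hδ : 0 < δ)
    (hδ1 : δ ≤ 1) {η : EuclideanSpace ℝ (Fin n) → ℝ} (hη : ContDiff ℝ ∞ η)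
    (hs : HasCompactSupport η) :
    Integrable (fun x =>
      η x ^ 2 * (deriv (truncSq δ) (radial G x) * ⟪dilationFlux G W x, radialGrad G W x⟫_ℝ) +
        2 * η x * truncSq δ (radial G x) * ⟪dilationFlux G W x, ∇ η x⟫_ℝ) volume ∧
    ∫ x, deriv f (u x) * (trunc δ (radial G x) * η x) ^ 2 = ∫ x,
      (η x ^ 2 * (deriv (truncSq δ) (radial G x) * ⟪dilationFlux G W x, radialGrad G W x⟫_ℝ) +
        2 * η x * truncSq δ (radial G x) * ⟪dilationFlux G W x, ∇ η x⟫_ℝ) := by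
  -- Majorant for the product rule: the derivative of `truncSq` decays like 1/(δ²(1 + v²)), which
  -- compensates the quadratic growth in ∇v.
  have hb : LocallyIntegrable (fun x => 2 * (δ ^ 2)⁻¹ *
      (‖radialGrad G W x‖ ^ 2 / (1 + radial G x ^ 2)) + 2 * ‖radialGrad G W x‖) volume :=
    (h.locallyIntegrable_radialGrad_sq_div.smul (2 * (δ ^ 2)⁻¹)).add
      ((locallyIntegrable_norm h.locallyIntegrable_radialGrad).smul (2 : ℝ))
  have hk : ∀ k, HasWeakDerivAlong (stdVec k)
      (fun x => truncSq δ (radial G x) * dilationFlux G W x k)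
      (fun x => (deriv (truncSq δ) (radial G x) * radialGrad G W x k) * dilationFlux G W x k +
        truncSq δ (radial G x) * ∑ i, x i * fluxHessian G W W₂ i k x k) := by
    intro k
    have h1 := (h.weak_radial k).comp_smul_of_bounded (h.weak_dilationFlux k)
      ((contDiff_truncSq δ).of_le (by simp)) (C := δ⁻¹) (D := 1) (abs_truncSq_le_inv hδ)
      (fun y => (abs_deriv_truncSq_le δ y).trans
        (pow_le_one₀ (mcFactor_pos _).le (mcFactor_le_one _))) hb
      (Eventually.of_forall fun x => by
        have a1 := abs_deriv_truncSq_le δ (radial G x)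
        have a2 := mcFactor_real_sq_le hδ hδ1 (radial G x)
        have a3 : |radialGrad G W x k| ≤ ‖radialGrad G W x‖ :=
          (Real.norm_eq_abs _).symm.trans_le (PiLp.norm_apply_le (radialGrad G W x) k)
        have a4 := norm_dilationFlux_le (G := G) (W := W) x
        have a5 : mcFactor (δ • radial G x) ^ 2 ≤ 1 :=
          pow_le_one₀ (mcFactor_pos _).le (mcFactor_le_one _)
        calc _ ≤ mcFactor (δ • radial G x) ^ 2 * ‖radialGrad G W x‖ *
              (2 * ‖radialGrad G W x‖ + 2) := by gcongr
          _ = 2 * (mcFactor (δ • radial G x) ^ 2 * ‖radialGrad G W x‖ ^ 2) +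
              2 * (mcFactor (δ • radial G x) ^ 2 * ‖radialGrad G W x‖) := by ring
          _ ≤ 2 * ((δ ^ 2)⁻¹ * (1 + radial G x ^ 2)⁻¹ * ‖radialGrad G W x‖ ^ 2) +
              2 * (1 * ‖radialGrad G W x‖) := by gcongr
          _ = _ := by ring)
    refine (h1.coord k).congr (Eventually.of_forall fun x => rfl) (Eventually.of_forall fun x => ?_)
    simp [WithLp.ofLp_sum]
  have hη2 : ContDiff ℝ ∞ fun x => η x ^ 2 := hη.pow 2
  have hs2 : HasCompactSupport fun x => η x ^ 2 := by
    simp only [sq]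
    exact hs.mul_left
  have hfd : ∀ x e, fderiv ℝ (fun x => η x ^ 2) x e = 2 * η x * fderiv ℝ η x e := by
    intro x e
    rw [fderiv_fun_pow 2 (hη.differentiable (by simp) x)]
    simp
  have h1 : ∀ k, Integrable (fun x => 2 * η x * fderiv ℝ η x (stdVec k) *
      (truncSq δ (radial G x) * dilationFlux G W x k)) volume := by
    intro k
    have := (hk k).1.integrable_test_mul (continuous_fderiv_apply_of_contDiff hη2 (stdVec k))
      (hasCompactSupport_fderiv_apply_of hs2 _)
    simpa only [hfd] using this
  have h2 := fun k => (hk k).2.1.integrable_test_mul hη2.continuous hs2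
  have h3 : ∀ k, ∫ x, 2 * η x * fderiv ℝ η x (stdVec k) *
      (truncSq δ (radial G x) * dilationFlux G W x k) = -∫ x, η x ^ 2 *
      ((deriv (truncSq δ) (radial G x) * radialGrad G W x k) * dilationFlux G W x k +
        truncSq δ (radial G x) * ∑ i, x i * fluxHessian G W W₂ i k x k) := by
    intro k
    have := (hk k).2.2 _ hη2 hs2
    simpa only [hfd, smul_eq_mul] using this
  have e1 : ∀ x, ∑ k, 2 * η x * fderiv ℝ η x (stdVec k) *
      (truncSq δ (radial G x) * dilationFlux G W x k) =
      2 * η x * truncSq δ (radial G x) * ⟪dilationFlux G W x, ∇ η x⟫_ℝ := by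
    intro x
    rw [euclidean_inner_eq_sum, Finset.mul_sum]
    refine Finset.sum_congr rfl fun k _ => ?_
    rw [gradient_coord]
    ring
  -- Taking the divergence, the symmetry of `fluxHessian` exchanges the indices and the
  -- differentiated equation turns the second-order terms into −f'(u)v.
  have e2 : ∀ᵐ x, ∑ k, η x ^ 2 *
      ((deriv (truncSq δ) (radial G x) * radialGrad G W x k) * dilationFlux G W x k +
        truncSq δ (radial G x) * ∑ i, x i * fluxHessian G W W₂ i k x k) =
      η x ^ 2 * (deriv (truncSq δ) (radial G x) * ⟪dilationFlux G W x, radialGrad G W x⟫_ℝ) -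
        deriv f (u x) * (trunc δ (radial G x) * η x) ^ 2 := by
    filter_upwards [h.fluxHessian_symm, ae_all_iff.2 h.deriv_equation_ae] with x hx hx'
    rw [← Finset.mul_sum, Finset.sum_add_distrib, ← Finset.mul_sum, Finset.sum_comm]
    have a1 : ∑ i, ∑ k, x i * fluxHessian G W W₂ i k x k = -(deriv f (u x) * radial G x) := by
      rw [radial, euclidean_inner_eq_sum, Finset.mul_sum, ← Finset.sum_neg_distrib]
      refine Finset.sum_congr rfl fun i _ => ?_
      rw [← Finset.mul_sum]
      have : ∑ k, fluxHessian G W W₂ i k x k = -(deriv f (u x) * G x i) := by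
        rw [hx' i, neg_neg]
        exact Finset.sum_congr rfl fun k _ => by rw [hx i k]
      rw [this]
      ring
    rw [a1, mul_pow, ← mul_truncSq, euclidean_inner_eq_sum, Finset.mul_sum, mul_add, Finset.mul_sum,
      Finset.mul_sum, sub_eq_add_neg]
    congr 1
    · exact Finset.sum_congr rfl fun k _ => by ring
    · ring
  have i1 : Integrable (fun x => 2 * η x * truncSq δ (radial G x) *
      ⟪dilationFlux G W x, ∇ η x⟫_ℝ) volume := by
    have := integrable_finsetSum Finset.univ fun k _ => h1 k
    simpa only [e1] using this
  have i2 : Integrable (fun x =>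
      η x ^ 2 * (deriv (truncSq δ) (radial G x) * ⟪dilationFlux G W x, radialGrad G W x⟫_ℝ) -
        deriv f (u x) * (trunc δ (radial G x) * η x) ^ 2) volume :=
    (integrable_finsetSum Finset.univ fun k _ => h2 k).congr e2
  have i3 : Integrable (fun x => deriv f (u x) * (trunc δ (radial G x) * η x) ^ 2) volume := by
    have l1 : LocallyIntegrable (fun x => deriv f (u x) * trunc δ (radial G x) ^ 2) volume := by
      refine (h.locallyIntegrable_deriv.smul (δ⁻¹ ^ 2)).mono
        (h.locallyIntegrable_deriv.aestronglyMeasurable.mul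
          (((contDiff_trunc δ).continuous.comp_aestronglyMeasurable
            h.locallyIntegrable_radial.aestronglyMeasurable).pow 2))
        (Eventually.of_forall fun x => ?_)
      rw [norm_mul, norm_pow, Pi.smul_apply, norm_smul, norm_pow,
        Real.norm_of_nonneg (inv_nonneg.2 hδ.le), mul_comm]
      gcongr
      exact norm_trunc_le_inv hδ _
    refine (l1.integrable_test_mul hη2.continuous hs2).congr (Eventually.of_forall fun x => ?_)
    simp only
    ring
  have i4 : Integrable (fun x => η x ^ 2 * (deriv (truncSq δ) (radial G x) *
      ⟪dilationFlux G W x, radialGrad G W x⟫_ℝ)) volume := by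
    refine (i2.add i3).congr (Eventually.of_forall fun x => ?_)
    simp
  refine ⟨i4.add i1, ?_⟩
  have h4 := Finset.sum_congr (rfl : (Finset.univ : Finset (Fin n)) = Finset.univ) fun k _ => h3 k
  rw [← integral_finsetSum _ fun k _ => h1 k, Finset.sum_neg_distrib,
    ← integral_finsetSum _ fun k _ => h2 k, integral_congr_ae e2, integral_sub i4 i3] at h4
  simp only [e1] at h4
  rw [integral_add i4 i1, h4]
  ring

end StableData

/-! ### Extension of stability to Sobolev test functions. -/

lemma mollify_coord {n : ℕ} (k : ℕ) {g : EuclideanSpace ℝ (Fin n) → EuclideanSpace ℝ (Fin n)}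
    (hg : LocallyIntegrable g volume) (x : EuclideanSpace ℝ (Fin n)) (i : Fin n) :
    (mollify k g x) i = mollify k (fun y => g y i) x := by
  have h1 := (convolutionExists_mollify k hg x).integrable
  have h2 := (EuclideanSpace.proj (𝕜 := ℝ) i : EuclideanSpace ℝ (Fin n) →L[ℝ]
    ℝ).integral_comp_comm h1
  rw [mollify_apply, mollify_apply]
  exact h2.symm

lemma tendsto_integral_sq_mollify_sub {E F : Type*} [NormedAddCommGroup E] [InnerProductSpace ℝ E]
    [FiniteDimensional ℝ E] [MeasurableSpace E] [BorelSpace E] [NormedAddCommGroup F]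
    [NormedSpace ℝ F] [CompleteSpace F] {g : E → F} (hg : MemLp g 2 volume) :
    Tendsto (fun k => ∫ x, ‖mollify k g x - g x‖ ^ 2) atTop (𝓝 0) := by
  have h1 := tendsto_eLpNorm_mollify_sub (by norm_num) (by norm_num) hg
  have h2 := (ENNReal.tendsto_toReal ENNReal.zero_ne_top).comp h1
  have h3 := h2.pow 2
  simp only [ENNReal.toReal_zero, ne_eq, OfNat.ofNat_ne_zero, not_false_eq_true, zero_pow,
    Function.comp_apply] at h3
  refine h3.congr fun k => ?_
  have hm : MemLp (mollify k g - g) 2 volume := by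
    refine MemLp.sub
      ⟨(contDiff_mollify k (hg.locallyIntegrable (by norm_num))).continuous.aestronglyMeasurable,
      (eLpNorm_mollify_le k hg.1 (by norm_num) (by norm_num)).trans_lt hg.2⟩ hg
  rw [hm.eLpNorm_eq_integral_rpow_norm (by norm_num) (by norm_num), ENNReal.toReal_ofReal]
  · simp only [ENNReal.toReal_ofNat, Real.rpow_ofNat, Pi.sub_apply]
    rw [← Real.rpow_natCast, ← Real.rpow_mul (integral_nonneg fun x => by positivity)]
    norm_num
  · positivity

namespace StableData

variable {n : ℕ} {f : ℝ → ℝ} {u : EuclideanSpace ℝ (Fin n) → ℝ}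
  {G : EuclideanSpace ℝ (Fin n) → EuclideanSpace ℝ (Fin n)}
  {W : Fin n → EuclideanSpace ℝ (Fin n) → EuclideanSpace ℝ (Fin n)}
  {W₂ : Fin n → Fin n → EuclideanSpace ℝ (Fin n) → EuclideanSpace ℝ (Fin n)}

/-- Young's inequality for the form, from its nonnegativity at εq − r. -/
lemma inner_mcDeriv_add_le_eps {V : Type*} [NormedAddCommGroup V] [InnerProductSpace ℝ V]
    {ε : ℝ} (hε : 0 < ε) (p q r : V) :
    ⟪mcDeriv p (q + r), q + r⟫_ℝ ≤
      (1 + ε) * ⟪mcDeriv p q, q⟫_ℝ + (1 + ε⁻¹) * ⟪mcDeriv p r, r⟫_ℝ := by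
  have h2 := inner_mcDeriv_self_nonneg p (ε • q - r)
  have h3 : ⟪mcDeriv p r, q⟫_ℝ = ⟪mcDeriv p q, r⟫_ℝ := by
    rw [inner_mcDeriv_comm, real_inner_comm]
  simp only [map_add, map_sub, map_smul, inner_add_left, inner_add_right, inner_sub_left,
    inner_sub_right, real_inner_smul_left, real_inner_smul_right, h3] at h2 ⊢
  have h4 := mul_nonneg (inv_nonneg.2 hε.le) h2
  have h6 : ε⁻¹ * (ε * (ε * ⟪mcDeriv p q, q⟫_ℝ - ⟪mcDeriv p q, r⟫_ℝ) -
      (ε * ⟪mcDeriv p q, r⟫_ℝ - ⟪mcDeriv p r, r⟫_ℝ)) =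
      ε * ⟪mcDeriv p q, q⟫_ℝ - 2 * ⟪mcDeriv p q, r⟫_ℝ + ε⁻¹ * ⟪mcDeriv p r, r⟫_ℝ := by
    field_simp
    ring
  nlinarith

lemma integrable_inner_mcDeriv [NeZero n] (h : StableData f u G W W₂)
    {N : EuclideanSpace ℝ (Fin n) → EuclideanSpace ℝ (Fin n)} (hN : MemLp N 2 volume) :
    Integrable (fun x => ⟪mcDeriv (G x) (N x), N x⟫_ℝ) volume := by
  refine ((memLp_two_iff_integrable_sq_norm hN.1).1 hN).mono ?_ (Eventually.of_forall fun x => ?_)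
  · exact (isBoundedBilinearMap_apply.continuous.comp_aestronglyMeasurable
      ((contDiff_mcDeriv.continuous.comp_aestronglyMeasurable
        h.locallyIntegrable_G.aestronglyMeasurable).prodMk hN.1)).inner hN.1
  · rw [Real.norm_of_nonneg (inner_mcDeriv_self_nonneg _ _)]
    exact (inner_mcDeriv_self_le_sq _ _).trans (le_abs_self _)

/-- The stability inequality extends to bounded compactly supported test functions with square
integrable weak gradient. -/
lemma stability_of_memLp [NeZero n] (h : StableData f u G W W₂)
    {ξ : EuclideanSpace ℝ (Fin n) → ℝ} {N : EuclideanSpace ℝ (Fin n) → EuclideanSpace ℝ (Fin n)}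
    (hξ : ∀ i, HasWeakDerivAlong (stdVec i) ξ (fun x => N x i)) {C : ℝ} (hC : ∀ x, |ξ x| ≤ C)
    (hs : HasCompactSupport ξ) (hN : MemLp N 2 volume) :
    ∫ x, deriv f (u x) * ξ x ^ 2 ≤ ∫ x, ⟪mcDeriv (G x) (N x), N x⟫_ℝ := by
  have lξ : LocallyIntegrable ξ volume := (hξ 0).1
  have lN : LocallyIntegrable N volume := hN.locallyIntegrable (by norm_num)
  have hgrad : ∀ k x, ∇ (mollify k ξ) x = mollify k N x := by
    intro k x
    ext i
    rw [gradient_coord, (hξ i).fderiv_mollify, mollify_coord k lN]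
  have hC0 : 0 ≤ C := (abs_nonneg _).trans (hC 0)
  set K := cthickening 1 (tsupport ξ)
  have hK : IsCompact K := hs.isCompact.cthickening
  have hL : Tendsto (fun k => ∫ x, deriv f (u x) * mollify k ξ x ^ 2) atTop
      (𝓝 (∫ x, deriv f (u x) * ξ x ^ 2)) := by
    refine tendsto_integral_of_dominated_convergence
      (K.indicator fun x => ‖deriv f (u x)‖ * C ^ 2) (fun k => ?_) ?_ (fun k => ?_) ?_
    · exact h.locallyIntegrable_deriv.aestronglyMeasurable.mul
        ((contDiff_mollify k lξ).continuous.pow 2).aestronglyMeasurable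
    · have : IntegrableOn (fun x => ‖deriv f (u x)‖ * C ^ 2) K volume :=
        (h.locallyIntegrable_deriv.integrableOn_isCompact hK).norm.mul_const _
      exact this.integrable_indicator hK.measurableSet
    · refine Eventually.of_forall fun x => ?_
      by_cases hx : x ∈ K
      · rw [Set.indicator_of_mem hx, norm_mul, norm_pow]
        gcongr
        exact norm_mollify_le_of_bound k hC x
      · have : mollify k ξ x = 0 := by
          by_contra hne
          exact hx (support_mollify_subset k hne)
        simp [this, hx]
    · filter_upwards [ae_tendsto_mollify lξ] with x hx
      exact (hx.pow 2).const_mul _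
  have hmem : ∀ k, MemLp (mollify k N) 2 volume := fun k =>
    ⟨(contDiff_mollify k lN).continuous.aestronglyMeasurable,
      (eLpNorm_mollify_le k hN.1 (by norm_num) (by norm_num)).trans_lt hN.2⟩
  -- The mollified gradient is written as N plus an error tending to zero in L². The form is bounded
  -- by |·|², so the error disappears in the limit for each fixed ε, and then ε tends to 0.
  have hε : ∀ ε : ℝ, 0 < ε → ∫ x, deriv f (u x) * ξ x ^ 2 ≤
      (1 + ε) * ∫ x, ⟪mcDeriv (G x) (N x), N x⟫_ℝ := by
    intro ε hε
    have hR := ((tendsto_integral_sq_mollify_sub hN).const_mul (1 + ε⁻¹)).const_add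
      ((1 + ε) * ∫ x, ⟪mcDeriv (G x) (N x), N x⟫_ℝ)
    rw [mul_zero, add_zero] at hR
    refine le_of_tendsto_of_tendsto' hL hR fun k => ?_
    have hd : MemLp (fun x => mollify k N x - N x) 2 volume := (hmem k).sub hN
    refine (h.stability _ (contDiff_mollify k lξ) (hs.mollify k)).trans ?_
    simp only [hgrad]
    rw [← integral_const_mul, ← integral_const_mul, ← integral_add
      ((h.integrable_inner_mcDeriv hN).const_mul _)
      (((memLp_two_iff_integrable_sq_norm hd.1).1 hd).const_mul _)]
    refine integral_mono (h.integrable_inner_mcDeriv (hmem k))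
      (((h.integrable_inner_mcDeriv hN).const_mul _).add
        (((memLp_two_iff_integrable_sq_norm hd.1).1 hd).const_mul _)) fun x => ?_
    have e1 := inner_mcDeriv_add_le_eps hε (G x) (N x) (mollify k N x - N x)
    rw [add_sub_cancel] at e1
    have e2 := inner_mcDeriv_self_le_sq (G x) (mollify k N x - N x)
    have e3 : 0 ≤ 1 + ε⁻¹ := by positivity
    simp only
    linarith [mul_le_mul_of_nonneg_left e2 e3]
  have hlim : Tendsto (fun k : ℕ => (1 + 1 / ((k : ℝ) + 1)) *
      ∫ x, ⟪mcDeriv (G x) (N x), N x⟫_ℝ) atTop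
      (𝓝 ((1 + 0) * ∫ x, ⟪mcDeriv (G x) (N x), N x⟫_ℝ)) :=
    (tendsto_one_div_add_atTop_nhds_zero_nat.const_add 1).mul_const _
  rw [add_zero, one_mul] at hlim
  exact ge_of_tendsto' hlim fun k => hε _ Nat.one_div_pos_of_nat

/-- Stability tested with the truncated radial derivative. -/
lemma stability_trunc_radial [NeZero n] (h : StableData f u G W W₂) {δ : ℝ} (hδ : 0 < δ)
    (hδ1 : δ ≤ 1) {η : EuclideanSpace ℝ (Fin n) → ℝ} (hη : ContDiff ℝ ∞ η)
    (hs : HasCompactSupport η) :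
    Integrable (fun x => ⟪mcDeriv (G x) ((mcFactor (δ • radial G x) ^ 3 * η x) • radialGrad G W x +
        trunc δ (radial G x) • ∇ η x), (mcFactor (δ • radial G x) ^ 3 * η x) • radialGrad G W x +
        trunc δ (radial G x) • ∇ η x⟫_ℝ) volume ∧
    ∫ x, deriv f (u x) * (trunc δ (radial G x) * η x) ^ 2 ≤
      ∫ x, ⟪mcDeriv (G x) ((mcFactor (δ • radial G x) ^ 3 * η x) • radialGrad G W x +
        trunc δ (radial G x) • ∇ η x), (mcFactor (δ • radial G x) ^ 3 * η x) • radialGrad G W x +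
        trunc δ (radial G x) • ∇ η x⟫_ℝ := by
  set N : EuclideanSpace ℝ (Fin n) → EuclideanSpace ℝ (Fin n) := fun x =>
    (mcFactor (δ • radial G x) ^ 3 * η x) • radialGrad G W x + trunc δ (radial G x) • ∇ η x
    with hNdef
  have hgc : Continuous (∇ η) := by
    have : ∇ η = fun x => (InnerProductSpace.toDual ℝ _).symm (fderiv ℝ η x) := rfl
    rw [this]
    exact (LinearIsometryEquiv.continuous _).comp (hη.continuous_fderiv (by simp))
  have hgs : HasCompactSupport (∇ η) := (hs.fderiv (𝕜 := ℝ)).comp_left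
    (g := (InnerProductSpace.toDual ℝ (EuclideanSpace ℝ (Fin n))).symm) (by simp)
  have mw := h.locallyIntegrable_radial.aestronglyMeasurable
  have mN : AEStronglyMeasurable N volume := by
    refine AEStronglyMeasurable.add ?_ ?_
    · exact (((contDiff_mcFactor.continuous.comp_aestronglyMeasurable
        (mw.const_smul δ)).pow 3).mul hη.continuous.aestronglyMeasurable).smul
          h.locallyIntegrable_radialGrad.aestronglyMeasurable
    · exact ((contDiff_trunc δ).continuous.comp_aestronglyMeasurable mw).smul
        hgc.aestronglyMeasurable
  -- The cube of `mcFactor` comes from the derivative of the scalar truncation; it makes the product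
  -- with ∇v square integrable by `locallyIntegrable_radialGrad_sq_div`.
  have hN : MemLp N 2 volume := by
    rw [memLp_two_iff_integrable_sq_norm mN]
    have i1 : Integrable (fun x => η x ^ 2 *
        (2 * (δ ^ 2)⁻¹ * (‖radialGrad G W x‖ ^ 2 / (1 + radial G x ^ 2)))) volume :=
      (h.locallyIntegrable_radialGrad_sq_div.smul (2 * (δ ^ 2)⁻¹)).integrable_test_mul
        (hη.continuous.pow 2) (by simp only [sq]; exact hs.mul_left)
    have i2 : Integrable (fun x => 2 * (δ ^ 2)⁻¹ * ‖∇ η x‖ ^ 2) volume := by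
      refine Integrable.const_mul ?_ _
      refine (hgc.norm.pow 2).integrable_of_hasCompactSupport ?_
      have := hgs.norm
      simp only [sq]
      exact this.mul_left
    refine (i1.add i2).mono' (mN.norm.pow 2) (Eventually.of_forall fun x => ?_)
    have a1 : mcFactor (δ • radial G x) ^ 6 ≤ (δ ^ 2)⁻¹ * (1 + radial G x ^ 2)⁻¹ := by
      refine le_trans ?_ (mcFactor_real_sq_le hδ hδ1 (radial G x))
      exact pow_le_pow_of_le_one (mcFactor_pos _).le (mcFactor_le_one _) (by norm_num)
    have a2 := norm_trunc_le_inv hδ (radial G x)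
    have a3 : ‖N x‖ ^ 2 ≤ 2 * ‖(mcFactor (δ • radial G x) ^ 3 * η x) • radialGrad G W x‖ ^ 2 +
        2 * ‖trunc δ (radial G x) • ∇ η x‖ ^ 2 := by
      have := norm_add_le ((mcFactor (δ • radial G x) ^ 3 * η x) • radialGrad G W x)
        (trunc δ (radial G x) • ∇ η x)
      have h0 : ‖N x‖ ≤ _ := this
      nlinarith [norm_nonneg (N x),
        sq_nonneg (‖(mcFactor (δ • radial G x) ^ 3 * η x) • radialGrad G W x‖ -
          ‖trunc δ (radial G x) • ∇ η x‖)]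
    rw [norm_pow, norm_norm]
    refine a3.trans ?_
    rw [norm_smul, norm_smul, mul_pow, mul_pow, norm_mul, mul_pow, Real.norm_eq_abs (η x), sq_abs,
      norm_pow, Real.norm_of_nonneg (mcFactor_pos _).le, ← pow_mul]
    have a4 : ‖trunc δ (radial G x)‖ ^ 2 ≤ (δ ^ 2)⁻¹ := by
      rw [← inv_pow]
      gcongr
    simp only [Pi.add_apply]
    refine add_le_add ?_ ?_
    · calc 2 * (mcFactor (δ • radial G x) ^ (3 * 2) * η x ^ 2 * ‖radialGrad G W x‖ ^ 2)
          ≤ 2 * ((δ ^ 2)⁻¹ * (1 + radial G x ^ 2)⁻¹ * η x ^ 2 * ‖radialGrad G W x‖ ^ 2) := by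
            gcongr
        _ = _ := by ring
    · calc _ ≤ 2 * ((δ ^ 2)⁻¹ * ‖∇ η x‖ ^ 2) := by gcongr
        _ = _ := by ring
  refine ⟨h.integrable_inner_mcDeriv hN, ?_⟩
  obtain ⟨C, hC⟩ := hη.continuous.bounded_above_of_compact_support hs
  refine h.stability_of_memLp (fun i => ?_) (C := δ⁻¹ * C) (fun x => ?_) hs.mul_left hN
  · have h1 := (h.weak_radial i).comp_of_bounded_fderiv (Φ := trunc δ)
      ((contDiff_trunc δ).of_le (by simp)) (C := 2)
      (fun y => by rw [(hasFDerivAt_trunc hδ.ne' y).fderiv]; exact norm_mcDeriv_le _)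
    refine (h1.smooth_smul hη).congr (Eventually.of_forall fun x => ?_)
      (Eventually.of_forall fun x => ?_)
    · simp only [smul_eq_mul, mul_comm]
    · simp only [PiLp.add_apply, PiLp.smul_apply, smul_eq_mul, gradient_coord,
        fderiv_trunc_real hδ.ne']
      ring
  · rw [← Real.norm_eq_abs, norm_mul]
    exact mul_le_mul (norm_trunc_le_inv hδ _) (hC x) (norm_nonneg _) (inv_nonneg.2 hδ.le)

end StableData

lemma continuous_gradient_of_contDiff {n : ℕ} {η : EuclideanSpace ℝ (Fin n) → ℝ}
    (hη : ContDiff ℝ ∞ η) : Continuous (∇ η) := by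
  have : ∇ η = fun x => (InnerProductSpace.toDual ℝ _).symm (fderiv ℝ η x) := rfl
  rw [this]
  exact (LinearIsometryEquiv.continuous _).comp (hη.continuous_fderiv (by simp))

lemma HasCompactSupport.gradient {n : ℕ} {η : EuclideanSpace ℝ (Fin n) → ℝ}
    (hs : HasCompactSupport η) : HasCompactSupport (∇ η) :=
  (hs.fderiv (𝕜 := ℝ)).comp_left
    (g := (InnerProductSpace.toDual ℝ (EuclideanSpace ℝ (Fin n))).symm) (by simp)

/-! ### Stability tested with the radial derivative, and the Pohozaev identity. -/

namespace StableData

variable {n : ℕ} {f : ℝ → ℝ} {u : EuclideanSpace ℝ (Fin n) → ℝ}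
  {G : EuclideanSpace ℝ (Fin n) → EuclideanSpace ℝ (Fin n)}
  {W : Fin n → EuclideanSpace ℝ (Fin n) → EuclideanSpace ℝ (Fin n)}
  {W₂ : Fin n → Fin n → EuclideanSpace ℝ (Fin n) → EuclideanSpace ℝ (Fin n)}

/-- The factor `1/s + 1/s³` with `s = √(1 + |p|²)`. -/
noncomputable def fluxFactor (p : EuclideanSpace ℝ (Fin n)) : ℝ := mcFactor p + mcFactor p ^ 3

lemma radial_sq_le (G : EuclideanSpace ℝ (Fin n) → EuclideanSpace ℝ (Fin n))
    (x : EuclideanSpace ℝ (Fin n)) : radial G x ^ 2 ≤ ‖x‖ ^ 2 * ‖G x‖ ^ 2 := by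
  rw [← mul_pow, ← sq_abs]
  gcongr
  exact abs_real_inner_le_norm x (G x)

/-- One of the two factors |G| is absorbed by the degeneracy of the form. Only |G|, and not |G|², is
known to be locally integrable. -/
lemma radial_sq_mul_inner_le (x v : EuclideanSpace ℝ (Fin n)) :
    radial G x ^ 2 * ⟪mcDeriv (G x) v, v⟫_ℝ ≤ ‖x‖ ^ 2 * ‖v‖ ^ 2 * ‖G x‖ := by
  have h1 := radial_sq_le G x
  have h2 := inner_mcDeriv_self_le (G x) v
  have h3 := mcFactor_pos (G x)
  have h4 := mcFactor_mul_norm_le_one (G x)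
  calc _ ≤ ‖x‖ ^ 2 * ‖G x‖ ^ 2 * (mcFactor (G x) * ‖v‖ ^ 2) :=
        mul_le_mul h1 h2 (inner_mcDeriv_self_nonneg _ _) (by positivity)
    _ = ‖x‖ ^ 2 * ‖v‖ ^ 2 * ‖G x‖ * (mcFactor (G x) * ‖G x‖) := by ring
    _ ≤ ‖x‖ ^ 2 * ‖v‖ ^ 2 * ‖G x‖ * 1 := by gcongr
    _ = _ := mul_one _

/-- Stability tested with the radial derivative, after removal of the truncation. -/
lemma radial_stability [NeZero n] (h : StableData f u G W W₂)
    {η : EuclideanSpace ℝ (Fin n) → ℝ} (hη : ContDiff ℝ ∞ η) (hs : HasCompactSupport η) :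
    Integrable (fun x => radial G x ^ 2 * ⟪mcDeriv (G x) (∇ η x), ∇ η x⟫_ℝ +
      η x ^ 2 * (fluxFactor (G x) * ⟪G x, radialGrad G W x⟫_ℝ) +
      2 * η x * radial G x * (fluxFactor (G x) * ⟪G x, ∇ η x⟫_ℝ)) volume ∧
    0 ≤ ∫ x, (radial G x ^ 2 * ⟪mcDeriv (G x) (∇ η x), ∇ η x⟫_ℝ +
      η x ^ 2 * (fluxFactor (G x) * ⟪G x, radialGrad G W x⟫_ℝ) +
      2 * η x * radial G x * (fluxFactor (G x) * ⟪G x, ∇ η x⟫_ℝ)) := by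
  -- Difference of the integrands of the stability inequality and of the linearized equation, as a
  -- function of the truncation factor s. At s = 1 the coefficients of A∇v·∇v and A∇v·∇η vanish.
  set J : ℝ → EuclideanSpace ℝ (Fin n) → ℝ := fun s x =>
    η x ^ 2 * (s ^ 6 - 2 * s ^ 4 + s ^ 2) *
      ⟪mcDeriv (G x) (radialGrad G W x), radialGrad G W x⟫_ℝ +
    2 * (s ^ 4 - s ^ 2) * (η x * radial G x * ⟪mcDeriv (G x) (radialGrad G W x), ∇ η x⟫_ℝ) +
    s ^ 2 * (radial G x ^ 2 * ⟪mcDeriv (G x) (∇ η x), ∇ η x⟫_ℝ) +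
    (2 * s ^ 4 - s ^ 2) * (η x ^ 2 * (fluxFactor (G x) * ⟪G x, radialGrad G W x⟫_ℝ)) +
    s ^ 2 * (2 * η x * radial G x * (fluxFactor (G x) * ⟪G x, ∇ η x⟫_ℝ)) with hJ
  set δ : ℕ → ℝ := fun k => 1 / ((k : ℝ) + 1)
  have hδ : ∀ k, 0 < δ k := fun k => Nat.one_div_pos_of_nat
  have hδ1 : ∀ k, δ k ≤ 1 := fun k => by
    rw [div_le_one (by positivity)]
    linarith [(Nat.cast_nonneg k : (0 : ℝ) ≤ k)]
  have hδ0 : Tendsto δ atTop (𝓝 0) := tendsto_one_div_add_atTop_nhds_zero_nat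
  have hk : ∀ k, Integrable (fun x => J (mcFactor (δ k • radial G x)) x) volume ∧
      0 ≤ ∫ x, J (mcFactor (δ k • radial G x)) x := by
    intro k
    obtain ⟨i1, e1⟩ := h.integral_linearized (hδ k) (hδ1 k) hη hs
    obtain ⟨i2, e2⟩ := h.stability_trunc_radial (hδ k) (hδ1 k) hη hs
    rw [e1, ← sub_nonneg, ← integral_sub i2 i1] at e2
    have e3 : ∀ x, J (mcFactor (δ k • radial G x)) x =
        ⟪mcDeriv (G x) ((mcFactor (δ k • radial G x) ^ 3 * η x) • radialGrad G W x +
          trunc (δ k) (radial G x) • ∇ η x),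
          (mcFactor (δ k • radial G x) ^ 3 * η x) • radialGrad G W x +
          trunc (δ k) (radial G x) • ∇ η x⟫_ℝ -
        (η x ^ 2 * (deriv (truncSq (δ k)) (radial G x) *
          ⟪dilationFlux G W x, radialGrad G W x⟫_ℝ) +
        2 * η x * truncSq (δ k) (radial G x) * ⟪dilationFlux G W x, ∇ η x⟫_ℝ) := by
      intro x
      have hsym : ⟪mcDeriv (G x) (∇ η x), radialGrad G W x⟫_ℝ =
          ⟪mcDeriv (G x) (radialGrad G W x), ∇ η x⟫_ℝ := by
        rw [inner_mcDeriv_comm, real_inner_comm]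
      rw [deriv_truncSq, dilationFlux_eq, truncSq, trunc_real]
      simp only [map_add, map_smul, inner_add_left, inner_add_right, inner_sub_left,
        real_inner_smul_left, real_inner_smul_right, hsym, hJ, fluxFactor]
      ring
    simp only [← e3] at e2
    exact ⟨(i2.sub i1).congr (Eventually.of_forall fun x => (e3 x).symm), e2⟩
  have cg := continuous_gradient_of_contDiff hη
  have sg := hs.gradient
  have lNN := h.locallyIntegrable_inner_radialGrad
  have lN := locallyIntegrable_norm h.locallyIntegrable_radialGrad
  have lG := locallyIntegrable_norm h.locallyIntegrable_G
  -- Majorant independent of δ: all polynomial coefficients in J are bounded for 0 < s ≤ 1, and the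
  -- mixed term is split by Cauchy–Schwarz for the form.
  set B : EuclideanSpace ℝ (Fin n) → ℝ := fun x =>
    η x ^ 2 * (2 * ⟪mcDeriv (G x) (radialGrad G W x), radialGrad G W x⟫_ℝ +
      2 * ‖radialGrad G W x‖) +
      (2 * ‖x‖ ^ 2 * ‖∇ η x‖ ^ 2 + 4 * |η x| * ‖x‖ * ‖∇ η x‖) * ‖G x‖ with hB
  have iB : Integrable B volume := by
    refine Integrable.add ?_ ?_
    · exact ((lNN.smul (2 : ℝ)).add (lN.smul (2 : ℝ))).integrable_test_mul
        (hη.continuous.pow 2) (by simp only [sq]; exact hs.mul_left)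
    · refine lG.integrable_test_mul (by have := hη.continuous; fun_prop) ?_
      refine HasCompactSupport.add ?_ ?_
      · simp only [sq ‖∇ η _‖]
        exact (sg.norm.mul_left).mul_left
      · exact sg.norm.mul_left
  have hbd : ∀ k x, ‖J (mcFactor (δ k • radial G x)) x‖ ≤ B x := by
    intro k x
    set s := mcFactor (δ k • radial G x)
    have hs0 : 0 < s := mcFactor_pos _
    have hs1 : s ≤ 1 := mcFactor_le_one _
    have b2 : s ^ 2 ≤ 1 := pow_le_one₀ hs0.le hs1
    have b20 : 0 < s ^ 2 := by positivity
    have e4 : s ^ 4 = s ^ 2 * s ^ 2 := by ring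
    have e6 : s ^ 6 = s ^ 2 * s ^ 2 * s ^ 2 := by ring
    have c1 : |s ^ 6 - 2 * s ^ 4 + s ^ 2| ≤ 1 := by
      have : s ^ 6 - 2 * s ^ 4 + s ^ 2 = s ^ 2 * (1 - s ^ 2) ^ 2 := by ring
      rw [this, abs_of_nonneg (by positivity)]
      have : (1 - s ^ 2) ^ 2 ≤ 1 := by nlinarith
      nlinarith
    have c2 : |s ^ 4 - s ^ 2| ≤ 1 := by
      rw [abs_le]; constructor <;> nlinarith
    have c3 : |2 * s ^ 4 - s ^ 2| ≤ 1 := by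
      rw [abs_le]; constructor <;> nlinarith
    have hNN := inner_mcDeriv_self_nonneg (G x) (radialGrad G W x)
    have hgg := radial_sq_mul_inner_le (G := G) x (∇ η x)
    have hgg0 := mul_nonneg (sq_nonneg (radial G x)) (inner_mcDeriv_self_nonneg (G x) (∇ η x))
    have hNg := two_mul_abs_inner_mcDeriv_le (G x) (η x • radialGrad G W x) (radial G x • ∇ η x)
    simp only [map_smul, real_inner_smul_left, real_inner_smul_right] at hNg
    have hff : ∀ v, |fluxFactor (G x) * ⟪G x, v⟫_ℝ| ≤ 2 * ‖v‖ := by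
      intro v
      rw [← real_inner_smul_left]
      refine (abs_real_inner_le_norm _ _).trans ?_
      gcongr
      exact norm_flux_factor_smul_le _
    have hw : |radial G x| ≤ ‖x‖ * ‖G x‖ := abs_real_inner_le_norm x (G x)
    have t1 : |η x ^ 2 * (s ^ 6 - 2 * s ^ 4 + s ^ 2) *
        ⟪mcDeriv (G x) (radialGrad G W x), radialGrad G W x⟫_ℝ| ≤
        η x ^ 2 * ⟪mcDeriv (G x) (radialGrad G W x), radialGrad G W x⟫_ℝ := by
      rw [abs_mul, abs_mul, abs_of_nonneg (sq_nonneg (η x)), abs_of_nonneg hNN]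
      calc _ ≤ η x ^ 2 * 1 * ⟪mcDeriv (G x) (radialGrad G W x), radialGrad G W x⟫_ℝ := by gcongr
        _ = _ := by ring
    have t2 : |2 * (s ^ 4 - s ^ 2) *
        (η x * radial G x * ⟪mcDeriv (G x) (radialGrad G W x), ∇ η x⟫_ℝ)| ≤
        η x ^ 2 * ⟪mcDeriv (G x) (radialGrad G W x), radialGrad G W x⟫_ℝ +
          radial G x ^ 2 * ⟪mcDeriv (G x) (∇ η x), ∇ η x⟫_ℝ := by
      rw [abs_mul, abs_mul, abs_two]
      have e : η x * radial G x * ⟪mcDeriv (G x) (radialGrad G W x), ∇ η x⟫_ℝ =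
        radial G x * (η x * ⟪mcDeriv (G x) (radialGrad G W x), ∇ η x⟫_ℝ) := by ring
      rw [e]
      calc _ ≤ 2 * 1 * |radial G x * (η x * ⟪mcDeriv (G x) (radialGrad G W x), ∇ η x⟫_ℝ)| := by
            gcongr
        _ = 2 * |radial G x * (η x * ⟪mcDeriv (G x) (radialGrad G W x), ∇ η x⟫_ℝ)| := by ring
        _ ≤ _ := hNg
        _ = _ := by ring
    have t3 : |s ^ 2 * (radial G x ^ 2 * ⟪mcDeriv (G x) (∇ η x), ∇ η x⟫_ℝ)| ≤
        radial G x ^ 2 * ⟪mcDeriv (G x) (∇ η x), ∇ η x⟫_ℝ := by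
      rw [abs_mul, abs_of_nonneg b20.le, abs_of_nonneg hgg0]
      exact mul_le_of_le_one_left hgg0 b2
    have t4 : |(2 * s ^ 4 - s ^ 2) *
        (η x ^ 2 * (fluxFactor (G x) * ⟪G x, radialGrad G W x⟫_ℝ))| ≤
        η x ^ 2 * (2 * ‖radialGrad G W x‖) := by
      rw [abs_mul, abs_mul (η x ^ 2), abs_of_nonneg (sq_nonneg (η x))]
      calc _ ≤ 1 * (η x ^ 2 * (2 * ‖radialGrad G W x‖)) := by
            gcongr
            exact hff _
        _ = _ := one_mul _
    have t5 : |s ^ 2 * (2 * η x * radial G x * (fluxFactor (G x) * ⟪G x, ∇ η x⟫_ℝ))| ≤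
        4 * |η x| * ‖x‖ * ‖∇ η x‖ * ‖G x‖ := by
      rw [abs_mul, abs_of_nonneg b20.le, abs_mul, abs_mul, abs_mul 2, abs_two]
      calc _ ≤ 1 * (2 * |η x| * (‖x‖ * ‖G x‖) * (2 * ‖∇ η x‖)) := by
            gcongr
            exact hff _
        _ = _ := by ring
    rw [Real.norm_eq_abs, hJ]
    refine (abs_add_le _ _).trans ?_
    refine (add_le_add ((abs_add_le _ _).trans (add_le_add ((abs_add_le _ _).trans
      (add_le_add ((abs_add_le _ _).trans (add_le_add t1 t2)) t3)) t4)) t5).trans ?_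
    simp only [hB]
    linarith
  have hpt : ∀ x, Tendsto (fun k => J (mcFactor (δ k • radial G x)) x) atTop (𝓝 (J 1 x)) := by
    intro x
    have hc : Continuous fun s => J s x := by
      simp only [hJ]
      fun_prop
    exact (hc.tendsto 1).comp (tendsto_mcFactor_smul hδ0 (radial G x))
  have iJ : Integrable (J 1) volume :=
    iB.mono' (aestronglyMeasurable_of_tendsto_ae atTop (fun k => (hk k).1.aestronglyMeasurable)
      (Eventually.of_forall hpt))
      (Eventually.of_forall fun x => le_of_tendsto' (hpt x).norm fun k => hbd k x)
  have hlim : Tendsto (fun k => ∫ x, J (mcFactor (δ k • radial G x)) x) atTop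
      (𝓝 (∫ x, J 1 x)) :=
    tendsto_integral_of_dominated_convergence B (fun k => (hk k).1.aestronglyMeasurable) iB
      (fun k => Eventually.of_forall (hbd k)) (Eventually.of_forall hpt)
  have e1 : ∀ x, J 1 x = radial G x ^ 2 * ⟪mcDeriv (G x) (∇ η x), ∇ η x⟫_ℝ +
      η x ^ 2 * (fluxFactor (G x) * ⟪G x, radialGrad G W x⟫_ℝ) +
      2 * η x * radial G x * (fluxFactor (G x) * ⟪G x, ∇ η x⟫_ℝ) := by
    intro x
    simp only [hJ]
    ring
  have hpos := ge_of_tendsto' hlim fun k => (hk k).2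
  simp only [e1] at hpos
  exact ⟨iJ.congr (Eventually.of_forall e1), hpos⟩

/-- The Pohozaev density `|p|² / √(1 + |p|²)`. -/
noncomputable def pohozaev (p : EuclideanSpace ℝ (Fin n)) : ℝ := mcFactor p * ‖p‖ ^ 2

/-- With s = `mcFactor p`, the coefficient is 2s − s³|p|², which equals s + s³ because s²(1 + |p|²)
= 1. The same factor occurs in `dilationFlux_eq`, so the remaining second-order term is an exact
derivative. -/
lemma fderiv_pohozaev (p e : EuclideanSpace ℝ (Fin n)) :
    fderiv ℝ pohozaev p e = fluxFactor p * ⟪p, e⟫_ℝ := by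
  have h1 : HasFDerivAt (pohozaev (n := n)) _ p :=
    (hasFDerivAt_mcFactor p).mul (hasStrictFDerivAt_norm_sq p).hasFDerivAt
  rw [h1.fderiv]
  simp only [add_apply, smul_apply, innerSL_apply_apply, smul_eq_mul, nsmul_eq_mul, fluxFactor]
  push_cast
  linear_combination (- mcFactor p * ⟪p, e⟫_ℝ) * mcFactor_sq p

lemma weak_pohozaev (h : StableData f u G W W₂) (i : Fin n) :
    HasWeakDerivAlong (stdVec i) (fun x => pohozaev (G x))
      (fun x => fluxFactor (G x) * ⟪G x, W i x⟫_ℝ) := by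
  have hc : ContDiff ℝ 1 (pohozaev (n := n)) :=
    (contDiff_mcFactor.mul (contDiff_norm_sq ℝ)).of_le (by simp)
  have := (h.weak_G i).comp_of_bounded_fderiv hc (C := 2) (fun y => by
    refine opNorm_le_bound _ (by norm_num) fun e => ?_
    rw [fderiv_pohozaev, ← real_inner_smul_left]
    refine (norm_inner_le_norm _ _).trans ?_
    gcongr
    exact norm_flux_factor_smul_le _)
  simpa only [fderiv_pohozaev] using this

/-- Integration by parts against the field η² x, whose divergence is nη² + 2η x·∇η. -/
lemma integral_pohozaev (h : StableData f u G W W₂)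
    {η : EuclideanSpace ℝ (Fin n) → ℝ} (hη : ContDiff ℝ ∞ η) (hs : HasCompactSupport η) :
    Integrable (fun x => η x ^ 2 * (fluxFactor (G x) * ⟪G x, dilationDeriv W x⟫_ℝ)) volume ∧
    Integrable (fun x => pohozaev (G x) * (n * η x ^ 2 + 2 * η x * ⟪x, ∇ η x⟫_ℝ)) volume ∧
    ∫ x, η x ^ 2 * (fluxFactor (G x) * ⟪G x, dilationDeriv W x⟫_ℝ) =
      -∫ x, pohozaev (G x) * (n * η x ^ 2 + 2 * η x * ⟪x, ∇ η x⟫_ℝ) := by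
  have hφ : ∀ i : Fin n, ContDiff ℝ ∞ fun x : EuclideanSpace ℝ (Fin n) => x i * η x ^ 2 :=
    fun i => (contDiff_coord i).mul (hη.pow 2)
  have hφs : ∀ i : Fin n, HasCompactSupport
      fun x : EuclideanSpace ℝ (Fin n) => x i * η x ^ 2 := by
    intro i
    simp only [sq]
    exact (hs.mul_left).mul_left
  have hfd : ∀ (i : Fin n) x, fderiv ℝ (fun x : EuclideanSpace ℝ (Fin n) => x i * η x ^ 2) x
      (stdVec i) = η x ^ 2 + x i * (2 * η x * fderiv ℝ η x (stdVec i)) := by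
    intro i x
    rw [fderiv_fun_mul ((contDiff_coord i).differentiable (by simp) x)
      ((hη.pow 2).differentiable (by simp) x), fderiv_fun_pow 2 (hη.differentiable (by simp) x)]
    simp only [add_apply, smul_apply, fderiv_coord, smul_eq_mul]
    simp
    ring
  have i1 := fun i => (h.weak_pohozaev i).1.integrable_test_mul
    (continuous_fderiv_apply_of_contDiff (hφ i) (stdVec i))
    (hasCompactSupport_fderiv_apply_of (hφs i) _)
  have i2 := fun i => (h.weak_pohozaev i).2.1.integrable_test_mul (hφ i).continuous (hφs i)
  have e0 := fun i => (h.weak_pohozaev i).2.2 _ (hφ i) (hφs i)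
  simp only [hfd, smul_eq_mul] at i1 e0
  have e1 : ∀ x, ∑ i, (η x ^ 2 + x i * (2 * η x * fderiv ℝ η x (stdVec i))) * pohozaev (G x) =
      pohozaev (G x) * (n * η x ^ 2 + 2 * η x * ⟪x, ∇ η x⟫_ℝ) := by
    intro x
    rw [euclidean_inner_eq_sum, ← Finset.sum_mul, Finset.sum_add_distrib, Finset.mul_sum]
    simp only [gradient_coord, Finset.sum_const, Finset.card_univ, Fintype.card_fin, nsmul_eq_mul]
    rw [mul_comm]
    congr 2
    exact Finset.sum_congr rfl fun i _ => by ring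
  have e2 : ∀ x, ∑ i, x i * η x ^ 2 * (fluxFactor (G x) * ⟪G x, W i x⟫_ℝ) =
      η x ^ 2 * (fluxFactor (G x) * ⟪G x, dilationDeriv W x⟫_ℝ) := by
    intro x
    rw [dilationDeriv, inner_sum, Finset.mul_sum, Finset.mul_sum]
    refine Finset.sum_congr rfl fun i _ => ?_
    rw [real_inner_smul_right]
    ring
  have j1 := integrable_finsetSum Finset.univ fun i _ => i1 i
  have j2 := integrable_finsetSum Finset.univ fun i _ => i2 i
  have e3 := Finset.sum_congr (rfl : (Finset.univ : Finset (Fin n)) = Finset.univ) fun i _ => e0 i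
  rw [← integral_finsetSum _ fun i _ => i1 i, Finset.sum_neg_distrib,
    ← integral_finsetSum _ fun i _ => i2 i] at e3
  simp only [e1, e2] at j1 j2 e3
  exact ⟨j2, j1, by rw [e3, neg_neg]⟩

/-- The integrand of the fundamental inequality for stable solutions. -/
noncomputable def stabilityDensity (G : EuclideanSpace ℝ (Fin n) → EuclideanSpace ℝ (Fin n))
    (η : EuclideanSpace ℝ (Fin n) → ℝ) (x : EuclideanSpace ℝ (Fin n)) : ℝ :=
  radial G x ^ 2 * ⟪mcDeriv (G x) (∇ η x), ∇ η x⟫_ℝ + η x ^ 2 * (fluxFactor (G x) * ‖G x‖ ^ 2) +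
    2 * η x * radial G x * (fluxFactor (G x) * ⟪G x, ∇ η x⟫_ℝ) -
    pohozaev (G x) * (n * η x ^ 2 + 2 * η x * ⟪x, ∇ η x⟫_ℝ)

/-- The fundamental inequality for stable solutions. -/
lemma integral_stabilityDensity_nonneg [NeZero n] (h : StableData f u G W W₂)
    {η : EuclideanSpace ℝ (Fin n) → ℝ} (hη : ContDiff ℝ ∞ η) (hs : HasCompactSupport η) :
    Integrable (stabilityDensity G η) volume ∧ 0 ≤ ∫ x, stabilityDensity G η x := by
  obtain ⟨i0, h0⟩ := h.radial_stability hη hs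
  obtain ⟨i1, i2, e⟩ := h.integral_pohozaev hη hs
  have key : ∀ x, stabilityDensity G η x = (radial G x ^ 2 * ⟪mcDeriv (G x) (∇ η x), ∇ η x⟫_ℝ +
      η x ^ 2 * (fluxFactor (G x) * ⟪G x, radialGrad G W x⟫_ℝ) +
      2 * η x * radial G x * (fluxFactor (G x) * ⟪G x, ∇ η x⟫_ℝ) -
      η x ^ 2 * (fluxFactor (G x) * ⟪G x, dilationDeriv W x⟫_ℝ)) -
      pohozaev (G x) * (n * η x ^ 2 + 2 * η x * ⟪x, ∇ η x⟫_ℝ) := by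
    intro x
    rw [stabilityDensity, radialGrad, inner_add_right, real_inner_self_eq_norm_sq]
    ring
  refine ⟨((i0.sub i1).sub i2).congr (Eventually.of_forall fun x => (key x).symm), ?_⟩
  have e' := integral_sub' (i0.sub i1) i2
  rw [integral_sub' i0 i1, e] at e'
  rw [integral_congr_ae (Eventually.of_forall key), ← Pi.sub_def]
  refine le_of_le_of_eq ?_ e'.symm
  linarith

end StableData

/-! ### The algebraic inequality behind the exponent. -/

/-- The decay rate of the test function that is optimal in dimension `n`. -/
noncomputable def testDecay (n : ℕ) : ℝ := if n ≤ 10 then ((n : ℝ) - 2) / 2 else 1 + √((n : ℝ) - 1)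

lemma testDecay_nonneg {n : ℕ} (hn : 2 ≤ n) : 0 ≤ testDecay n := by
  have : (2 : ℝ) ≤ n := by exact_mod_cast hn
  unfold testDecay
  split_ifs
  · linarith
  · positivity

lemma two_mul_liouvilleExponent (n : ℕ) : 2 * liouvilleExponent n = 2 * testDecay n - n := by
  unfold liouvilleExponent testDecay
  split_ifs <;> ring

lemma liouvilleExponent_nonpos (n : ℕ) : liouvilleExponent n ≤ 0 := by
  unfold liouvilleExponent
  split_ifs with h
  · norm_num
  · have hn : (11 : ℝ) ≤ n := by exact_mod_cast not_le.1 h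
    have : √((n : ℝ) - 1) ≤ (n : ℝ) / 2 - 1 := by
      rw [Real.sqrt_le_left (by linarith)]
      nlinarith
    linarith

/-- The algebraic inequality that decides the optimal exponent. -/
lemma testDecay_bracket_nonneg {n : ℕ} (hn : 2 ≤ n) {θ t : ℝ} (hθ0 : 0 ≤ θ) (hθ1 : θ ≤ 1)
    (ht0 : 0 ≤ t) (ht1 : t ≤ 1) :
    0 ≤ (n - 1 - t) - 2 * testDecay n + 2 * testDecay n * (1 + t) * θ -
      testDecay n ^ 2 * θ * (1 - θ * (1 - t)) := by
  have h2 : (2 : ℝ) ≤ n := by exact_mod_cast hn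
  set b := testDecay n with hb
  -- The expression is affine in t, so the endpoints t = 0 and t = 1 suffice. At t = 1 it is affine
  -- in θ: nonnegativity at θ = 0 means b ≤ (n − 2)/2, and at θ = 1 it means (b − 1)² ≤ n − 1. The
  -- two upper bounds coincide, with b = 4, at n = 10.
  have hlin : (n - 1 - t) - 2 * b + 2 * b * (1 + t) * θ - b ^ 2 * θ * (1 - θ * (1 - t)) =
      t * ((n - 2 - 2 * b) + θ * (4 * b - b ^ 2)) +
      (1 - t) * ((n - 1 - 2 * b) + (2 * b - b ^ 2) * θ + b ^ 2 * θ ^ 2) := by ring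
  rw [hlin]
  have h1t : 0 ≤ 1 - t := by linarith
  by_cases h : n ≤ 10
  · have h10 : (n : ℝ) ≤ 10 := by exact_mod_cast h
    have hb2 : (n : ℝ) = 2 * b + 2 := by rw [hb, testDecay, if_pos h]; ring
    have hb0 : 0 ≤ b := by linarith
    have hb4 : 0 ≤ 4 - b := by linarith
    have e1 : (n - 2 - 2 * b) + θ * (4 * b - b ^ 2) = θ * (b * (4 - b)) := by rw [hb2]; ring
    have e2 : (n - 1 - 2 * b) + (2 * b - b ^ 2) * θ + b ^ 2 * θ ^ 2 =
      (b * θ + (2 - b) / 2) ^ 2 + b * (4 - b) / 4 := by rw [hb2]; ring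
    rw [e1, e2]
    positivity
  · have h11 : (11 : ℝ) ≤ n := by exact_mod_cast not_le.1 h
    have hb1 : b = 1 + √((n : ℝ) - 1) := by rw [hb, testDecay, if_neg h]
    have hb2 : (n : ℝ) = (b - 1) ^ 2 + 1 := by
      rw [hb1, add_sub_cancel_left, Real.sq_sqrt (by linarith)]
      ring
    have hb4 : 0 ≤ b - 4 := by
      have : (3 : ℝ) ≤ √((n : ℝ) - 1) := Real.le_sqrt_of_sq_le (by linarith)
      linarith
    have hb0 : 0 ≤ b := by linarith
    have hθ : 0 ≤ 1 - θ := by linarith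
    have e1 : (n - 2 - 2 * b) + θ * (4 * b - b ^ 2) = (1 - θ) * (b * (b - 4)) := by
      rw [hb2]; ring
    have e2 : (n - 1 - 2 * b) + (2 * b - b ^ 2) * θ + b ^ 2 * θ ^ 2 =
      (b * θ + (2 - b) / 2) ^ 2 + 3 / 4 * (b * (b - 4)) := by rw [hb2]; ring
    rw [e1, e2]
    positivity

/-- Here r, p, w, t stand for |x|², |∇u|², x·∇u and 1/(1 + |∇u|²). The test function is smooth at
the origin because its profile uses 1 + r instead of r. The left side is the surplus that this
leaves. -/
lemma testDecay_form_le {n : ℕ} (hn : 2 ≤ n) {r p w t : ℝ} (hr : 0 ≤ r) (hp : 0 ≤ p)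
    (hw : w ^ 2 ≤ r * p) (ht0 : 0 ≤ t) (ht : t * (1 + p) = 1) :
    (n - 1 - t) * p / (1 + r) ≤
      (n - 1 - t) * p - 2 * (testDecay n / (1 + r)) * r * p +
      2 * (testDecay n / (1 + r)) * (1 + t) * w ^ 2 -
      (testDecay n / (1 + r)) ^ 2 * w ^ 2 * (r - t * w ^ 2) := by
  have ht1 : t ≤ 1 := by nlinarith
  set b := testDecay n with hb
  have h1r : 0 < 1 + r := by linarith
  rcases hr.eq_or_lt with rfl | hr0
  · have : w ^ 2 = 0 := le_antisymm (by simpa using hw) (sq_nonneg w)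
    rw [this]
    apply le_of_eq
    simp
  rcases hp.eq_or_lt with rfl | hp0
  · have : w ^ 2 = 0 := le_antisymm (by simpa using hw) (sq_nonneg w)
    rw [this]
    apply le_of_eq
    simp
  -- θ is the squared cosine of the angle between x and ∇u.
  obtain ⟨θ, hθ⟩ : ∃ θ, θ * (r * p) = w ^ 2 := ⟨w ^ 2 / (r * p), by field_simp⟩
  have hrp : 0 < r * p := mul_pos hr0 hp0
  have hθ0 : 0 ≤ θ := by
    by_contra! hc
    nlinarith [sq_nonneg w]
  have hθ1 : θ ≤ 1 := by
    by_contra! hc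
    nlinarith
  have key := testDecay_bracket_nonneg hn hθ0 hθ1 ht0 ht1
  rw [← hb] at key
  -- In this parameter the form is concave. At s = 0 it is (n − 1 − t)p and at s = 1 it is p times
  -- the bracket, so it lies above the chord; `hss` is the concavity excess.
  obtain ⟨s, hs⟩ : ∃ s, s = r / (1 + r) := ⟨_, rfl⟩
  have hs0 : 0 ≤ s := hs ▸ by positivity
  have hs1 : s ≤ 1 := by rw [hs, div_le_one h1r]; linarith
  have ea : b / (1 + r) * r = b * s := by rw [hs]; ring
  have e1 : (n - 1 - t) * p / (1 + r) = (1 - s) * ((n - 1 - t) * p) := by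
    rw [hs]; field_simp; ring
  have hq : 0 ≤ θ * (1 - θ * (1 - t)) := by
    apply mul_nonneg hθ0
    nlinarith
  have e2 : (n - 1 - t) * p - 2 * (b / (1 + r)) * r * p +
      2 * (b / (1 + r)) * (1 + t) * w ^ 2 - (b / (1 + r)) ^ 2 * w ^ 2 * (r - t * w ^ 2) =
      p * ((n - 1 - t) - 2 * (b * s) + 2 * (b * s) * (1 + t) * θ -
        (b * s) ^ 2 * (θ * (1 - θ * (1 - t)))) := by
    rw [← ea, ← hθ]
    linear_combination (b / (1 + r) * r) ^ 2 * θ ^ 2 * p * ht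
  rw [e1, e2]
  have hss : 0 ≤ b ^ 2 * (s - s ^ 2) * (θ * (1 - θ * (1 - t))) := by
    have : 0 ≤ s - s ^ 2 := by nlinarith
    positivity
  have := mul_nonneg hp0.le (add_nonneg (mul_nonneg hs0 key) hss)
  linarith

/-! ### Pointwise bounds for the density with radial test functions. -/

namespace StableData

variable {n : ℕ} {G : EuclideanSpace ℝ (Fin n) → EuclideanSpace ℝ (Fin n)}

lemma stabilityDensity_of_gradient_eq {η : EuclideanSpace ℝ (Fin n) → ℝ} {κ : ℝ}
    {x : EuclideanSpace ℝ (Fin n)} (hκ : ∇ η x = κ • x) :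
    stabilityDensity G η x = mcFactor (G x) * (radial G x ^ 2 * κ ^ 2 *
        (‖x‖ ^ 2 - mcFactor (G x) ^ 2 * radial G x ^ 2) +
      η x ^ 2 * (1 + mcFactor (G x) ^ 2) * ‖G x‖ ^ 2 +
      2 * η x * κ * radial G x ^ 2 * (1 + mcFactor (G x) ^ 2) -
      ‖G x‖ ^ 2 * (n * η x ^ 2 + 2 * η x * κ * ‖x‖ ^ 2)) := by
  have hx : ⟪G x, x⟫_ℝ = radial G x := real_inner_comm _ _
  rw [stabilityDensity, inner_mcDeriv_self, hκ, norm_smul, real_inner_smul_right,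
    real_inner_smul_right, hx, real_inner_self_eq_norm_sq, mul_pow, Real.norm_eq_abs, sq_abs,
    fluxFactor, pohozaev]
  ring

/-- The relation on κ is the differential equation of the profile (1 + |x|²)^(-b/2). With it the
density becomes −η² `mcFactor (G x)` times the form in `testDecay_form_le`. -/
lemma stabilityDensity_le_of_gradient_eq (hn : 2 ≤ n) {η : EuclideanSpace ℝ (Fin n) → ℝ} {κ : ℝ}
    {x : EuclideanSpace ℝ (Fin n)} (hκ : ∇ η x = κ • x)
    (h : κ * (1 + ‖x‖ ^ 2) = -testDecay n * η x) :
    stabilityDensity G η x ≤ -(η x ^ 2 * (mcFactor (G x) *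
      ((n - 1 - mcFactor (G x) ^ 2) * ‖G x‖ ^ 2 / (1 + ‖x‖ ^ 2)))) := by
  have h1 : (0 : ℝ) < 1 + ‖x‖ ^ 2 := by positivity
  have hk : κ = -(testDecay n / (1 + ‖x‖ ^ 2)) * η x := by
    field_simp
    linarith
  have key := testDecay_form_le hn (sq_nonneg ‖x‖) (sq_nonneg ‖G x‖) (radial_sq_le G x)
    (sq_nonneg (mcFactor (G x))) (mcFactor_sq (G x))
  have := mul_le_mul_of_nonneg_left key
    (mul_nonneg (sq_nonneg (η x)) (mcFactor_pos (G x)).le)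
  rw [stabilityDensity_of_gradient_eq hκ, hk]
  linarith

/-- Used in the transition annulus. The constant is 1 + 2 + 4 + 2, from the four terms; the part
with n has a favourable sign and is dropped. -/
lemma stabilityDensity_le_of_abs_le {η : EuclideanSpace ℝ (Fin n) → ℝ} {κ N : ℝ}
    {x : EuclideanSpace ℝ (Fin n)} (hκ : ∇ η x = κ • x) (hη : |η x| ≤ N)
    (hN : |κ| * ‖x‖ ^ 2 ≤ N) : stabilityDensity G η x ≤ 9 * N ^ 2 * ‖G x‖ ^ 2 := by
  have hN0 : 0 ≤ N := (abs_nonneg _).trans hη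
  have hs0 := mcFactor_pos (G x)
  have hs1 := mcFactor_le_one (G x)
  have ht1 : mcFactor (G x) ^ 2 ≤ 1 := pow_le_one₀ hs0.le hs1
  have hw := radial_sq_le G x
  have a1 : radial G x ^ 2 * κ ^ 2 * (‖x‖ ^ 2 - mcFactor (G x) ^ 2 * radial G x ^ 2) ≤
      N ^ 2 * ‖G x‖ ^ 2 := by
    calc _ ≤ radial G x ^ 2 * κ ^ 2 * ‖x‖ ^ 2 := by
          gcongr
          exact sub_le_self _ (by positivity)
      _ ≤ (‖x‖ ^ 2 * ‖G x‖ ^ 2) * κ ^ 2 * ‖x‖ ^ 2 := by gcongr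
      _ = (|κ| * ‖x‖ ^ 2) ^ 2 * ‖G x‖ ^ 2 := by rw [mul_pow, sq_abs]; ring
      _ ≤ _ := by gcongr
  have a2 : η x ^ 2 * (1 + mcFactor (G x) ^ 2) * ‖G x‖ ^ 2 ≤ 2 * (N ^ 2 * ‖G x‖ ^ 2) := by
    calc _ ≤ N ^ 2 * (1 + 1) * ‖G x‖ ^ 2 := by
          gcongr ?_ * (1 + ?_) * _
          rw [← sq_abs]
          gcongr
      _ = _ := by ring
  have b1 : |2 * η x * κ * ‖x‖ ^ 2| ≤ 2 * N ^ 2 := by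
    calc _ = 2 * |η x| * (|κ| * ‖x‖ ^ 2) := by
          rw [abs_mul, abs_mul, abs_mul, abs_two, abs_of_nonneg (sq_nonneg ‖x‖)]; ring
      _ ≤ 2 * N * N := by gcongr
      _ = _ := by ring
  have a3 : 2 * η x * κ * radial G x ^ 2 * (1 + mcFactor (G x) ^ 2) ≤
      4 * (N ^ 2 * ‖G x‖ ^ 2) := by
    calc _ ≤ |2 * η x * κ * radial G x ^ 2 * (1 + mcFactor (G x) ^ 2)| := le_abs_self _
      _ = |2 * η x * κ| * radial G x ^ 2 * (1 + mcFactor (G x) ^ 2) := by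
          rw [abs_mul, abs_mul _ (radial G x ^ 2), abs_of_nonneg (sq_nonneg (radial G x)),
            abs_of_nonneg (by positivity : 0 ≤ 1 + mcFactor (G x) ^ 2)]
      _ ≤ |2 * η x * κ| * (‖x‖ ^ 2 * ‖G x‖ ^ 2) * (1 + 1) := by gcongr
      _ = 2 * |2 * η x * κ * ‖x‖ ^ 2| * ‖G x‖ ^ 2 := by
          rw [abs_mul _ (‖x‖ ^ 2), abs_of_nonneg (sq_nonneg ‖x‖)]; ring
      _ ≤ 2 * (2 * N ^ 2) * ‖G x‖ ^ 2 := by gcongr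
      _ = _ := by ring
  have a4 : -(‖G x‖ ^ 2 * (n * η x ^ 2 + 2 * η x * κ * ‖x‖ ^ 2)) ≤ 2 * (N ^ 2 * ‖G x‖ ^ 2) := by
    have h0 : 0 ≤ n * η x ^ 2 := by positivity
    have : -(n * η x ^ 2 + 2 * η x * κ * ‖x‖ ^ 2) ≤ 2 * N ^ 2 := by
      linarith [neg_abs_le (2 * η x * κ * ‖x‖ ^ 2)]
    nlinarith [mul_le_mul_of_nonneg_left this (sq_nonneg ‖G x‖)]
  rw [stabilityDensity_of_gradient_eq hκ]
  calc _ ≤ mcFactor (G x) * (9 * N ^ 2 * ‖G x‖ ^ 2) := by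
        gcongr
        linarith
    _ ≤ _ := mul_le_of_le_one_left (by positivity) hs1

end StableData

/-! ### Radial cutoffs. -/

lemma deriv_smoothTransition_of_neg {y : ℝ} (hy : y < 0) : deriv Real.smoothTransition y = 0 := by
  have : Real.smoothTransition =ᶠ[𝓝 y] fun _ => 0 := by
    filter_upwards [Iio_mem_nhds hy] with z hz
    exact Real.smoothTransition.zero_of_nonpos (le_of_lt hz)
  rw [this.deriv_eq, deriv_const]

lemma deriv_smoothTransition_of_one_lt {y : ℝ} (hy : 1 < y) :
    deriv Real.smoothTransition y = 0 := by
  have : Real.smoothTransition =ᶠ[𝓝 y] fun _ => 1 := by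
    filter_upwards [Ioi_mem_nhds hy] with z hz
    exact Real.smoothTransition.one_of_one_le (le_of_lt hz)
  rw [this.deriv_eq, deriv_const]

lemma exists_abs_deriv_smoothTransition_le :
    ∃ C, 0 ≤ C ∧ ∀ y, |deriv Real.smoothTransition y| ≤ C := by
  have hc : Continuous (deriv Real.smoothTransition) :=
    (Real.smoothTransition.contDiff (n := 1)).continuous_deriv le_rfl
  obtain ⟨C, hC⟩ := (isCompact_Icc (a := (0 : ℝ)) (b := 1)).exists_bound_of_continuousOn
    hc.continuousOn
  refine ⟨max C 0, le_max_right _ _, fun y => ?_⟩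
  rcases lt_or_ge y 0 with h0 | h0
  · simp [deriv_smoothTransition_of_neg h0]
  rcases lt_or_ge 1 y with h1 | h1
  · simp [deriv_smoothTransition_of_one_lt h1]
  · exact (hC y ⟨h0, h1⟩).trans (le_max_left _ _)

lemma gradient_comp_norm_sq {n : ℕ} {g : ℝ → ℝ} {g' : ℝ} {x : EuclideanSpace ℝ (Fin n)}
    (hg : HasDerivAt g g' (‖x‖ ^ 2)) : ∇ (fun y => g (‖y‖ ^ 2)) x = (2 * g') • x := by
  have h : HasFDerivAt (fun y : EuclideanSpace ℝ (Fin n) => g (‖y‖ ^ 2)) _ x :=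
    hg.comp_hasFDerivAt x (hasStrictFDerivAt_norm_sq x).hasFDerivAt
  refine ext_inner_left ℝ fun v => ?_
  rw [real_inner_gradient, h.fderiv, real_inner_smul_right]
  simp only [smul_apply, innerSL_apply_apply, smul_eq_mul, nsmul_eq_mul]
  rw [real_inner_comm]
  push_cast
  ring

/-- Radial test functions equal to `(1 + |x|²)^(-b/2)` in `B_R` and vanishing outside `B_{2R}`. -/
lemma exists_radial_cutoff (n : ℕ) {b : ℝ} (hb : 0 ≤ b) :
    ∃ M : ℝ, 0 < M ∧ ∀ R : ℝ, 0 < R → ∃ η κ : EuclideanSpace ℝ (Fin n) → ℝ,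
      ContDiff ℝ ∞ η ∧ HasCompactSupport η ∧ (∀ x, ∇ η x = κ x • x) ∧
      (∀ x, ‖x‖ < R → η x = (1 + ‖x‖ ^ 2) ^ (-b / 2) ∧ κ x * (1 + ‖x‖ ^ 2) = -b * η x) ∧
      (∀ x, R ≤ ‖x‖ → ‖x‖ < 2 * R → |η x| ≤ M * R ^ (-b) ∧ |κ x| * ‖x‖ ^ 2 ≤ M * R ^ (-b)) ∧
      (∀ x, 2 * R ≤ ‖x‖ → η x = 0 ∧ κ x = 0) := by
  obtain ⟨C, hC0, hC⟩ := exists_abs_deriv_smoothTransition_le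
  -- In the annulus the power contributes b, and the cutoff contributes 2 · C · |x|²/R² ≤ 8C.
  refine ⟨1 + b + 8 * C, by positivity, fun R hR => ?_⟩
  set S := Real.smoothTransition with hS
  have dS : ∀ y, HasDerivAt S (deriv S y) y := fun y =>
    ((Real.smoothTransition.contDiff (n := 1)).differentiable (by simp) y).hasDerivAt
  -- In the variable τ = |x|² the cutoff is 1 for τ ≤ 2R² and 0 for τ ≥ 3R². This leaves strict room
  -- inside B_R and outside B_{2R}, where its derivative must vanish.
  set g : ℝ → ℝ := fun τ => (1 + τ) ^ (-b / 2) * S (3 - τ / R ^ 2) with hg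
  set g' : ℝ → ℝ := fun τ => (-b / 2) * (1 + τ) ^ (-b / 2 - 1) * S (3 - τ / R ^ 2) -
    (1 + τ) ^ (-b / 2) * (deriv S (3 - τ / R ^ 2) / R ^ 2) with hg'
  have hR2 : 0 < R ^ 2 := by positivity
  have hgd : ∀ τ, 0 ≤ τ → HasDerivAt g (g' τ) τ := by
    intro τ hτ
    have h1 : HasDerivAt (fun τ : ℝ => (1 + τ) ^ (-b / 2))
        (1 * (-b / 2) * (1 + τ) ^ (-b / 2 - 1)) τ :=
      ((hasDerivAt_id τ).const_add 1).rpow_const (Or.inl (by simp; positivity))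
    have h2 : HasDerivAt (fun τ : ℝ => S (3 - τ / R ^ 2))
        (deriv S (3 - τ / R ^ 2) * (-(1 / R ^ 2))) τ :=
      (dS _).comp τ (((hasDerivAt_id τ).div_const _).const_sub 3)
    refine (h1.mul h2).congr_deriv ?_
    simp only [hg']
    ring
  have hpos : ∀ x : EuclideanSpace ℝ (Fin n), 0 < 1 + ‖x‖ ^ 2 := fun x => by positivity
  have hzero : ∀ x : EuclideanSpace ℝ (Fin n), 2 * R ≤ ‖x‖ → 3 - ‖x‖ ^ 2 / R ^ 2 < 0 := by
    intro x hx
    rw [sub_neg, lt_div_iff₀ hR2]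
    nlinarith
  refine ⟨fun x => g (‖x‖ ^ 2), fun x => 2 * g' (‖x‖ ^ 2), ?_, ?_, ?_, ?_, ?_, ?_⟩
  · have h1 : ContDiff ℝ ∞ fun x : EuclideanSpace ℝ (Fin n) => ‖x‖ ^ 2 := contDiff_norm_sq ℝ
    exact ((contDiff_const.add h1).rpow_const_of_ne fun x => (hpos x).ne').mul
      (Real.smoothTransition.contDiff.comp (contDiff_const.sub (h1.div_const _)))
  · refine HasCompactSupport.intro (isCompact_closedBall (0 : EuclideanSpace ℝ (Fin n)) (2 * R))
      fun x hx => ?_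
    have hx' : 2 * R ≤ ‖x‖ := by simpa using (not_le.1 (by simpa using hx)).le
    simp only [hg, hS, Real.smoothTransition.zero_of_nonpos (hzero x hx').le, mul_zero]
  · exact fun x => gradient_comp_norm_sq (hgd _ (sq_nonneg _))
  · intro x hx
    have h1 : 1 < 3 - ‖x‖ ^ 2 / R ^ 2 := by
      have : ‖x‖ ^ 2 / R ^ 2 ≤ 1 := by
        rw [div_le_one hR2]
        gcongr
      linarith
    simp only [hg, hg', hS, Real.smoothTransition.one_of_one_le h1.le,
      deriv_smoothTransition_of_one_lt h1, Real.rpow_sub_one (hpos x).ne']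
    refine ⟨by ring, ?_⟩
    have := (hpos x).ne'
    field_simp
    ring
  · intro x hx hx2
    have hx0 : 0 < ‖x‖ := hR.trans_le hx
    have hp : (1 + ‖x‖ ^ 2) ^ (-b / 2) ≤ R ^ (-b) := by
      calc _ ≤ (R ^ 2) ^ (-b / 2) :=
            Real.rpow_le_rpow_of_nonpos hR2 (by nlinarith) (by linarith)
        _ = R ^ (-b) := by
            rw [← Real.rpow_natCast, ← Real.rpow_mul hR.le]
            congr 1
            push_cast
            ring
    have hp0 : 0 ≤ (1 + ‖x‖ ^ 2) ^ (-b / 2) := (Real.rpow_pos_of_pos (hpos x) _).le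
    have hS0 : 0 ≤ S (3 - ‖x‖ ^ 2 / R ^ 2) := Real.smoothTransition.nonneg _
    have hS1 : S (3 - ‖x‖ ^ 2 / R ^ 2) ≤ 1 := Real.smoothTransition.le_one _
    have hRb : 0 < R ^ (-b) := Real.rpow_pos_of_pos hR _
    constructor
    · rw [abs_of_nonneg (mul_nonneg hp0 hS0)]
      calc _ ≤ R ^ (-b) * 1 := by
            gcongr
        _ ≤ (1 + b + 8 * C) * R ^ (-b) := by nlinarith [mul_nonneg hb hRb.le, mul_nonneg hC0 hRb.le]
    · have e : 2 * g' (‖x‖ ^ 2) * ‖x‖ ^ 2 =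
          -(b * ((1 + ‖x‖ ^ 2) ^ (-b / 2) * S (3 - ‖x‖ ^ 2 / R ^ 2) *
            (‖x‖ ^ 2 / (1 + ‖x‖ ^ 2)))) -
          2 * ((1 + ‖x‖ ^ 2) ^ (-b / 2) * deriv S (3 - ‖x‖ ^ 2 / R ^ 2) *
            (‖x‖ ^ 2 / R ^ 2)) := by
        simp only [hg', Real.rpow_sub_one (hpos x).ne']
        ring
      have q1 : ‖x‖ ^ 2 / (1 + ‖x‖ ^ 2) ≤ 1 := by
        rw [div_le_one (hpos x)]
        linarith
      have q2 : ‖x‖ ^ 2 / R ^ 2 ≤ 4 := by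
        rw [div_le_iff₀ hR2]
        nlinarith
      have hk : |2 * g' (‖x‖ ^ 2)| * ‖x‖ ^ 2 = |2 * g' (‖x‖ ^ 2) * ‖x‖ ^ 2| := by
        rw [abs_mul _ (‖x‖ ^ 2), abs_of_nonneg (sq_nonneg ‖x‖)]
      rw [hk, e]
      refine (abs_sub _ _).trans ?_
      rw [abs_neg, abs_mul, abs_of_nonneg hb, abs_mul, abs_mul ((1 + ‖x‖ ^ 2) ^ (-b / 2)),
        abs_of_nonneg hp0, abs_of_nonneg hS0, abs_mul 2, abs_two, abs_mul, abs_mul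
          ((1 + ‖x‖ ^ 2) ^ (-b / 2)), abs_of_nonneg hp0,
        abs_of_nonneg (by positivity : 0 ≤ ‖x‖ ^ 2 / (1 + ‖x‖ ^ 2)),
        abs_of_nonneg (by positivity : 0 ≤ ‖x‖ ^ 2 / R ^ 2)]
      calc _ ≤ b * (R ^ (-b) * 1 * 1) + 2 * (R ^ (-b) * C * 4) := by
            gcongr
            exact hC _
        _ ≤ (1 + b + 8 * C) * R ^ (-b) := by nlinarith
  · intro x hx
    simp only [hg, hg', hS, Real.smoothTransition.zero_of_nonpos (hzero x hx).le,
      deriv_smoothTransition_of_neg (hzero x hx)]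
    simp

lemma ae_const_of_hasWeakDerivAlong_stdVec_zero {n : ℕ} [NeZero n]
    {u : EuclideanSpace ℝ (Fin n) → ℝ}
    (h : ∀ i : Fin n, HasWeakDerivAlong (stdVec i) u fun _ => 0) :
    ∃ b : ℝ, u =ᵐ[volume] fun _ => b := by
  refine ae_const_of_hasWeakDerivAlong_zero fun e => ⟨(h 0).1, (h 0).2.1, fun φ hφ hs => ?_⟩
  have e1 : ∀ x, fderiv ℝ φ x e • u x = ∑ i, e i * (fderiv ℝ φ x (stdVec i) • u x) := by
    intro x
    rw [← real_inner_gradient, euclidean_inner_eq_sum, smul_eq_mul, Finset.sum_mul]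
    simp only [gradient_coord, smul_eq_mul, mul_assoc]
  have e2 : ∀ i : Fin n, ∫ x, fderiv ℝ φ x (stdVec i) • u x = 0 := by
    intro i
    simpa using (h i).2.2 φ hφ hs
  simp only [e1]
  rw [integral_finsetSum _ fun i _ => (((h i).1.integrable_test_smul
    (continuous_fderiv_apply_of_contDiff hφ (stdVec i))
    (hasCompactSupport_fderiv_apply_of hs _)).const_mul (e i))]
  simp only [integral_const_mul, e2]
  simp

/-! ### The growth estimate. -/

namespace StableData

variable {n : ℕ} {f : ℝ → ℝ} {u : EuclideanSpace ℝ (Fin n) → ℝ}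
  {G : EuclideanSpace ℝ (Fin n) → EuclideanSpace ℝ (Fin n)}
  {W : Fin n → EuclideanSpace ℝ (Fin n) → EuclideanSpace ℝ (Fin n)}
  {W₂ : Fin n → Fin n → EuclideanSpace ℝ (Fin n) → EuclideanSpace ℝ (Fin n)}

lemma ae_const_of_gradient_ae_zero [NeZero n] (h : StableData f u G W W₂)
    (hG : G =ᵐ[volume] fun _ => 0) : ∃ b : ℝ, u =ᵐ[volume] fun _ => b :=
  ae_const_of_hasWeakDerivAlong_stdVec_zero fun i => (h.weak_u i).congr EventuallyEq.rfl (by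
    filter_upwards [hG] with x hx
    simp [hx])

/-- The part of the fundamental inequality that controls the gradient inside a ball. -/
noncomputable def coreDensity (G : EuclideanSpace ℝ (Fin n) → EuclideanSpace ℝ (Fin n))
    (x : EuclideanSpace ℝ (Fin n)) : ℝ :=
  ((1 + ‖x‖ ^ 2) ^ (-testDecay n / 2)) ^ 2 * (mcFactor (G x) *
    ((n - 1 - mcFactor (G x) ^ 2) * ‖G x‖ ^ 2 / (1 + ‖x‖ ^ 2)))

lemma mcFactor_sq_le_one (p : EuclideanSpace ℝ (Fin n)) : mcFactor p ^ 2 ≤ 1 :=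
  pow_le_one₀ (mcFactor_pos p).le (mcFactor_le_one p)

lemma coreDensity_nonneg (hn : 2 ≤ n) (x : EuclideanSpace ℝ (Fin n)) : 0 ≤ coreDensity G x := by
  have h2 : (2 : ℝ) ≤ n := by exact_mod_cast hn
  have h1 : 0 ≤ (n : ℝ) - 1 - mcFactor (G x) ^ 2 := by linarith [mcFactor_sq_le_one (G x)]
  have := mcFactor_pos (G x)
  unfold coreDensity
  positivity

/-- A nonzero gradient makes `mcFactor` strictly less than 1, so n − 1 − `mcFactor (G x) ^ 2` is
positive even for n = 2. -/
lemma eq_zero_of_coreDensity_eq_zero (hn : 2 ≤ n) {x : EuclideanSpace ℝ (Fin n)}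
    (h : coreDensity G x = 0) : G x = 0 := by
  by_contra hG
  have hG0 : 0 < ‖G x‖ := norm_pos_iff.2 hG
  have h2 : (2 : ℝ) ≤ n := by exact_mod_cast hn
  have hσ := mcFactor_pos (G x)
  have h3 : mcFactor (G x) ^ 2 < 1 := by
    have := mcFactor_sq (G x)
    have : 0 < mcFactor (G x) ^ 2 * ‖G x‖ ^ 2 := by positivity
    linarith
  have h1 : 0 < (n : ℝ) - 1 - mcFactor (G x) ^ 2 := by linarith
  have h4 : 0 < (1 + ‖x‖ ^ 2) ^ (-testDecay n / 2) := Real.rpow_pos_of_pos (by positivity) _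
  have : 0 < coreDensity G x := by
    unfold coreDensity
    positivity
  exact this.ne' h

lemma coreDensity_le (hn : 2 ≤ n) (x : EuclideanSpace ℝ (Fin n)) :
    coreDensity G x ≤ n * ‖G x‖ := by
  have h2 : (2 : ℝ) ≤ n := by exact_mod_cast hn
  have hb := testDecay_nonneg hn
  have hσ := mcFactor_pos (G x)
  have h0 : 0 ≤ (n : ℝ) - 1 - mcFactor (G x) ^ 2 := by linarith [mcFactor_sq_le_one (G x)]
  have hx : 1 ≤ 1 + ‖x‖ ^ 2 := by linarith [sq_nonneg ‖x‖]
  have h4 : (1 + ‖x‖ ^ 2) ^ (-testDecay n / 2) ≤ 1 :=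
    Real.rpow_le_one_of_one_le_of_nonpos hx (by linarith)
  have h5 : 0 ≤ (1 + ‖x‖ ^ 2) ^ (-testDecay n / 2) := by positivity
  unfold coreDensity
  calc _ ≤ 1 * (mcFactor (G x) * ((n - 1 - mcFactor (G x) ^ 2) * ‖G x‖ ^ 2 / (1 + ‖x‖ ^ 2))) := by
        gcongr
        exact pow_le_one₀ h5 h4
    _ ≤ 1 * (mcFactor (G x) * ((n - 1 - mcFactor (G x) ^ 2) * ‖G x‖ ^ 2)) := by
        gcongr
        exact div_le_self (by positivity) hx
    _ ≤ 1 * (mcFactor (G x) * (n * ‖G x‖ ^ 2)) := by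
        gcongr
        linarith [sq_nonneg (mcFactor (G x))]
    _ = n * ‖G x‖ * (mcFactor (G x) * ‖G x‖) := by ring
    _ ≤ n * ‖G x‖ * 1 := by
        gcongr
        exact mcFactor_mul_norm_le_one _
    _ = _ := mul_one _

lemma locallyIntegrable_coreDensity [NeZero n] (hn : 2 ≤ n) (h : StableData f u G W W₂) :
    LocallyIntegrable (coreDensity G) volume := by
  have hG := h.locallyIntegrable_G
  have hGm := hG.aestronglyMeasurable
  refine ((locallyIntegrable_norm hG).smul (n : ℝ)).mono ?_ (Eventually.of_forall fun x => ?_)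
  · have hσ : AEStronglyMeasurable (fun x => mcFactor (G x)) volume :=
      (contDiff_mcFactor (V := EuclideanSpace ℝ (Fin n))).continuous.comp_aestronglyMeasurable hGm
    have hc : Continuous fun x : EuclideanSpace ℝ (Fin n) =>
        ((1 + ‖x‖ ^ 2) ^ (-testDecay n / 2)) ^ 2 :=
      ((continuous_const.add (continuous_norm.pow 2)).rpow_const fun x =>
        Or.inl (by positivity : (1 + ‖x‖ ^ 2) ≠ 0)).pow 2
    have hc2 : Continuous fun x : EuclideanSpace ℝ (Fin n) => (1 + ‖x‖ ^ 2)⁻¹ :=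
      (continuous_const.add (continuous_norm.pow 2)).inv₀ fun x =>
        (by positivity : (1 + ‖x‖ ^ 2) ≠ 0)
    refine (hc.aestronglyMeasurable.mul (hσ.mul
      ((((aestronglyMeasurable_const (b := (n : ℝ) - 1)).sub (hσ.pow 2)).mul
      (hGm.norm.pow 2)).mul hc2.aestronglyMeasurable))).congr
      (Eventually.of_forall fun x => ?_)
    simp only [coreDensity, div_eq_mul_inv, Pi.mul_apply, Pi.sub_apply, Pi.pow_apply]
  · rw [Real.norm_of_nonneg (coreDensity_nonneg hn x)]
    exact (coreDensity_le hn x).trans (le_abs_self _)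

lemma exists_integral_coreDensity_pos [NeZero n] (hn : 2 ≤ n) (h : StableData f u G W W₂)
    (hu : ¬ ∃ b : ℝ, u =ᵐ[volume] fun _ => b) :
    ∃ k : ℕ, 0 < ∫ x in ball 0 (k : ℝ), coreDensity G x := by
  by_contra! hc
  refine hu (h.ae_const_of_gradient_ae_zero ?_)
  have hz : ∀ k : ℕ, ∀ᵐ x, x ∈ ball (0 : EuclideanSpace ℝ (Fin n)) (k : ℝ) → G x = 0 := by
    intro k
    have hi : IntegrableOn (coreDensity G) (ball 0 (k : ℝ)) volume :=
      ((h.locallyIntegrable_coreDensity hn).integrableOn_isCompact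
        (isCompact_closedBall 0 (k : ℝ))).mono_set ball_subset_closedBall
    have h0 : ∫ x in ball 0 (k : ℝ), coreDensity G x = 0 :=
      le_antisymm (hc k) (integral_nonneg fun x => coreDensity_nonneg hn x)
    rw [integral_eq_zero_iff_of_nonneg (fun x => coreDensity_nonneg hn x) hi,
      EventuallyEq, ae_restrict_iff' measurableSet_ball] at h0
    filter_upwards [h0] with x hx hxk
    exact eq_zero_of_coreDensity_eq_zero hn (hx hxk)
  filter_upwards [ae_all_iff.2 hz] with x hx
  obtain ⟨k, hk⟩ := exists_nat_gt ‖x‖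
  exact hx k (by simpa using hk)

/-- The energy in a dyadic annulus controls the energy in a fixed ball. -/
lemma integral_coreDensity_le [NeZero n] (hn : 2 ≤ n) (h : StableData f u G W W₂) :
    ∃ M : ℝ, 0 < M ∧ ∀ R : ℝ, 0 < R → ∀ r ≤ R,
      IntegrableOn (fun x => ‖G x‖ ^ 2) (ball 0 (2 * R) \ ball 0 R) volume →
      ∫ x in ball 0 r, coreDensity G x ≤
        9 * (M * R ^ (-testDecay n)) ^ 2 * ∫ x in ball 0 (2 * R) \ ball 0 R, ‖G x‖ ^ 2 := by
  obtain ⟨M, hM, hcut⟩ := exists_radial_cutoff n (testDecay_nonneg hn)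
  refine ⟨M, hM, fun R hR r hrR hann => ?_⟩
  obtain ⟨η, κ, hη, hs, hgrad, hin, hmid, hout⟩ := hcut R hR
  obtain ⟨iD, hD⟩ := h.integral_stabilityDensity_nonneg hη hs
  set A := ball (0 : EuclideanSpace ℝ (Fin n)) (2 * R) \ ball 0 R
  set N := M * R ^ (-testDecay n)
  have hA : MeasurableSet A := measurableSet_ball.diff measurableSet_ball
  have hi : IntegrableOn (coreDensity G) (ball 0 r) volume :=
    ((h.locallyIntegrable_coreDensity hn).integrableOn_isCompact
      (isCompact_closedBall 0 r)).mono_set ball_subset_closedBall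
  have i1 : Integrable ((ball 0 r).indicator (coreDensity G)) volume :=
    hi.integrable_indicator measurableSet_ball
  have i2 : Integrable (A.indicator fun x => 9 * N ^ 2 * ‖G x‖ ^ 2) volume :=
    IntegrableOn.integrable_indicator (Integrable.const_mul hann (9 * N ^ 2)) hA
  -- Negative inside B_R by the choice of the decay rate, of size N²|G|² in the annulus, and zero
  -- outside B_{2R}. Discarding the negative part between r and R keeps the left side of the
  -- estimate fixed as R grows.
  have hle : ∀ x, stabilityDensity G η x ≤
      A.indicator (fun x => 9 * N ^ 2 * ‖G x‖ ^ 2) x - (ball 0 r).indicator (coreDensity G) x := by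
    intro x
    rcases lt_or_ge ‖x‖ R with hx | hx
    · have hxA : x ∉ A := fun hxA => hxA.2 (by simpa using hx)
      rw [Set.indicator_of_notMem hxA, zero_sub]
      have hd : stabilityDensity G η x ≤ -coreDensity G x := by
        have := stabilityDensity_le_of_gradient_eq (G := G) hn (hgrad x) (hin x hx).2
        rwa [(hin x hx).1] at this
      exact hd.trans (neg_le_neg (Set.indicator_le_self' (fun _ _ => coreDensity_nonneg hn _) x))
    · have hxr : x ∉ ball (0 : EuclideanSpace ℝ (Fin n)) r := by
        simpa using hrR.trans hx
      rw [Set.indicator_of_notMem hxr, sub_zero]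
      rcases lt_or_ge ‖x‖ (2 * R) with hx2 | hx2
      · have hxA : x ∈ A := ⟨by simpa using hx2, by simpa using hx⟩
        rw [Set.indicator_of_mem hxA]
        exact stabilityDensity_le_of_abs_le (hgrad x) (hmid x hx hx2).1 (hmid x hx hx2).2
      · have hxA : x ∉ A := fun hxA => absurd hxA.1 (by simpa using hx2)
        rw [Set.indicator_of_notMem hxA, stabilityDensity_of_gradient_eq (hgrad x),
          (hout x hx2).1, (hout x hx2).2]
        simp
  have h1 := hD.trans (integral_mono iD (i2.sub i1) hle)
  rw [integral_sub' i2 i1, integral_indicator hA, integral_indicator measurableSet_ball,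
    integral_const_mul] at h1
  linarith

lemma volume_annulus_le [NeZero n] {R : ℝ} (hR : 0 < R) :
    volume (ball (0 : EuclideanSpace ℝ (Fin n)) (2 * R) \ ball 0 R) ≤
      ENNReal.ofReal ((2 * R) ^ n * volume.real (ball (0 : EuclideanSpace ℝ (Fin n)) 1)) := by
  refine (measure_mono Set.sdiff_subset).trans (le_of_eq ?_)
  rw [Measure.addHaar_ball _ _ (by positivity), finrank_euclideanSpace_fin,
    ENNReal.ofReal_mul (by positivity), measureReal_def,
    ENNReal.ofReal_toReal measure_ball_lt_top.ne]

/-- The lower growth estimate for the gradient of a nonconstant stable solution. -/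
lemma le_laverage_annulus [NeZero n] (hn : 2 ≤ n) (h : StableData f u G W W₂)
    (hu : ¬ ∃ b : ℝ, u =ᵐ[volume] fun _ => b) :
    ∃ c : ℝ, 0 < c ∧ ∃ R₀ : ℝ, 2 < R₀ ∧ ∀ R : ℝ, R₀ ≤ R →
      ENNReal.ofReal (c * R ^ (2 * liouvilleExponent n)) ≤
        ⨍⁻ x in ball (0 : EuclideanSpace ℝ (Fin n)) (2 * R) \ ball 0 R, ‖G x‖ₑ ^ 2 ∂volume := by
  obtain ⟨k, hk⟩ := h.exists_integral_coreDensity_pos hn hu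
  obtain ⟨M, hM, hMR⟩ := h.integral_coreDensity_le hn
  set V := volume.real (ball (0 : EuclideanSpace ℝ (Fin n)) 1)
  have hV : 0 < V := ENNReal.toReal_pos (measure_ball_pos _ _ one_pos).ne' measure_ball_lt_top.ne
  set c₀ := ∫ x in ball 0 (k : ℝ), coreDensity G x
  refine ⟨c₀ / (9 * M ^ 2 * (2 ^ n * V)), by positivity, max 3 k,
    lt_max_of_lt_left (by norm_num), fun R hR => ?_⟩
  have hR0 : 0 < R := by linarith [(le_max_left (3 : ℝ) k).trans hR]
  set A := ball (0 : EuclideanSpace ℝ (Fin n)) (2 * R) \ ball 0 R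
  have hGm := h.locallyIntegrable_G.aestronglyMeasurable
  have hμ : volume A ≠ ⊤ := ((measure_mono Set.sdiff_subset).trans_lt measure_ball_lt_top).ne
  have hkR : (k : ℝ) ≤ R := (le_max_right _ _).trans hR
  -- If the annulus were null, the energy estimate would make the positive constant c₀ nonpositive.
  have hμ0 : volume A ≠ 0 := by
    intro h0
    have := hMR R hR0 k hkR (IntegrableOn.of_measure_zero h0)
    rw [setIntegral_measure_zero _ h0, mul_zero] at this
    linarith
  rw [setLAverage_eq, ENNReal.le_div_iff_mul_le (Or.inl hμ0) (Or.inl hμ)]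
  -- Local square integrability of G is not available, and an infinite annular integral makes the
  -- bound trivial.
  rcases eq_or_ne (∫⁻ x in A, ‖G x‖ₑ ^ 2) ⊤ with htop | htop
  · rw [htop]
    exact le_top
  have hen : ∀ x, ‖‖G x‖ ^ 2‖ₑ = ‖G x‖ₑ ^ 2 := fun x => by
    rw [enorm_pow, enorm_norm]
  have hann : IntegrableOn (fun x => ‖G x‖ ^ 2) A volume := by
    refine ⟨(hGm.norm.pow 2).restrict, ?_⟩
    rw [hasFiniteIntegral_iff_enorm]
    simpa only [hen] using htop.lt_top
  have hint : ENNReal.ofReal (∫ x in A, ‖G x‖ ^ 2) = ∫⁻ x in A, ‖G x‖ₑ ^ 2 := by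
    rw [ofReal_integral_eq_lintegral_ofReal hann (Eventually.of_forall fun x => by positivity)]
    refine lintegral_congr fun x => ?_
    rw [ENNReal.ofReal_pow (norm_nonneg _), ofReal_norm]
  have hmain := hMR R hR0 k hkR hann
  refine (mul_le_mul_right (volume_annulus_le hR0) _).trans ?_
  rw [← hint, ← ENNReal.ofReal_mul (by positivity)]
  refine ENNReal.ofReal_le_ofReal ?_
  have hRb : 0 < R ^ testDecay n := Real.rpow_pos_of_pos hR0 _
  -- The numerator comes from the size of the test function and the denominator from the volume of
  -- the annulus.
  have e1 : R ^ (2 * liouvilleExponent n) = (R ^ testDecay n) ^ 2 / R ^ n := by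
    rw [two_mul_liouvilleExponent, Real.rpow_sub hR0, Real.rpow_natCast, mul_comm (2 : ℝ),
      Real.rpow_mul hR0.le, ← Real.rpow_natCast (R ^ testDecay n)]
    norm_num
  rw [Real.rpow_neg hR0.le] at hmain
  rw [e1, mul_pow]
  have e2 : c₀ / (9 * M ^ 2 * (2 ^ n * V)) * ((R ^ testDecay n) ^ 2 / R ^ n) *
      (2 ^ n * R ^ n * V) = c₀ * ((R ^ testDecay n) ^ 2 / (9 * M ^ 2)) := by
    field_simp
  have e3 : (9 * (M * (R ^ testDecay n)⁻¹) ^ 2 * ∫ x in A, ‖G x‖ ^ 2) *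
      ((R ^ testDecay n) ^ 2 / (9 * M ^ 2)) = ∫ x in A, ‖G x‖ ^ 2 := by
    field_simp
  rw [e2, ← e3]
  gcongr

end StableData

/-- Functions in `W^{3,1}_loc` are identified up to null sets, so "constant" means constant almost
everywhere. The average of `|∇u|²` is taken in `[0, ∞]`, since `|∇u|²` need not be integrable.
The growth condition is understood for almost every `x`, as `|x| → ∞`. -/
theorem theorem1p6 (n : ℕ) (hn : 2 ≤ n) (f : ℝ → ℝ) (hf : ContDiff ℝ 1 f)
    (u : EuclideanSpace ℝ (Fin n) → ℝ) (hu : MemSobolevLoc 3 u) (hstable : IsStableSolution f u)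
    (G : EuclideanSpace ℝ (Fin n) → EuclideanSpace ℝ (Fin n)) (hG : HasWeakGradient u G) :
    ((¬ ∃ b : ℝ, u =ᵐ[volume] fun _ => b) →
      ∃ c : ℝ, 0 < c ∧ ∃ R₀ : ℝ, 2 < R₀ ∧ ∀ R : ℝ, R₀ ≤ R →
        ENNReal.ofReal (c * R ^ (2 * liouvilleExponent n)) ≤
          ⨍⁻ x in ball (0 : EuclideanSpace ℝ (Fin n)) (2 * R) \ ball 0 R,
            ‖G x‖ₑ ^ 2 ∂volume) ∧
    (G =o[Bornology.cobounded (EuclideanSpace ℝ (Fin n)) ⊓ ae volume]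
        (fun x => ‖x‖ ^ liouvilleExponent n) →
      ∃ b : ℝ, u =ᵐ[volume] fun _ => b) := by
  have : NeZero n := ⟨by omega⟩
  obtain ⟨W, W₂, h⟩ := exists_stableData hf hu hstable hG
  refine ⟨h.le_laverage_annulus hn, fun hlo => ?_⟩
  by_contra hconst
  obtain ⟨c, hc, R₀, hR₀, hlow⟩ := h.le_laverage_annulus hn hconst
  have hq := liouvilleExponent_nonpos n
  -- With this constant the average is at most c/4 times R^(2q_n), strictly below the lower bound c
  -- R^(2q_n).
  have hε : 0 < √c / 2 := by positivity
  obtain ⟨s, hs, t, ht, hst⟩ := eventually_inf.1 (hlo.def hε)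
  obtain ⟨r, -, hr⟩ := (hasBasis_cobounded_norm (E := EuclideanSpace ℝ (Fin n))).mem_iff.1 hs
  set R := max R₀ r
  have hR0 : 0 < R := by linarith [le_max_left R₀ r]
  set A := ball (0 : EuclideanSpace ℝ (Fin n)) (2 * R) \ ball 0 R
  have hA : MeasurableSet A := measurableSet_ball.diff measurableSet_ball
  have hRq : 0 < R ^ (2 * liouvilleExponent n) := Real.rpow_pos_of_pos hR0 _
  -- As the exponent is nonpositive, |x|^(q_n) ≤ R^(q_n) throughout the annulus.
  have hup : ⨍⁻ x in A, ‖G x‖ₑ ^ 2 ∂volume ≤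
      ENNReal.ofReal (c / 4 * R ^ (2 * liouvilleExponent n)) := by
    rw [setLAverage_eq]
    refine ENNReal.div_le_of_le_mul ?_
    rw [← setLIntegral_const]
    refine setLIntegral_mono_ae' hA ?_
    filter_upwards [ht] with x hxt hxA
    have hxR : R ≤ ‖x‖ := by simpa using hxA.2
    have hx := hst x ⟨hr ((le_max_right _ _).trans hxR), hxt⟩
    rw [Real.norm_of_nonneg (Real.rpow_nonneg (norm_nonneg x) _)] at hx
    rw [← ofReal_norm, ← ENNReal.ofReal_pow (norm_nonneg _)]
    refine ENNReal.ofReal_le_ofReal ?_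
    calc ‖G x‖ ^ 2 ≤ (√c / 2 * R ^ liouvilleExponent n) ^ 2 := by
          gcongr
          exact hx.trans (mul_le_mul_of_nonneg_left
            (Real.rpow_le_rpow_of_nonpos hR0 hxR hq) hε.le)
      _ = c / 4 * R ^ (2 * liouvilleExponent n) := by
          rw [mul_pow, div_pow, Real.sq_sqrt hc.le, mul_comm 2 (liouvilleExponent n),
            Real.rpow_mul hR0.le]
          norm_num
  have := (ENNReal.ofReal_le_ofReal_iff (by positivity)).1 ((hlow R (le_max_left _ _)).trans hup)
  nlinarith
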